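/- **Setting.** Let $M$ be a closed, oriented, smooth 4-manifold with Riemannian metric $g$, Levi-Civita connection $\nabla$, scalar curvature $R$ and volume measure $dV$. For smooth $f:M\to\mathbb R$ put $R_f=R+2\Delta f-|\nabla f|^2$, where $\Delta=\operatorname{div}\nabla$, and let $$\lambda(g)=\inf\Big\{\int_M R_h\,e^{-h}\,dV \;:\; h\in C^\infty(M),\ \int_M e^{-h}\,dV=1\Big\}$$ be Perelman's $\lambda$-entropy. A minimizer of the $\lambda$-entropy is a smooth $f$ with $\int_M e^{-f}dV=1$ and $\int_M R_f e^{-f}dV=\lambda(g)$. Let $\mathfrak s$ be a spin-c structure on $(M,g)$: Hermitian rank-two bundles $W^\pm$ and a Hermitian line bundle $L=\det W^+$, with Clifford multiplication by tangent vectors exchanging $W^+$ and $W^-$, skew-adjoint and satisfying $X\cdot Y\cdot+\,Y\cdot X\cdot=-2\langle X,Y\rangle$, such that $-e_1e_2e_3e_4=1$ on $W^+$ for oriented orthonormal frames. A unitary connection $A$ on $L$ with curvature $F_A$ determines the unitary spin-c connection $\nabla^A$ on $W^\pm$ (the one for which Clifford multiplication is parallel and which induces $A$ on $L$) and the Dirac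 operator $D_A=\sum_i e_i\cdot\nabla^A_{e_i}:\Gamma(W^+)\to\Gamma(W^-)$. Write $D_{A,f}=e^{f/2}D_Ae^{-f/2}$ and $(\phi\otimes\phi^*)^\circ=\phi\otimes\phi^*-\tfrac12|\phi|^2\mathbb 1$, and let $F_A^+\cdot$ denote the Clifford action of the self-dual part of $F_A$ on $W^+$ (with $e_i\wedge e_j$ acting as $e_i\cdot e_j\cdot$ for $i<j$). A monopole is a pair $(A,\phi)$, with $\phi$ a smooth section of $W^+$, such that $$F_A^+\cdot=(\phi\otimes\phi^*)^\circ,\qquad D_A\phi=0;$$ it is irreducible if $\phi\not\equiv0$. **Theorem.** Let $(A,\phi)$ be an irreducible monopole on $(M^4,g)$, let $f$ be a minimizer of the $\lambda$-entropy, and let $\psi=e^{f/2}\phi$. Then $(A,\psi)$ solves the weighted monopole equations $$F_A^+\cdot=e^{-f}(\psi\otimes\psi^*)^\circ,\qquad D_{A,f}\psi=0,$$ the integrals below are finite, the denominator is positive, and $$\lambda(g)=-\frac{\displaystyle\int_M\big(4|\nabla^A\psi|^2+e^{-f}|\psi|^4\big)\,e^{-f}\,dV}{\displaystyle\int_M|\psi|^2\,e^{-f}\,dV}.$$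 -/

import Mathlib

open scoped Manifold ContDiff Bundle Topology InnerProductSpace
open MeasureTheory

noncomputable section

namespace SWEntropy

/-- The model space `ℝ⁴`. -/
abbrev E4 : Type := EuclideanSpace ℝ (Fin 4)

/-- A smooth Riemannian metric on a 4-manifold. -/
abbrev Metric4 (M : Type*) [TopologicalSpace M] [ChartedSpace E4 M] [IsManifold (𝓡 4) ∞ M] :=
  Bundle.ContMDiffRiemannianMetric (𝓡 4) ∞ E4 (TangentSpace (𝓡 4) : M → Type _)

section Riemannian

variable {M : Type*} [TopologicalSpace M] [ChartedSpace E4 M] [IsManifold (𝓡 4) ∞ M]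

/-- Differentiability at `x` of a section of a vector bundle with model fibre `F`. -/
abbrev DiffSecAt (F : Type*) [NormedAddCommGroup F] [NormedSpace ℝ F] {V : M → Type*}
    [TopologicalSpace (Bundle.TotalSpace F V)] [∀ x, TopologicalSpace (V x)] [FiberBundle F V]
    (s : Π x : M, V x) (x : M) : Prop :=
  MDifferentiableAt (𝓡 4) ((𝓡 4).prod 𝓘(ℝ, F))
    (fun y => (Bundle.TotalSpace.mk' F y (s y) : Bundle.TotalSpace F V)) x

/-- Smoothness of a section of a vector bundle with model fibre `F`. -/
abbrev SmoothSec (F : Type*) [NormedAddCommGroup F] [NormedSpace ℝ F] {V : M → Type*}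
    [TopologicalSpace (Bundle.TotalSpace F V)] [∀ x, TopologicalSpace (V x)] [FiberBundle F V]
    (s : Π x : M, V x) : Prop :=
  ContMDiff (𝓡 4) ((𝓡 4).prod 𝓘(ℝ, F)) ∞
    (fun y => (Bundle.TotalSpace.mk' F y (s y) : Bundle.TotalSpace F V))

/-! ### Orthonormal frames -/

theorem exists_orthonormal_basis (g : Metric4 M) (x : M) :
    ∃ e : Module.Basis (Fin 4) ℝ (TangentSpace (𝓡 4) x),
      ∀ i j, g.inner x (e i) (e j) = if i = j then 1 else 0 := by
  let core : InnerProductSpace.Core ℝ (TangentSpace (𝓡 4) x) :=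
    { inner := fun v w => g.inner x v w
      conj_inner_symm := fun v w => by simp [g.symm x v w]
      re_inner_nonneg := fun v => by
        by_cases hv : v = 0
        · simp [hv]
        · simpa using (g.pos x v hv).le
      add_left := fun u v w => by simp
      smul_left := fun u v r => by simp
      definite := fun v hv => by
        by_contra h
        exact (g.pos x v h).ne' hv }
  let _ : NormedAddCommGroup (TangentSpace (𝓡 4) x) := core.toNormedAddCommGroup
  let _ : InnerProductSpace ℝ (TangentSpace (𝓡 4) x) := InnerProductSpace.ofCore core.toCore
  have hfin : FiniteDimensional ℝ (TangentSpace (𝓡 4) x) :=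
    inferInstanceAs (FiniteDimensional ℝ E4)
  have hrank : Module.finrank ℝ (TangentSpace (𝓡 4) x) = 4 := by
    change Module.finrank ℝ E4 = 4
    simp
  let b := (stdOrthonormalBasis ℝ (TangentSpace (𝓡 4) x)).reindex (finCongr hrank)
  refine ⟨b.toBasis, fun i j => ?_⟩
  rw [OrthonormalBasis.coe_toBasis]
  exact orthonormal_iff_ite.mp b.orthonormal i j

/-- A `g`-orthonormal basis of the tangent space at `x`. All constructions below that use it
(traces, gradients) do not depend on which orthonormal basis is taken. -/
def frame (g : Metric4 M) (x : M) : Module.Basis (Fin 4) ℝ (TangentSpace (𝓡 4) x) :=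
  (exists_orthonormal_basis g x).choose

theorem frame_orthonormal (g : Metric4 M) (x : M) (i j : Fin 4) :
    g.inner x (frame g x i) (frame g x j) = if i = j then 1 else 0 :=
  (exists_orthonormal_basis g x).choose_spec i j

theorem frame_expand (g : Metric4 M) (x : M) (v : TangentSpace (𝓡 4) x) :
    ∑ i, g.inner x v (frame g x i) • frame g x i = v := by
  have h : ∀ i, g.inner x v (frame g x i) = (frame g x).repr v i := fun i => by
    have h1 := congrArg (fun w => g.inner x w (frame g x i)) ((frame g x).sum_repr v)
    simp only [map_sum, map_smul, _root_.sum_apply, _root_.smul_apply,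
      frame_orthonormal] at h1
    rw [← h1]
    simp
  simp only [h]
  exact (frame g x).sum_repr v

/-! ### The Levi-Civita connection, through the Koszul formula -/

theorem mdifferentiableAt_metric (g : Metric4 M) {X Y : Π x : M, TangentSpace (𝓡 4) x} {x : M}
    (hX : DiffSecAt E4 X x) (hY : DiffSecAt E4 Y x) :
    MDifferentiableAt (𝓡 4) 𝓘(ℝ) (fun y => g.inner y (X y) (Y y)) x := by
  have h : MDifferentiableAt (𝓡 4) ((𝓡 4).prod 𝓘(ℝ))
      (fun m ↦ Bundle.TotalSpace.mk' ℝ (E := Bundle.Trivial M ℝ) m (g.inner m (X m) (Y m))) x := by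
    apply MDifferentiableAt.clm_bundle_apply₂ (F₁ := E4) (F₂ := E4)
    · exact (g.contMDiff x).mdifferentiableAt (by simp)
    · exact hX
    · exact hY
  simp only [mdifferentiableAt_totalSpace] at h
  exact h.2

/-- The right hand side of the Koszul formula for `2 g(∇_X Y, Z)`. -/
def koszul (g : Metric4 M) (X Y Z : Π x : M, TangentSpace (𝓡 4) x) (x : M) : ℝ :=
  mvfderiv (𝓡 4) (fun y => g.inner y (Y y) (Z y)) x (X x)
    + mvfderiv (𝓡 4) (fun y => g.inner y (X y) (Z y)) x (Y x)
    - mvfderiv (𝓡 4) (fun y => g.inner y (X y) (Y y)) x (Z x)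
    + g.inner x (VectorField.mlieBracket (𝓡 4) X Y x) (Z x)
    - g.inner x (VectorField.mlieBracket (𝓡 4) X Z x) (Y x)
    - g.inner x (VectorField.mlieBracket (𝓡 4) Y Z x) (X x)

theorem koszul_tensorial (g : Metric4 M) {Y Z : Π x : M, TangentSpace (𝓡 4) x} {x : M}
    (hY : DiffSecAt E4 Y x) (hZ : DiffSecAt E4 Z x) :
    TensorialAt (𝓡 4) E4 (fun X => koszul g X Y Z x) x where
  smul {f X} hf hX := by
    have h1 := mvfderiv_fun_mul hf (mdifferentiableAt_metric g hX hZ)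
    have h2 := mvfderiv_fun_mul hf (mdifferentiableAt_metric g hX hY)
    simp [koszul, h1, h2, VectorField.mlieBracket_smul_left hf hX, g.symm x (X x)]
    ring
  add {X X'} hX hX' := by
    have h1 := mvfderiv_fun_add (mdifferentiableAt_metric g hX hZ)
      (mdifferentiableAt_metric g hX' hZ)
    have h2 := mvfderiv_fun_add (mdifferentiableAt_metric g hX hY)
      (mdifferentiableAt_metric g hX' hY)
    simp [koszul, h1, h2, VectorField.mlieBracket_add_left hX hX']
    ring

theorem koszul_add (g : Metric4 M) {X Y Y' Z : Π x : M, TangentSpace (𝓡 4) x} {x : M}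
    (hX : DiffSecAt E4 X x) (hY : DiffSecAt E4 Y x) (hY' : DiffSecAt E4 Y' x)
    (hZ : DiffSecAt E4 Z x) :
    koszul g X (Y + Y') Z x = koszul g X Y Z x + koszul g X Y' Z x := by
  have h1 := mvfderiv_fun_add (mdifferentiableAt_metric g hY hZ)
    (mdifferentiableAt_metric g hY' hZ)
  have h2 := mvfderiv_fun_add (mdifferentiableAt_metric g hX hY)
    (mdifferentiableAt_metric g hX hY')
  simp [koszul, h1, h2, VectorField.mlieBracket_add_left hY hY',
    VectorField.mlieBracket_add_right hY hY']
  ring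

theorem koszul_smul (g : Metric4 M) {X Y Z : Π x : M, TangentSpace (𝓡 4) x} {h : M → ℝ} {x : M}
    (hX : DiffSecAt E4 X x) (hY : DiffSecAt E4 Y x) (hh : MDifferentiableAt (𝓡 4) 𝓘(ℝ) h x)
    (hZ : DiffSecAt E4 Z x) :
    koszul g X (h • Y) Z x
      = h x * koszul g X Y Z x + 2 * (mvfderiv (𝓡 4) h x (X x)) * g.inner x (Y x) (Z x) := by
  have h1 := mvfderiv_fun_mul hh (mdifferentiableAt_metric g hY hZ)
  have h2 := mvfderiv_fun_mul hh (mdifferentiableAt_metric g hX hY)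
  simp [koszul, h1, h2, VectorField.mlieBracket_smul_left hh hY,
    VectorField.mlieBracket_smul_right hh hY, g.symm x (X x)]
  ring

open Classical in
/-- `∇_v Y = ½ ∑ᵢ K(v, Y, eᵢ) eᵢ`, with `K` the right hand side of the Koszul formula and `e` an
orthonormal basis (and `0` at points where `Y` is not differentiable). -/
def leviCivitaFun (g : Metric4 M) (Y : Π x : M, TangentSpace (𝓡 4) x) (x : M) :
    TangentSpace (𝓡 4) x →L[ℝ] TangentSpace (𝓡 4) x :=
  if hY : DiffSecAt E4 Y x then
    ∑ i, ((1 / 2 : ℝ) • TensorialAt.mkHom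
      (fun X => koszul g X Y (FiberBundle.extend E4 (frame g x i)) x) x
        (koszul_tensorial g hY (FiberBundle.mdifferentiableAt_extend ..))).smulRight (frame g x i)
  else 0

theorem leviCivitaFun_apply (g : Metric4 M) {Y : Π x : M, TangentSpace (𝓡 4) x} {x : M}
    (hY : DiffSecAt E4 Y x) (v : TangentSpace (𝓡 4) x) :
    leviCivitaFun g Y x v = ∑ i, ((1 / 2 : ℝ) *
      koszul g (FiberBundle.extend E4 v) Y (FiberBundle.extend E4 (frame g x i)) x) •
        frame g x i := by
  simp [leviCivitaFun, hY, TensorialAt.mkHom_apply_eq_extend]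

/-- The Levi-Civita connection of `g`. -/
def leviCivita (g : Metric4 M) :
    CovariantDerivative (𝓡 4) E4 (TangentSpace (𝓡 4) : M → Type _) where
  toFun := leviCivitaFun g
  isCovariantDerivativeOnUniv :=
    { add := by
        intro Y Y' x hY hY' _
        ext1 v
        have hs : DiffSecAt E4 (Y + Y') x := mdifferentiableAt_add_section hY hY'
        rw [_root_.add_apply, leviCivitaFun_apply g hs, leviCivitaFun_apply g hY,
          leviCivitaFun_apply g hY', ← Finset.sum_add_distrib]
        refine Finset.sum_congr rfl fun i _ => ?_
        rw [koszul_add g (FiberBundle.mdifferentiableAt_extend ..) hY hY' (FiberBundle.mdifferentiableAt_extend ..),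
          mul_add, add_smul]
      leibniz := by
        intro Y h x hY hh _
        ext1 v
        have hs : DiffSecAt E4 (h • Y) x := hh.smul_section hY
        rw [leviCivitaFun_apply g hs]
        have hv := congrArg (fun w => (mvfderiv (𝓡 4) h x v) • w) (frame_expand g x (Y x))
        simp only [Finset.smul_sum] at hv
        simp only [_root_.add_apply, _root_.smul_apply,
          ContinuousLinearMap.smulRight_apply]
        rw [leviCivitaFun_apply g hY, ← hv, Finset.smul_sum, ← Finset.sum_add_distrib]
        refine Finset.sum_congr rfl fun i _ => ?_
        rw [koszul_smul g (FiberBundle.mdifferentiableAt_extend ..) hY hh (FiberBundle.mdifferentiableAt_extend ..)]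
        simp only [FiberBundle.extend_apply_self, smul_smul, ← add_smul]
        congr 1
        ring }

/-! ### Curvature, gradient, Laplacian -/

/-- The curvature `R(v, w) s = ∇_X ∇_Y σ - ∇_Y ∇_X σ - ∇_{[X, Y]} σ` of a connection, where `X`, `Y`,
`σ` extend `v`, `w`, `s` (the extensions used are smooth near `x`). -/
def curvature {F : Type*} [NormedAddCommGroup F] [NormedSpace ℝ F] {V : M → Type*}
    [TopologicalSpace (Bundle.TotalSpace F V)] [∀ x, AddCommGroup (V x)] [∀ x, Module ℝ (V x)]
    [∀ x, TopologicalSpace (V x)] [∀ x, IsTopologicalAddGroup (V x)]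
    [∀ x, ContinuousSMul ℝ (V x)] [FiberBundle F V]
    (D : CovariantDerivative (𝓡 4) F V) (x : M) (v w : TangentSpace (𝓡 4) x) (s : V x) : V x :=
  let X : Π y : M, TangentSpace (𝓡 4) y := FiberBundle.extend E4 v
  let Y : Π y : M, TangentSpace (𝓡 4) y := FiberBundle.extend E4 w
  let σ : Π y : M, V y := FiberBundle.extend F s
  D (fun y => D σ y (Y y)) x v - D (fun y => D σ y (X y)) x w
    - D σ x (VectorField.mlieBracket (𝓡 4) X Y x)

/-- The scalar curvature `R = ∑ᵢⱼ g(R(eᵢ, eⱼ) eⱼ, eᵢ)`. -/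
def scalarCurvature (g : Metric4 M) (x : M) : ℝ :=
  ∑ i, ∑ j, g.inner x
    (curvature (leviCivita g) x (frame g x i) (frame g x j) (frame g x j)) (frame g x i)

/-- The gradient of a function. -/
def grad (g : Metric4 M) (f : M → ℝ) (x : M) : TangentSpace (𝓡 4) x :=
  ∑ i, mvfderiv (𝓡 4) f x (frame g x i) • frame g x i

/-- The Laplacian `Δ f = div (grad f)`. -/
def laplacian (g : Metric4 M) (f : M → ℝ) (x : M) : ℝ :=
  ∑ i, g.inner x (leviCivita g (grad g f) x (frame g x i)) (frame g x i)

/-- The weighted scalar curvature `R_f = R + 2 Δ f - |∇ f|²`. -/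
def weightedScalarCurvature (g : Metric4 M) (f : M → ℝ) (x : M) : ℝ :=
  scalarCurvature g x + 2 * laplacian g f x - g.inner x (grad g f x) (grad g f x)

/-! ### Riemannian volume and the `λ`-entropy -/

/-- The matrix `g_{ij}` of the metric at the point with coordinates `y` in the chart at `x`. -/
def chartGram (g : Metric4 M) (x : M) (y : E4) : Matrix (Fin 4) (Fin 4) ℝ :=
  Matrix.of fun i j => g.inner ((chartAt E4 x).symm y)
    (mfderiv 𝓘(ℝ, E4) (𝓡 4) (chartAt E4 x).symm y (EuclideanSpace.single i (1 : ℝ)))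
    (mfderiv 𝓘(ℝ, E4) (𝓡 4) (chartAt E4 x).symm y (EuclideanSpace.single j (1 : ℝ)))

variable [MeasurableSpace M] [BorelSpace M]

/-- The measure `√(det g_{ij}) dy` of the chart at `x`, carried to `M`. -/
def chartVolume (g : Metric4 M) (x : M) : Measure M :=
  ((volume.restrict (chartAt E4 x).target).withDensity
    (fun y => ENNReal.ofReal (Real.sqrt (chartGram g x y).det))).map (chartAt E4 x).symm

/-- The Riemannian volume measure `dV_g`: the least measure that dominates the volume measure of
every chart. (As these agree on overlaps, it restricts to each of them on its chart domain.) -/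
def riemannianVolume (g : Metric4 M) : Measure M := ⨆ x, chartVolume g x

/-- The weighted Hilbert-Einstein functional `∫ R_f e^{-f} dV`. -/
def hilbertEinstein (g : Metric4 M) (f : M → ℝ) : ℝ :=
  ∫ x, weightedScalarCurvature g f x * Real.exp (-f x) ∂(riemannianVolume g)

/-- Smooth functions with `∫ e^{-f} dV = 1`. -/
def Normalized (g : Metric4 M) (f : M → ℝ) : Prop :=
  ContMDiff (𝓡 4) 𝓘(ℝ) ∞ f ∧ ∫ x, Real.exp (-f x) ∂(riemannianVolume g) = 1

/-- Perelman's `λ`-entropy `λ(g) = inf {∫ R_f e^{-f} dV : ∫ e^{-f} dV = 1}`. -/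
def lambdaEntropy (g : Metric4 M) : ℝ :=
  sInf (hilbertEinstein g '' {f | Normalized g f})

/-- `f` is a minimizer of the `λ`-entropy. -/
def IsLambdaMinimizer (g : Metric4 M) (f : M → ℝ) : Prop :=
  Normalized g f ∧ ∀ h : M → ℝ, Normalized g h → hilbertEinstein g f ≤ hilbertEinstein g h

end Riemannian

/-! ### Orientations -/

section Orientation

variable (M : Type*) [TopologicalSpace M] [ChartedSpace E4 M] [IsManifold (𝓡 4) ∞ M]

/-- An orientation of a 4-manifold: a choice of orientation of each tangent space such that a
smooth family of vector fields that is a positive basis at a point is a positive basis at all nearby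
points. -/
structure Orientation4 where
  orient : ∀ x : M, Orientation ℝ (TangentSpace (𝓡 4) x) (Fin 4)
  locally_constant : ∀ (X : Fin 4 → Π x : M, TangentSpace (𝓡 4) x), (∀ i, SmoothSec E4 (X i)) →
    ∀ x : M, (∃ b : Module.Basis (Fin 4) ℝ (TangentSpace (𝓡 4) x),
        (∀ i, b i = X i x) ∧ b.orientation = orient x) →
      ∀ᶠ y in 𝓝 x, ∃ b : Module.Basis (Fin 4) ℝ (TangentSpace (𝓡 4) y),
        (∀ i, b i = X i y) ∧ b.orientation = orient y

variable {M}

/-- A positively oriented `g`-orthonormal basis of the tangent space at `x`. -/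
def orientedFrame (g : Metric4 M) (o : Orientation4 M) (x : M) :
    Module.Basis (Fin 4) ℝ (TangentSpace (𝓡 4) x) :=
  (frame g x).adjustToOrientation (o.orient x)

end Orientation

/-! ### Spin-c structures, spin-c connections and monopoles -/

section SpinC

/-- The model fibre of a complex vector bundle of rank two. -/
abbrev C2 : Type := EuclideanSpace ℂ (Fin 2)

variable {M : Type*} [TopologicalSpace M] [ChartedSpace E4 M] [IsManifold (𝓡 4) ∞ M]

/-- The Hermitian metric on the fibres of `V` depends smoothly on the base point. -/
class SmoothHermitian (F : Type*) [NormedAddCommGroup F] [NormedSpace ℝ F] (V : M → Type*)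
    [∀ x, NormedAddCommGroup (V x)] [∀ x, InnerProductSpace ℂ (V x)]
    [TopologicalSpace (Bundle.TotalSpace F V)] [FiberBundle F V] : Prop where
  smooth_inner : ∀ s t : Π x : M, V x, SmoothSec F s → SmoothSec F t →
    ContMDiff (𝓡 4) 𝓘(ℝ, ℂ) ∞ (fun x => ⟪s x, t x⟫_ℂ)

/-- Smooth unitary connections on a Hermitian bundle. (The product rule for the Hermitian form also
makes `D` complex linear.) -/
structure IsUnitaryConnection {F : Type*} [NormedAddCommGroup F] [NormedSpace ℝ F]
    {V : M → Type*} [∀ x, NormedAddCommGroup (V x)] [∀ x, InnerProductSpace ℂ (V x)]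
    [TopologicalSpace (Bundle.TotalSpace F V)] [FiberBundle F V] [VectorBundle ℝ F V]
    (D : CovariantDerivative (𝓡 4) F V) : Prop where
  smooth : CovariantDerivative.ContMDiffCovariantDerivative D ∞
  unitary : ∀ (s t : Π x : M, V x) (x : M), DiffSecAt F s x → DiffSecAt F t x →
    ∀ v : TangentSpace (𝓡 4) x,
      mvfderiv (𝓡 4) (fun y => ⟪s y, t y⟫_ℂ) x v = ⟪D s x v, t x⟫_ℂ + ⟪s x, D t x v⟫_ℂ

variable (Wp Wm L : M → Type*)
  [∀ x, NormedAddCommGroup (Wp x)] [∀ x, InnerProductSpace ℂ (Wp x)]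
  [TopologicalSpace (Bundle.TotalSpace C2 Wp)] [FiberBundle C2 Wp]
  [VectorBundle ℂ C2 Wp] [VectorBundle ℝ C2 Wp]
  [∀ x, NormedAddCommGroup (Wm x)] [∀ x, InnerProductSpace ℂ (Wm x)]
  [TopologicalSpace (Bundle.TotalSpace C2 Wm)] [FiberBundle C2 Wm]
  [VectorBundle ℂ C2 Wm] [VectorBundle ℝ C2 Wm]
  [∀ x, NormedAddCommGroup (L x)] [∀ x, InnerProductSpace ℂ (L x)]
  [TopologicalSpace (Bundle.TotalSpace ℂ L)] [FiberBundle ℂ L]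
  [VectorBundle ℂ ℂ L] [VectorBundle ℝ ℂ L]

/-- A spin-c structure on the oriented Riemannian manifold `(M, g, o)` with spinor bundles `W⁺`, `W⁻`
and determinant line bundle `L`: Clifford multiplication by tangent vectors exchanging `W⁺` and `W⁻`
such that the complex volume element `-e₁e₂e₃e₄` is `1` on `W⁺`, and an isometric isomorphism
`Λ² W⁺ ≅ L`, given as an alternating form on `W⁺` with values in `L`. -/
structure SpinCStructure (g : Metric4 M) (o : Orientation4 M) where
  cP : ∀ x : M, TangentSpace (𝓡 4) x →ₗ[ℝ] Wp x →ₗ[ℂ] Wm x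
  cM : ∀ x : M, TangentSpace (𝓡 4) x →ₗ[ℝ] Wm x →ₗ[ℂ] Wp x
  clifford_P : ∀ (x : M) (v w : TangentSpace (𝓡 4) x) (s : Wp x),
    cM x v (cP x w s) + cM x w (cP x v s) = (-2 * g.inner x v w) • s
  clifford_M : ∀ (x : M) (v w : TangentSpace (𝓡 4) x) (s : Wm x),
    cP x v (cM x w s) + cP x w (cM x v s) = (-2 * g.inner x v w) • s
  skew : ∀ (x : M) (v : TangentSpace (𝓡 4) x) (s : Wp x) (t : Wm x),
    ⟪cP x v s, t⟫_ℂ = -⟪s, cM x v t⟫_ℂ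
  smooth_P : ∀ (X : Π x : M, TangentSpace (𝓡 4) x) (s : Π x : M, Wp x),
    SmoothSec E4 X → SmoothSec C2 s → SmoothSec C2 (fun x => cP x (X x) (s x))
  smooth_M : ∀ (X : Π x : M, TangentSpace (𝓡 4) x) (s : Π x : M, Wm x),
    SmoothSec E4 X → SmoothSec C2 s → SmoothSec C2 (fun x => cM x (X x) (s x))
  chirality : ∀ (x : M) (e : Module.Basis (Fin 4) ℝ (TangentSpace (𝓡 4) x)),
    (∀ i j, g.inner x (e i) (e j) = if i = j then 1 else 0) → e.orientation = o.orient x →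
      ∀ s : Wp x, cM x (e 0) (cP x (e 1) (cM x (e 2) (cP x (e 3) s))) = -s
  det : ∀ x : M, Wp x →ₗ[ℂ] Wp x →ₗ[ℂ] L x
  det_self : ∀ (x : M) (s : Wp x), det x s s = 0
  norm_det : ∀ (x : M) (s t : Wp x),
    ‖det x s t‖ ^ 2 = ‖s‖ ^ 2 * ‖t‖ ^ 2 - ‖⟪s, t⟫_ℂ‖ ^ 2
  smooth_det : ∀ s t : Π x : M, Wp x,
    SmoothSec C2 s → SmoothSec C2 t → SmoothSec ℂ (fun x => det x (s x) (t x))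

variable {Wp Wm L} {g : Metric4 M} {o : Orientation4 M}

/-- A `U(1)`-connection `A` on `L` together with the spin-c connection `∇^A` on `W⁺` and `W⁻` that
it determines: the unitary connection for which Clifford multiplication is parallel and which
induces `A` on `L = Λ² W⁺`. -/
structure SpinCConnection (𝔰 : SpinCStructure Wp Wm L g o) where
  A : CovariantDerivative (𝓡 4) ℂ L
  nablaP : CovariantDerivative (𝓡 4) C2 Wp
  nablaM : CovariantDerivative (𝓡 4) C2 Wm
  unitary_A : IsUnitaryConnection A
  unitary_P : IsUnitaryConnection nablaP
  unitary_M : IsUnitaryConnection nablaM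
  clifford_P : ∀ (X : Π x : M, TangentSpace (𝓡 4) x) (s : Π x : M, Wp x) (x : M),
    DiffSecAt E4 X x → DiffSecAt C2 s x → ∀ v : TangentSpace (𝓡 4) x,
      nablaM (fun y => 𝔰.cP y (X y) (s y)) x v
        = 𝔰.cP x (leviCivita g X x v) (s x) + 𝔰.cP x (X x) (nablaP s x v)
  clifford_M : ∀ (X : Π x : M, TangentSpace (𝓡 4) x) (s : Π x : M, Wm x) (x : M),
    DiffSecAt E4 X x → DiffSecAt C2 s x → ∀ v : TangentSpace (𝓡 4) x,
      nablaP (fun y => 𝔰.cM y (X y) (s y)) x v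
        = 𝔰.cM x (leviCivita g X x v) (s x) + 𝔰.cM x (X x) (nablaM s x v)
  det_compat : ∀ (s t : Π x : M, Wp x) (x : M), DiffSecAt C2 s x → DiffSecAt C2 t x →
    ∀ v : TangentSpace (𝓡 4) x,
      A (fun y => 𝔰.det y (s y) (t y)) x v
        = 𝔰.det x (nablaP s x v) (t x) + 𝔰.det x (s x) (nablaP t x v)

/-- The Levi-Civita symbol `ε_{ijkl}`. -/
def leviCivitaSymbol (i j k l : Fin 4) : ℤ :=
  Matrix.det (Matrix.of fun a b : Fin 4 => if ![i, j, k, l] a = b then (1 : ℤ) else 0)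

namespace SpinCConnection

variable {𝔰 : SpinCStructure Wp Wm L g o} (A : SpinCConnection 𝔰)

/-- The curvature `F_A` of the connection on `L`, as an (imaginary valued) 2-form: the curvature
endomorphism of the line `L x` is multiplication by `F_A`. -/
def curvatureForm (x : M) (v w : TangentSpace (𝓡 4) x) : ℂ :=
  let l : L x := (trivializationAt ℂ L x).symm x 1
  ⟪l, curvature A.A x v w l⟫_ℂ / ⟪l, l⟫_ℂ

/-- Components, in the oriented orthonormal frame, of the self-dual part `(F_A + ⋆F_A) / 2`, where
`(⋆F)_{ij} = ½ ∑ ε_{ijkl} F_{kl}`. -/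
def selfDualCurvature (x : M) (i j : Fin 4) : ℂ :=
  (A.curvatureForm x (orientedFrame g o x i) (orientedFrame g o x j)
    + (1 / 2) * ∑ k, ∑ l, (leviCivitaSymbol i j k l : ℂ) *
        A.curvatureForm x (orientedFrame g o x k) (orientedFrame g o x l)) / 2

/-- The Clifford action `F_A⁺ · χ = ∑_{i<j} (F_A⁺)_{ij} eᵢ · eⱼ · χ` on `W⁺`, written as half of the
sum over all `i, j`. -/
def selfDualAction (x : M) (χ : Wp x) : Wp x :=
  (1 / 2 : ℂ) • ∑ i, ∑ j, A.selfDualCurvature x i j •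
    𝔰.cM x (orientedFrame g o x i) (𝔰.cP x (orientedFrame g o x j) χ)

/-- The spin-c Dirac operator `D_A φ = ∑ eᵢ · ∇^A_{eᵢ} φ`. -/
def dirac (φ : Π x : M, Wp x) (x : M) : Wm x :=
  ∑ i, 𝔰.cP x (frame g x i) (A.nablaP φ x (frame g x i))

/-- The weighted Dirac operator `D_{A,f} = e^{f/2} D_A e^{-f/2}`. -/
def weightedDirac (f : M → ℝ) (ψ : Π x : M, Wp x) (x : M) : Wm x :=
  Real.exp (f x / 2) • A.dirac (fun y => Real.exp (-f y / 2) • ψ y) x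

/-- `|∇^A ψ|²`. -/
def normSqNabla (ψ : Π x : M, Wp x) (x : M) : ℝ :=
  ∑ i, ‖A.nablaP ψ x (frame g x i)‖ ^ 2

/-- The monopole equations `F_A⁺ · = (φ ⊗ φ*)°`, `D_A φ = 0` for a smooth spinor `φ`, where
`(φ ⊗ φ*)° χ = ⟨χ, φ⟩ φ - ½ |φ|² χ`. (Mathlib's inner product is linear in the second slot.) -/
structure IsMonopole (φ : Π x : M, Wp x) : Prop where
  smooth : SmoothSec C2 φ
  curvature_eq : ∀ (x : M) (χ : Wp x),
    A.selfDualAction x χ = ⟪φ x, χ⟫_ℂ • φ x - (‖φ x‖ ^ 2 / 2) • χ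
  dirac_eq : ∀ x, A.dirac φ x = 0

/-- The weighted monopole equations `F_A⁺ · = e^{-f} (ψ ⊗ ψ*)°`, `D_{A,f} ψ = 0`. -/
structure IsWeightedMonopole (f : M → ℝ) (ψ : Π x : M, Wp x) : Prop where
  smooth : SmoothSec C2 ψ
  curvature_eq : ∀ (x : M) (χ : Wp x),
    A.selfDualAction x χ
      = Real.exp (-f x) • (⟪ψ x, χ⟫_ℂ • ψ x - (‖ψ x‖ ^ 2 / 2) • χ)
  dirac_eq : ∀ x, A.weightedDirac f ψ x = 0

end SpinCConnection

end SpinC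

end SWEntropy

end

/-! The weighted equations only rescale the monopole equations: e^{-f/2}ψ = φ, so the weights
cancel. The entropy formula comes from comparing two facts about p = |φ|².

The first is a Bochner formula, Δp = 2|∇φ|² + (R/2)p + ½|φ|⁴ (`laplacian_normSq_of_isMonopole`).
Differentiating D_A φ = 0 once more expresses Σ ∇²_{i,i}φ through the Clifford-contracted curvature
of W⁺ (`sum_secondDeriv_of_dirac`), which `clifford_curvature_sum` evaluates. The curvature of the
spinor bundle minus the spin lift of the Riemann tensor commutes with Clifford multiplication, so by
Schur's lemma it is scalar on W⁺; the trace identifies the scalar as F_A/2. In the spin-lift part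
the Bianchi identity reduces the quartic Clifford sum to a Ricci contraction, whose pairing with φ
leaves R/4. In the scalar part the chirality condition kills the anti-self-dual half of F_A, and the
curvature equation converts the rest into |φ|⁴.

The second is the Euler-Lagrange equation of λ in weak form. In terms of w = e^{-f/2} the functional
is the quadratic form ∫ (R w² + 4|∇w|²) (`hilbertEinstein_eq_energy`), minimized by w among positive
functions of given L² norm. Its first variation at w in the direction p e^{f/2} says λ ∫ p = ∫ (R p
- 2⟨∇f, ∇p⟩ - p|∇f|²) (`IsLambdaMinimizer.euler_lagrange`).

To combine them, expand 4|∇ψ|² e^{-f} = 4|∇φ|² + 2⟨∇f, ∇p⟩ + p|∇f|² and eliminate |∇φ|² by Bochner.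
The numerator's integrand becomes 2Δp minus the Euler-Lagrange integrand, so it integrates to -λ ∫
p, and ∫ p is the denominator.

Both halves rest on foundations built here: the Levi-Civita connection is metric and torsion free,
curvature is tensorial, and the divergence theorem `integral_divergence` holds for the volume
measure glued from charts. -/

noncomputable section

set_option linter.unusedSectionVars false

namespace SWEntropy

/-! ### Global smooth sections with prescribed germs, and smooth orthonormal frames. -/

section GlobalSections

variable {M : Type*} [TopologicalSpace M] [ChartedSpace E4 M] [IsManifold (𝓡 4) ∞ M]

section Bundles

variable {F : Type*} [NormedAddCommGroup F] [NormedSpace ℝ F] {V : M → Type*}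
  [TopologicalSpace (Bundle.TotalSpace F V)] [∀ x, AddCommGroup (V x)] [∀ x, Module ℝ (V x)]
  [∀ x, TopologicalSpace (V x)] [FiberBundle F V] [VectorBundle ℝ F V]

theorem SmoothSec.diffSecAt {s : Π x : M, V x} (hs : SmoothSec F s) (x : M) : DiffSecAt F s x :=
  (hs x).mdifferentiableAt (by simp)

theorem DiffSecAt.congr {s t : Π x : M, V x} {x : M} (hs : DiffSecAt F s x)
    (h : ∀ᶠ y in 𝓝 x, t y = s y) : DiffSecAt F t x :=
  MDifferentiableAt.congr_of_eventuallyEq hs (h.mono fun y hy => by simp [hy])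

theorem SmoothSec.add {s t : Π x : M, V x} (hs : SmoothSec F s) (ht : SmoothSec F t) :
    SmoothSec F (fun x => s x + t x) :=
  ContMDiff.add_section hs ht

theorem SmoothSec.smul {f : M → ℝ} {s : Π x : M, V x} (hf : ContMDiff (𝓡 4) 𝓘(ℝ) ∞ f)
    (hs : SmoothSec F s) : SmoothSec F (fun x => f x • s x) :=
  ContMDiff.smul_section hf hs

theorem SmoothSec.sum {ι : Type*} (t : Finset ι) {s : ι → Π x : M, V x}
    (hs : ∀ i, SmoothSec F (s i)) : SmoothSec F (fun x => ∑ i ∈ t, s i x) :=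
  ContMDiff.sum_section fun i _ => hs i

variable [T2Space M]

/-- Multiply by a bump function supported in `U` and equal to 1 near `x`. Connections see only
germs, so local frames and extensions may be replaced by global smooth sections throughout. -/
theorem exists_smoothSec_eventuallyEq {s : Π x : M, V x} {x : M} {U : Set M} (hU : U ∈ 𝓝 x)
    (hs : ContMDiffOn (𝓡 4) ((𝓡 4).prod 𝓘(ℝ, F)) ∞
      (fun y => (Bundle.TotalSpace.mk' F y (s y) : Bundle.TotalSpace F V)) U) :
    ∃ t : Π x : M, V x, SmoothSec F t ∧ ∀ᶠ y in 𝓝 x, t y = s y := by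
  obtain ⟨W, hWU, hWo, hxW⟩ := mem_nhds_iff.1 hU
  obtain ⟨ψ, -, hψ⟩ := (SmoothBumpFunction.nhds_basis_tsupport (I := 𝓡 4) x).mem_iff.1
    (hWo.mem_nhds hxW)
  refine ⟨fun y => ψ y • s y, ?_, ?_⟩
  · exact ContMDiffOn.smul_section_of_tsupport (n := ∞) ψ.contMDiff.contMDiffOn hWo hψ (hs.mono hWU)
  · filter_upwards [ψ.eventuallyEq_one] with y hy
    simp [hy]

theorem exists_smoothFun_eventuallyEq {G : Type*} [NormedAddCommGroup G] [NormedSpace ℝ G]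
    {f : M → G} {x : M} {U : Set M} (hU : U ∈ 𝓝 x)
    (hf : ContMDiffOn (𝓡 4) 𝓘(ℝ, G) ∞ f U) :
    ∃ h : M → G, ContMDiff (𝓡 4) 𝓘(ℝ, G) ∞ h ∧ ∀ᶠ y in 𝓝 x, h y = f y := by
  obtain ⟨W, hWU, hWo, hxW⟩ := mem_nhds_iff.1 hU
  obtain ⟨ψ, -, hψ⟩ := (SmoothBumpFunction.nhds_basis_tsupport (I := 𝓡 4) x).mem_iff.1
    (hWo.mem_nhds hxW)
  refine ⟨fun y => ψ y • f y, ?_, ?_⟩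
  · refine contMDiff_of_tsupport fun y hy => ?_
    have hyW : y ∈ W := hψ (tsupport_smul_subset_left ψ f hy)
    exact (ψ.contMDiff y).smul ((hf.mono hWU).contMDiffAt (hWo.mem_nhds hyW))
  · filter_upwards [ψ.eventuallyEq_one] with y hy
    simp [hy]

variable [ContMDiffVectorBundle ∞ F V (𝓡 4)]

theorem exists_smoothSec_extend (F) [NormedAddCommGroup F] [NormedSpace ℝ F]
    [TopologicalSpace (Bundle.TotalSpace F V)] [FiberBundle F V] [VectorBundle ℝ F V]
    [ContMDiffVectorBundle ∞ F V (𝓡 4)] {x : M} (v : V x) :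
    ∃ t : Π x : M, V x, SmoothSec F t ∧ t x = v ∧
      ∀ᶠ y in 𝓝 x, t y = FiberBundle.extend F v y := by
  obtain ⟨U, hU, h⟩ := FiberBundle.exists_contMDiffOn_extend (𝓡 4) F v (k := ∞)
  obtain ⟨t, ht, hte⟩ := exists_smoothSec_eventuallyEq hU h
  exact ⟨t, ht, by simpa using hte.self_of_nhds, hte⟩

/-- A global smooth section near `x` is a combination of global smooth sections framing the bundle
near `x`. -/
theorem exists_smooth_frame (F) [NormedAddCommGroup F] [NormedSpace ℝ F] [FiniteDimensional ℝ F]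
    (V : M → Type*)
    [TopologicalSpace (Bundle.TotalSpace F V)] [∀ x, AddCommGroup (V x)] [∀ x, Module ℝ (V x)]
    [∀ x, TopologicalSpace (V x)] [FiberBundle F V] [VectorBundle ℝ F V]
    [ContMDiffVectorBundle ∞ F V (𝓡 4)] (x : M) :
    ∃ S : Fin (Module.finrank ℝ F) → Π x : M, V x, (∀ a, SmoothSec F (S a)) ∧
      ∃ c : Fin (Module.finrank ℝ F) → V x →ₗ[ℝ] ℝ,
      ∀ s : Π x : M, V x, SmoothSec F s →
        ∃ f : Fin (Module.finrank ℝ F) → M → ℝ, (∀ a, ContMDiff (𝓡 4) 𝓘(ℝ) ∞ (f a)) ∧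
          (∀ a, f a x = c a (s x)) ∧ ∀ᶠ y in 𝓝 x, s y = ∑ a, f a y • S a y := by
  let t := trivializationAt F V x
  have hx : x ∈ t.baseSet := FiberBundle.mem_baseSet_trivializationAt F V x
  have hU : t.baseSet ∈ 𝓝 x := t.open_baseSet.mem_nhds hx
  let b := Module.finBasis ℝ F
  have : ContMDiffVectorBundle 1 F V (𝓡 4) := ContMDiffVectorBundle.of_le (n := ∞) (by simp)
  choose S hS hSe using fun a => exists_smoothSec_eventuallyEq hU
    (t.contMDiffOn_localFrame_baseSet (I := 𝓡 4) ∞ b a)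
  -- The functionals are fixed before `s`, so sections with the same value at `x` have the same
  -- coefficients there. Pointwise dependence of the curvature on the section rests on this.
  refine ⟨S, hS, fun a => t.localFrameCoeff (𝓡 4) b a x, fun s hs => ?_⟩
  choose f hf hfe using fun a => exists_smoothFun_eventuallyEq hU
    (contMDiffOn_localFrameCoeff (e := t) (I := 𝓡 4) b t.open_baseSet subset_rfl
      hs.contMDiffOn a)
  refine ⟨f, hf, fun a => (hfe a).self_of_nhds, ?_⟩
  filter_upwards [t.eventually_eq_localFrame_sum_coeff_smul b hx (s := s) (I := 𝓡 4),
    Filter.eventually_all.2 hSe, Filter.eventually_all.2 hfe] with y h1 h2 h3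
  rw [h1]
  exact Finset.sum_congr rfl fun a _ => by rw [h2, h3]; rfl

end Bundles

theorem smooth_inner (g : Metric4 M) {X Y : Π x : M, TangentSpace (𝓡 4) x}
    (hX : SmoothSec E4 X) (hY : SmoothSec E4 Y) :
    ContMDiff (𝓡 4) 𝓘(ℝ) ∞ (fun y => g.inner y (X y) (Y y)) := by
  have h : ContMDiff (𝓡 4) ((𝓡 4).prod 𝓘(ℝ)) ∞
      (fun m ↦ Bundle.TotalSpace.mk' ℝ (E := Bundle.Trivial M ℝ) m (g.inner m (X m) (Y m))) := by
    apply ContMDiff.clm_bundle_apply₂ (F₁ := E4) (F₂ := E4)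
    · exact g.contMDiff
    · exact hX
    · exact hY
  intro x
  have := h x
  simp only [Bundle.contMDiffAt_totalSpace] at this
  exact this.2

/-- Gram-Schmidt applied to smooth extensions, one vector at a time. Since `e` is already
orthonormal, the procedure does not change the values at `x`. -/
theorem exists_smooth_orthonormal_extension [T2Space M] (g : Metric4 M) (x : M) (n : ℕ)
    (e : Fin n → TangentSpace (𝓡 4) x)
    (he : ∀ i j, g.inner x (e i) (e j) = if i = j then 1 else 0) :
    ∃ E : Fin n → Π y : M, TangentSpace (𝓡 4) y, (∀ i, SmoothSec E4 (E i)) ∧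
      (∀ i, E i x = e i) ∧
      ∀ᶠ y in 𝓝 x, ∀ i j, g.inner y (E i y) (E j y) = if i = j then 1 else 0 := by
  induction n with
  | zero => exact ⟨fun i => i.elim0, fun i => i.elim0, fun i => i.elim0, by simp⟩
  | succ n ih =>
    obtain ⟨E, hE, hEx, hEo⟩ := ih (fun i => e i.castSucc) fun i j => by
      simpa using he i.castSucc j.castSucc
    obtain ⟨v, hv, hvx, -⟩ := exists_smoothSec_extend E4 (e (Fin.last n))
    let w : Π y : M, TangentSpace (𝓡 4) y :=
      fun y => v y + ∑ i, (-g.inner y (v y) (E i y)) • E i y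
    have hw : SmoothSec E4 w :=
      hv.add (SmoothSec.sum _ fun i => SmoothSec.smul (smooth_inner g hv (hE i)).neg (hE i))
    have hwx : w x = e (Fin.last n) := by
      have h0 : ∀ i : Fin n, g.inner x (e (Fin.last n)) (e i.castSucc) = 0 := fun i => by
        rw [he, if_neg (Fin.castSucc_lt_last i).ne']
      simp [w, hvx, hEx, h0]
    have hN := smooth_inner g hw hw
    have hNx : g.inner x (w x) (w x) = 1 := by rw [hwx, he]; simp
    have hpos : ∀ᶠ y in 𝓝 x, 0 < g.inner y (w y) (w y) :=
      hN.continuous.continuousAt.eventually (lt_mem_nhds (by simp only [hNx]; exact one_pos))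
    -- The normalized field is smooth only where g(w, w) > 0, a neighbourhood of `x`, so it is cut
    -- off to a global section.
    obtain ⟨u, hu, hue⟩ := exists_smoothSec_eventuallyEq (F := E4) (x := x)
      (s := fun y => (Real.sqrt (g.inner y (w y) (w y)))⁻¹ • w y) hpos (by
        refine ContMDiffOn.smul_section ?_ hw.contMDiffOn
        intro y hy
        have hy' : 0 < g.inner y (w y) (w y) := hy
        have h1 : ContDiffAt ℝ ∞ (fun r : ℝ => (Real.sqrt r)⁻¹) (g.inner y (w y) (w y)) :=
          (Real.contDiffAt_sqrt hy'.ne').inv (Real.sqrt_pos.2 hy').ne'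
        exact (h1.contMDiffAt.comp y (hN y)).contMDiffWithinAt)
    refine ⟨Fin.snoc (α := fun _ => Π y : M, TangentSpace (𝓡 4) y) E u, ?_, ?_, ?_⟩
    · intro i
      refine Fin.lastCases ?_ (fun i => ?_) i
      · simpa using hu
      · simpa using hE i
    · intro i
      refine Fin.lastCases ?_ (fun i => ?_) i
      · rw [Fin.snoc_last, hue.self_of_nhds, hNx]
        simp [hwx]
      · simpa using hEx i
    · filter_upwards [hEo, hpos, hue] with y hy hp hu
      have hwE : ∀ i, g.inner y (w y) (E i y) = 0 := fun i => by
        simp [w, hy]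
      have hEw : ∀ i, g.inner y (E i y) (w y) = 0 := fun i => by rw [g.symm, hwE]
      have hsq : Real.sqrt (g.inner y (w y) (w y)) ≠ 0 := (Real.sqrt_pos.2 hp).ne'
      intro i j
      refine Fin.lastCases ?_ (fun i => ?_) i <;> refine Fin.lastCases ?_ (fun j => ?_) j
      · simp only [Fin.snoc_last, hu, map_smul, _root_.smul_apply, smul_eq_mul, if_true]
        field_simp
        rw [Real.sq_sqrt hp.le]
      · simp [hu, hwE, (Fin.castSucc_lt_last j).ne']
      · simp [hu, hEw, (Fin.castSucc_lt_last i).ne]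
      · simp [hy]

end GlobalSections

/-! ### The Levi-Civita connection: Koszul formula, metric compatibility, torsion, smoothness. -/

section LeviCivita

variable {M : Type*} [TopologicalSpace M] [ChartedSpace E4 M] [IsManifold (𝓡 4) ∞ M]

theorem smooth_mvfderiv {G : Type*} [NormedAddCommGroup G] [NormedSpace ℝ G] {f : M → G}
    {X : Π x : M, TangentSpace (𝓡 4) x} (hf : ContMDiff (𝓡 4) 𝓘(ℝ, G) ∞ f)
    (hX : SmoothSec E4 X) :
    ContMDiff (𝓡 4) 𝓘(ℝ, G) ∞ (fun x => mvfderiv (𝓡 4) f x (X x)) :=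
  (contMDiff_snd_tangentBundle_modelSpace G 𝓘(ℝ, G)).comp
    ((hf.contMDiff_tangentMap (m := ∞) (by simp)).comp hX)

theorem smooth_mlieBracket {X Y : Π x : M, TangentSpace (𝓡 4) x} (hX : SmoothSec E4 X)
    (hY : SmoothSec E4 Y) : SmoothSec E4 (VectorField.mlieBracket (𝓡 4) X Y) := by
  have : IsManifold (𝓡 4) (minSmoothness ℝ 2) M := by
    rw [minSmoothness_of_isRCLikeNormedField]; infer_instance
  have : IsManifold (𝓡 4) (((⊤ : ℕ∞) : WithTop ℕ∞) + 1) M := inferInstanceAs (IsManifold (𝓡 4) ∞ M)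
  exact ContDiff.mlieBracket_vectorField (m := ⊤) (n := ⊤) hX hY (by simp)

/-- `[X, Y] f = X (Y f) - Y (X f)`. -/
theorem mvfderiv_mlieBracket {X Y : Π x : M, TangentSpace (𝓡 4) x} {f : M → ℝ} [T2Space M]
    (hX : SmoothSec E4 X) (hY : SmoothSec E4 Y) (hf : ContMDiff (𝓡 4) 𝓘(ℝ) ∞ f) (x : M) :
    mvfderiv (𝓡 4) f x (VectorField.mlieBracket (𝓡 4) X Y x)
      = mvfderiv (𝓡 4) (fun y => mvfderiv (𝓡 4) f y (Y y)) x (X x)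
        - mvfderiv (𝓡 4) (fun y => mvfderiv (𝓡 4) f y (X y)) x (Y x) := by
  -- The formula is read off from the Jacobi identity for X, Y and fZ. After expansion the
  -- first-order terms in f cancel, the terms with undifferentiated f cancel by Jacobi for Z, and a
  -- multiple of Z(x) remains; hence the need for Z(x) ≠ 0.
  obtain ⟨v, hv⟩ : ∃ v : TangentSpace (𝓡 4) x, v ≠ 0 :=
    ⟨(EuclideanSpace.single 0 1 : E4), by
      intro h
      have := congrArg (fun v : E4 => v 0) h
      simp only [PiLp.single_apply] at this
      exact one_ne_zero (α := ℝ) this⟩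
  have : IsManifold (𝓡 4) (minSmoothness ℝ 3) M := by
    rw [minSmoothness_of_isRCLikeNormedField]; infer_instance
  obtain ⟨Z, hZ, hZx, -⟩ := exists_smoothSec_extend E4 v
  have hd : ∀ {W : Π x : M, TangentSpace (𝓡 4) x}, SmoothSec E4 W → ∀ y, DiffSecAt E4 W y :=
    fun h y => h.diffSecAt y
  have hfd : ∀ {h : M → ℝ}, ContMDiff (𝓡 4) 𝓘(ℝ) ∞ h → ∀ y, MDifferentiableAt (𝓡 4) 𝓘(ℝ) h y :=
    fun h y => (h y).mdifferentiableAt (by simp)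
  have hXf := smooth_mvfderiv hf hX
  have hYf := smooth_mvfderiv hf hY
  have h2 : (minSmoothness ℝ 2 : WithTop ℕ∞) ≤ ∞ := by
    rw [minSmoothness_of_isRCLikeNormedField]; exact WithTop.coe_le_coe.2 (le_top : (2 : ℕ∞) ≤ ⊤)
  have key := VectorField.leibniz_identity_mlieBracket_apply (I := 𝓡 4) (x := x)
    ((hX x).of_le h2) ((hY x).of_le h2) (((SmoothSec.smul hf hZ) x).of_le h2)
  have e : ∀ {W : Π x : M, TangentSpace (𝓡 4) x},
      VectorField.mlieBracket (𝓡 4) W (fun y => f y • Z y)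
        = (fun y => mvfderiv (𝓡 4) f y (W y)) • Z + f • VectorField.mlieBracket (𝓡 4) W Z :=
    funext fun y => VectorField.mlieBracket_smul_right (hfd hf y) (hd hZ y)
  have s1 : ∀ {W W' : Π x : M, TangentSpace (𝓡 4) x}, SmoothSec E4 W → SmoothSec E4 W' →
      VectorField.mlieBracket (𝓡 4) W' ((fun y => mvfderiv (𝓡 4) f y (W y)) • Z
          + f • VectorField.mlieBracket (𝓡 4) W Z) x
        = (mvfderiv (𝓡 4) (fun y => mvfderiv (𝓡 4) f y (W y)) x (W' x)) • v
          + (mvfderiv (𝓡 4) f x (W x)) • VectorField.mlieBracket (𝓡 4) W' Z x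
          + ((mvfderiv (𝓡 4) f x (W' x)) • VectorField.mlieBracket (𝓡 4) W Z x
          + f x • VectorField.mlieBracket (𝓡 4) W' (VectorField.mlieBracket (𝓡 4) W Z) x) := by
    intro W W' hW hW'
    rw [VectorField.mlieBracket_add_right (V := W')
      (W := (fun y => mvfderiv (𝓡 4) f y (W y)) • Z)
      (W₁ := f • VectorField.mlieBracket (𝓡 4) W Z) (hd (SmoothSec.smul (smooth_mvfderiv hf hW) hZ) x)
      (hd (SmoothSec.smul hf (smooth_mlieBracket hW hZ)) x),
      VectorField.mlieBracket_smul_right (hfd (smooth_mvfderiv hf hW) x) (hd hZ x),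
      VectorField.mlieBracket_smul_right (hfd hf x) (hd (smooth_mlieBracket hW hZ) x), hZx]
  have j := VectorField.leibniz_identity_mlieBracket_apply (I := 𝓡 4) (x := x)
    ((hX x).of_le h2) ((hY x).of_le h2) ((hZ x).of_le h2)
  rw [e, e, e, s1 hY hX, s1 hX hY] at key
  simp only [Pi.add_apply, Pi.smul_apply', hZx, j] at key
  have : (mvfderiv (𝓡 4) f x (VectorField.mlieBracket (𝓡 4) X Y x)
      - (mvfderiv (𝓡 4) (fun y => mvfderiv (𝓡 4) f y (Y y)) x (X x)
        - mvfderiv (𝓡 4) (fun y => mvfderiv (𝓡 4) f y (X y)) x (Y x))) • v = 0 := by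
    rw [sub_smul, sub_smul]
    rw [← sub_eq_zero] at key
    rw [← neg_eq_zero, ← key]
    module
  rcases smul_eq_zero.1 this with h | h
  · linarith
  · exact absurd h hv

theorem inner_frame_ext (g : Metric4 M) {x : M} {v w : TangentSpace (𝓡 4) x}
    (h : ∀ u, g.inner x v u = g.inner x w u) : v = w := by
  rw [← frame_expand g x v, ← frame_expand g x w]
  simp [h]

theorem koszul_tensorial_right (g : Metric4 M) {X Y : Π x : M, TangentSpace (𝓡 4) x} {x : M}
    (hX : DiffSecAt E4 X x) (hY : DiffSecAt E4 Y x) :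
    TensorialAt (𝓡 4) E4 (fun Z => koszul g X Y Z x) x where
  smul {f Z} hf hZ := by
    have h1 := mvfderiv_fun_mul hf (mdifferentiableAt_metric g hY hZ)
    have h2 := mvfderiv_fun_mul hf (mdifferentiableAt_metric g hX hZ)
    simp [koszul, h1, h2, VectorField.mlieBracket_smul_right hf hZ, g.symm x (Z x)]
    ring
  add {Z Z'} hZ hZ' := by
    have h1 := mvfderiv_fun_add (mdifferentiableAt_metric g hY hZ)
      (mdifferentiableAt_metric g hY hZ')
    have h2 := mvfderiv_fun_add (mdifferentiableAt_metric g hX hZ)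
      (mdifferentiableAt_metric g hX hZ')
    simp [koszul, h1, h2, VectorField.mlieBracket_add_right hZ hZ']
    ring

/-- The definition tests the Koszul expression only on chosen extensions of frame vectors; its
tensoriality in `X` and `Z` frees it from that choice. -/
theorem inner_leviCivita (g : Metric4 M) {X Y Z : Π x : M, TangentSpace (𝓡 4) x} {x : M}
    (hX : DiffSecAt E4 X x) (hY : DiffSecAt E4 Y x) (hZ : DiffSecAt E4 Z x) :
    g.inner x (leviCivita g Y x (X x)) (Z x) = 1 / 2 * koszul g X Y Z x := by
  have hX' : DiffSecAt E4 (FiberBundle.extend E4 (X x)) x :=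
    FiberBundle.mdifferentiableAt_extend ..
  have hT := koszul_tensorial_right g hX' hY
  change g.inner x (leviCivitaFun g Y x (X x)) (Z x) = _
  rw [leviCivitaFun_apply g hY, (koszul_tensorial g hY hZ).pointwise hX hX' (by simp),
    ← TensorialAt.mkHom_apply hT hZ]
  conv_rhs => rw [← frame_expand g x (Z x)]
  simp only [map_sum, map_smul, _root_.sum_apply, _root_.smul_apply, smul_eq_mul,
    TensorialAt.mkHom_apply_eq_extend, Finset.mul_sum]
  refine Finset.sum_congr rfl fun i _ => ?_
  rw [g.symm x (Z x)]
  ring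

/-- In the sum of the Koszul expressions for (X, Y, Z) and (X, Z, Y), everything cancels except 2 X
g(Y, Z). -/
theorem leviCivita_metric (g : Metric4 M) {Y Z : Π x : M, TangentSpace (𝓡 4) x} {x : M}
    (hY : DiffSecAt E4 Y x) (hZ : DiffSecAt E4 Z x) (v : TangentSpace (𝓡 4) x) :
    mvfderiv (𝓡 4) (fun y => g.inner y (Y y) (Z y)) x v
      = g.inner x (leviCivita g Y x v) (Z x) + g.inner x (Y x) (leviCivita g Z x v) := by
  have hX : DiffSecAt E4 (FiberBundle.extend E4 v) x := FiberBundle.mdifferentiableAt_extend ..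
  have h1 := inner_leviCivita g hX hY hZ
  have h2 := inner_leviCivita g hX hZ hY
  rw [FiberBundle.extend_apply_self] at h1 h2
  rw [g.symm x (Y x), h1, h2]
  simp only [koszul, FiberBundle.extend_apply_self, VectorField.mlieBracket_swap_apply (V := Z) (W := Y),
    map_neg, _root_.neg_apply, fun y => g.symm y (Z y) (Y y)]
  ring

/-- Exchanging X and Y in the Koszul expression and subtracting leaves 2 g([X, Y], Z). -/
theorem leviCivita_torsion (g : Metric4 M) {X Y : Π x : M, TangentSpace (𝓡 4) x} {x : M}
    (hX : DiffSecAt E4 X x) (hY : DiffSecAt E4 Y x) :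
    VectorField.mlieBracket (𝓡 4) X Y x = leviCivita g Y x (X x) - leviCivita g X x (Y x) := by
  refine inner_frame_ext g fun u => ?_
  have hZ : DiffSecAt E4 (FiberBundle.extend E4 u) x := FiberBundle.mdifferentiableAt_extend ..
  have h1 := inner_leviCivita g hX hY hZ
  have h2 := inner_leviCivita g hY hX hZ
  rw [FiberBundle.extend_apply_self] at h1 h2
  simp only [map_sub, _root_.sub_apply, h1, h2]
  simp only [koszul, FiberBundle.extend_apply_self, VectorField.mlieBracket_swap_apply (V := Y) (W := X),
    map_neg, _root_.neg_apply, fun y => g.symm y (Y y) (X y)]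
  ring

theorem smooth_koszul (g : Metric4 M) {X Y Z : Π x : M, TangentSpace (𝓡 4) x}
    (hX : SmoothSec E4 X) (hY : SmoothSec E4 Y) (hZ : SmoothSec E4 Z) :
    ContMDiff (𝓡 4) 𝓘(ℝ) ∞ (koszul g X Y Z) := by
  unfold koszul
  refine ContMDiff.sub (ContMDiff.sub (ContMDiff.add (ContMDiff.sub (ContMDiff.add ?_ ?_) ?_) ?_) ?_) ?_
  · exact smooth_mvfderiv (smooth_inner g hY hZ) hX
  · exact smooth_mvfderiv (smooth_inner g hX hZ) hY
  · exact smooth_mvfderiv (smooth_inner g hX hY) hZ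
  · exact smooth_inner g (smooth_mlieBracket hX hY) hZ
  · exact smooth_inner g (smooth_mlieBracket hX hZ) hY
  · exact smooth_inner g (smooth_mlieBracket hY hZ) hX

theorem orthonormal_expand (g : Metric4 M) {x : M} {e : Fin 4 → TangentSpace (𝓡 4) x}
    (he : ∀ i j, g.inner x (e i) (e j) = if i = j then 1 else 0) (v : TangentSpace (𝓡 4) x) :
    ∑ i, g.inner x v (e i) • e i = v := by
  have hli : LinearIndependent ℝ e := by
    rw [Fintype.linearIndependent_iff]
    intro c hc i
    have := congrArg (fun w => g.inner x w (e i)) hc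
    simpa [he] using this
  have : FiniteDimensional ℝ (TangentSpace (𝓡 4) x) := inferInstanceAs (FiniteDimensional ℝ E4)
  have hrank : Module.finrank ℝ (TangentSpace (𝓡 4) x) = 4 := by
    change Module.finrank ℝ E4 = 4
    simp
  let b := basisOfLinearIndependentOfCardEqFinrank hli (by simp [hrank])
  have hb : ∀ i, b i = e i := fun i => by simp [b]
  have h := b.sum_repr v
  have hr : ∀ i, g.inner x v (e i) = b.repr v i := fun i => by
    conv_lhs => rw [← h]
    simp [hb, he]
  exact (Finset.sum_congr rfl fun i _ => by rw [hr, hb]).trans h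

/-- The transition matrix between orthonormal bases is orthogonal. `frame g x` is chosen pointwise
without any continuity in `x`; this allows it to be exchanged for a smooth or an oriented frame. -/
theorem orthonormal_trace (g : Metric4 M) {A : Type*} [AddCommGroup A] [Module ℝ A] {x : M}
    {e e' : Fin 4 → TangentSpace (𝓡 4) x}
    (he : ∀ i j, g.inner x (e i) (e j) = if i = j then 1 else 0)
    (he' : ∀ i j, g.inner x (e' i) (e' j) = if i = j then 1 else 0)
    (B : TangentSpace (𝓡 4) x →ₗ[ℝ] TangentSpace (𝓡 4) x →ₗ[ℝ] A) :
    ∑ i, B (e i) (e i) = ∑ i, B (e' i) (e' i) := by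
  have h1 : ∀ i, B (e i) (e i)
      = ∑ j, ∑ k, (g.inner x (e i) (e' j) * g.inner x (e i) (e' k)) • B (e' j) (e' k) := by
    intro i
    conv_lhs => rw [← orthonormal_expand g he' (e i)]
    simp only [map_sum, map_smul, LinearMap.sum_apply, LinearMap.smul_apply, Finset.smul_sum,
      smul_smul]
    rw [Finset.sum_comm]
    simp only [mul_comm]
  simp only [h1]
  rw [Finset.sum_comm]
  refine Finset.sum_congr rfl fun j _ => ?_
  rw [Finset.sum_comm]
  have h2 : ∀ k, ∑ i, g.inner x (e i) (e' j) * g.inner x (e i) (e' k) = if j = k then 1 else 0 := by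
    intro k
    rw [← he' j k]
    conv_rhs => rw [← orthonormal_expand g he (e' j)]
    simp only [map_sum, map_smul, _root_.sum_apply, _root_.smul_apply, smul_eq_mul]
    exact Finset.sum_congr rfl fun i _ => by rw [g.symm x (e i) (e' j)]
  simp only [← Finset.sum_smul, h2, ite_smul, one_smul, zero_smul, Finset.sum_ite_eq,
    Finset.mem_univ, if_true]

theorem exists_smooth_orthonormal_frame [T2Space M] (g : Metric4 M) (x : M) :
    ∃ E : Fin 4 → Π y : M, TangentSpace (𝓡 4) y, (∀ i, SmoothSec E4 (E i)) ∧
      ∀ᶠ y in 𝓝 x, ∀ i j, g.inner y (E i y) (E j y) = if i = j then 1 else 0 := by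
  obtain ⟨E, hE, -, h⟩ := exists_smooth_orthonormal_extension g x 4 (frame g x)
    (frame_orthonormal g x)
  exact ⟨E, hE, h⟩

section Connection

variable {F : Type*} [NormedAddCommGroup F] [NormedSpace ℝ F] {V : M → Type*}
    [TopologicalSpace (Bundle.TotalSpace F V)] [∀ x, AddCommGroup (V x)] [∀ x, Module ℝ (V x)]
    [∀ x, TopologicalSpace (V x)] [∀ x, IsTopologicalAddGroup (V x)]
    [∀ x, ContinuousSMul ℝ (V x)] [FiberBundle F V]

/-- `∇_X σ` is smooth for smooth `X` and `σ`. -/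
def SmoothConnection (D : CovariantDerivative (𝓡 4) F V) : Prop :=
  ∀ (X : Π x : M, TangentSpace (𝓡 4) x) (σ : Π x : M, V x), SmoothSec E4 X → SmoothSec F σ →
    SmoothSec F (fun y => D σ y (X y))

end Connection

theorem smooth_leviCivita [T2Space M] (g : Metric4 M) : SmoothConnection (leviCivita g) := by
  intro X Y hX hY x
  obtain ⟨E, hE, hEo⟩ := exists_smooth_orthonormal_frame g x
  have h : SmoothSec E4 (fun y => ∑ i, (1 / 2 * koszul g X Y (E i) y) • E i y) :=
    SmoothSec.sum _ fun i => SmoothSec.smul (contMDiff_const.mul (smooth_koszul g hX hY (hE i))) (hE i)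
  refine (h x).congr_of_eventuallyEq ?_
  filter_upwards [hEo] with y hy
  congr 1
  rw [← orthonormal_expand g hy (leviCivita g Y y (X y))]
  exact Finset.sum_congr rfl fun i _ => by
    rw [inner_leviCivita g (hX.diffSecAt y) (hY.diffSecAt y) ((hE i).diffSecAt y)]

end LeviCivita

/-! ### Second covariant derivatives and tensoriality of curvature. -/

section Curvature

variable {M : Type*} [TopologicalSpace M] [ChartedSpace E4 M] [IsManifold (𝓡 4) ∞ M]
variable {F : Type*} [NormedAddCommGroup F] [NormedSpace ℝ F] {V : M → Type*}
    [TopologicalSpace (Bundle.TotalSpace F V)] [∀ x, AddCommGroup (V x)] [∀ x, Module ℝ (V x)]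
    [∀ x, TopologicalSpace (V x)] [∀ x, IsTopologicalAddGroup (V x)]
    [∀ x, ContinuousSMul ℝ (V x)] [FiberBundle F V] [VectorBundle ℝ F V]
  {D : CovariantDerivative (𝓡 4) F V} {x : M} {σ τ : Π x : M, V x}

theorem conn_add (hσ : DiffSecAt F σ x) (hτ : DiffSecAt F τ x) (v : TangentSpace (𝓡 4) x) :
    D (fun y => σ y + τ y) x v = D σ x v + D τ x v := by
  have := D.isCovariantDerivativeOnUniv.add hσ hτ
  exact congrArg (fun L => L v) this

theorem conn_smul {f : M → ℝ} (hf : MDifferentiableAt (𝓡 4) 𝓘(ℝ) f x) (hσ : DiffSecAt F σ x)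
    (v : TangentSpace (𝓡 4) x) :
    D (fun y => f y • σ y) x v = f x • D σ x v + mvfderiv (𝓡 4) f x v • σ x := by
  have := D.isCovariantDerivativeOnUniv.leibniz hσ hf
  exact congrArg (fun L => L v) this

theorem conn_congr (hσ : DiffSecAt F σ x) (h : ∀ᶠ y in 𝓝 x, τ y = σ y) : D τ x = D σ x :=
  D.isCovariantDerivativeOnUniv.congr_of_eventuallyEq (hσ.congr h) hσ Filter.univ_mem h

theorem conn_zero (v : TangentSpace (𝓡 4) x) : D (fun y => (0 : V y)) x v = 0 := by
  have := D.isCovariantDerivativeOnUniv.zero (x := x)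
  exact congrArg (fun L => L v) this

theorem conn_sum {ι : Type*} (t : Finset ι) {s : ι → Π x : M, V x}
    (hs : ∀ i, SmoothSec F (s i)) (v : TangentSpace (𝓡 4) x) :
    D (fun y => ∑ i ∈ t, s i y) x v = ∑ i ∈ t, D (s i) x v := by
  classical
  induction t using Finset.induction_on with
  | empty => simpa using conn_zero v
  | insert a t ha ih =>
    simp only [Finset.sum_insert ha, ← ih]
    exact conn_add ((hs a).diffSecAt x) ((SmoothSec.sum t hs).diffSecAt x) v

theorem SmoothSec.const_smul {F' : Type*} [NormedAddCommGroup F'] [NormedSpace ℝ F'] {V' : M → Type*}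
    [TopologicalSpace (Bundle.TotalSpace F' V')] [∀ x, AddCommGroup (V' x)] [∀ x, Module ℝ (V' x)]
    [∀ x, TopologicalSpace (V' x)] [FiberBundle F' V'] [VectorBundle ℝ F' V'] {s : Π x : M, V' x}
    (c : ℝ) (hs : SmoothSec F' s) : SmoothSec F' (fun x => c • s x) :=
  SmoothSec.smul contMDiff_const hs

variable [T2Space M]

/-- `Y` is only differentiable at `x`, so `hD` does not apply to it; expand `Y` in a smooth
orthonormal frame, to which it does. -/
theorem diffSecAt_conn (g : Metric4 M) (hD : SmoothConnection D) (hσ : SmoothSec F σ)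
    {Y : Π x : M, TangentSpace (𝓡 4) x} (hY : DiffSecAt E4 Y x) :
    DiffSecAt F (fun y => D σ y (Y y)) x := by
  obtain ⟨E, hE, hEo⟩ := exists_smooth_orthonormal_frame g x
  have h : DiffSecAt F (fun y => ∑ i, g.inner y (Y y) (E i y) • D σ y (E i y)) x :=
    MDifferentiableAt.sum_section fun i _ =>
      (mdifferentiableAt_metric g hY ((hE i).diffSecAt x)).smul_section
        ((hD _ _ (hE i) hσ).diffSecAt x)
  refine h.congr ?_
  filter_upwards [hEo] with y hy
  conv_lhs => rw [← orthonormal_expand g hy (Y y)]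
  simp

/-- The second covariant derivative `∇²_{v,w} σ = ∇_v ∇_Y σ - ∇_{∇_v Y} σ`, where `Y` extends `w`. -/
def secondDeriv (g : Metric4 M) (D : CovariantDerivative (𝓡 4) F V) (σ : Π x : M, V x) (x : M)
    (v w : TangentSpace (𝓡 4) x) : V x :=
  D (fun y => D σ y (FiberBundle.extend E4 w y)) x v
    - D σ x (leviCivita g (FiberBundle.extend E4 w) x v)

/-- For fY both terms produce (v f) D_Y σ, and the two cancel. The Levi-Civita correction is there
for this purpose. -/
theorem secondDeriv_tensorial (g : Metric4 M) (hD : SmoothConnection D) (hσ : SmoothSec F σ)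
    (v : TangentSpace (𝓡 4) x) :
    TensorialAt (𝓡 4) E4 (fun Y : Π x : M, TangentSpace (𝓡 4) x =>
      D (fun y => D σ y (Y y)) x v - D σ x (leviCivita g Y x v)) x where
  smul {f Y} hf hY := by
    have h1 := conn_smul (D := D) hf (diffSecAt_conn g hD hσ hY) v
    have h2 := conn_smul (D := leviCivita g) hf hY v
    simp only [Pi.smul_apply', map_smul]
    erw [h1, h2]
    simp only [map_add, map_smul]
    module
  add {Y Y'} hY hY' := by
    have h1 := conn_add (D := D) (diffSecAt_conn g hD hσ hY) (diffSecAt_conn g hD hσ hY') v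
    have h2 := conn_add (D := leviCivita g) hY hY' v
    simp only [Pi.add_apply, map_add]
    erw [h1, h2]
    simp only [map_add]
    abel

theorem secondDeriv_eq (g : Metric4 M) (hD : SmoothConnection D) (hσ : SmoothSec F σ)
    {Y : Π x : M, TangentSpace (𝓡 4) x} (hY : DiffSecAt E4 Y x) (v : TangentSpace (𝓡 4) x) :
    secondDeriv g D σ x v (Y x) = D (fun y => D σ y (Y y)) x v - D σ x (leviCivita g Y x v) :=
  (secondDeriv_tensorial g hD hσ v).pointwise (FiberBundle.mdifferentiableAt_extend ..) hY (by simp)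

theorem secondDeriv_add_left (g : Metric4 M) (v v' w : TangentSpace (𝓡 4) x) :
    secondDeriv g D σ x (v + v') w = secondDeriv g D σ x v w + secondDeriv g D σ x v' w := by
  simp only [secondDeriv, map_add]
  abel

theorem secondDeriv_smul_left (g : Metric4 M) (c : ℝ) (v w : TangentSpace (𝓡 4) x) :
    secondDeriv g D σ x (c • v) w = c • secondDeriv g D σ x v w := by
  simp only [secondDeriv, map_smul, smul_sub]

theorem secondDeriv_add_right (g : Metric4 M) (hD : SmoothConnection D) (hσ : SmoothSec F σ)
    (v w w' : TangentSpace (𝓡 4) x) :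
    secondDeriv g D σ x v (w + w') = secondDeriv g D σ x v w + secondDeriv g D σ x v w' := by
  have h := secondDeriv_tensorial g hD hσ v
  exact (TensorialAt.mkHom _ x h).map_add w w'

theorem secondDeriv_smul_right (g : Metric4 M) (hD : SmoothConnection D) (hσ : SmoothSec F σ)
    (c : ℝ) (v w : TangentSpace (𝓡 4) x) :
    secondDeriv g D σ x v (c • w) = c • secondDeriv g D σ x v w := by
  have h := secondDeriv_tensorial g hD hσ v
  exact (TensorialAt.mkHom _ x h).map_smul c w

theorem conn_congr_nhds (hσ : SmoothSec F σ) (h : ∀ᶠ y in 𝓝 x, τ y = σ y) :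
    ∀ᶠ y in 𝓝 x, D τ y = D σ y := by
  filter_upwards [eventually_eventually_nhds.2 h] with y hy
  exact conn_congr (hσ.diffSecAt y) hy

theorem conn_conn_congr (g : Metric4 M) (hD : SmoothConnection D) (hσ : SmoothSec F σ)
    (h : ∀ᶠ y in 𝓝 x, τ y = σ y)
    {Y : Π x : M, TangentSpace (𝓡 4) x} (hY : DiffSecAt E4 Y x) :
    D (fun y => D τ y (Y y)) x = D (fun y => D σ y (Y y)) x :=
  conn_congr (diffSecAt_conn g hD hσ hY) ((conn_congr_nhds hσ h).mono fun y hy => by rw [hy])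

theorem secondDeriv_congr (g : Metric4 M) (hD : SmoothConnection D) (hσ : SmoothSec F σ)
    (h : ∀ᶠ y in 𝓝 x, τ y = σ y) (v w : TangentSpace (𝓡 4) x) :
    secondDeriv g D τ x v w = secondDeriv g D σ x v w := by
  simp only [secondDeriv]
  rw [conn_conn_congr g hD hσ h (FiberBundle.mdifferentiableAt_extend ..),
    conn_congr (hσ.diffSecAt x) h]

theorem secondDeriv_add (g : Metric4 M) (hD : SmoothConnection D) (hσ : SmoothSec F σ)
    (hτ : SmoothSec F τ) (v w : TangentSpace (𝓡 4) x) :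
    secondDeriv g D (fun y => σ y + τ y) x v w
      = secondDeriv g D σ x v w + secondDeriv g D τ x v w := by
  obtain ⟨Y, hY, hYx, -⟩ := exists_smoothSec_extend E4 w
  rw [← hYx, secondDeriv_eq g hD (hσ.add hτ) (hY.diffSecAt x),
    secondDeriv_eq g hD hσ (hY.diffSecAt x), secondDeriv_eq g hD hτ (hY.diffSecAt x)]
  simp only [fun y => conn_add (D := D) (hσ.diffSecAt y) (hτ.diffSecAt y)]
  rw [conn_add ((hD Y σ hY hσ).diffSecAt x) ((hD Y τ hY hτ).diffSecAt x)]
  abel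

theorem secondDeriv_sum (g : Metric4 M) (hD : SmoothConnection D) {ι : Type*} (t : Finset ι)
    {s : ι → Π x : M, V x} (hs : ∀ i, SmoothSec F (s i)) (v w : TangentSpace (𝓡 4) x) :
    secondDeriv g D (fun y => ∑ i ∈ t, s i y) x v w = ∑ i ∈ t, secondDeriv g D (s i) x v w := by
  classical
  induction t using Finset.induction_on with
  | empty => simp [secondDeriv, conn_zero]
  | insert a t ha ih =>
    simp only [Finset.sum_insert ha, ← ih]
    exact secondDeriv_add g hD (hs a) (SmoothSec.sum t hs) v w

theorem secondDeriv_smul (g : Metric4 M) (hD : SmoothConnection D) (hσ : SmoothSec F σ)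
    {f : M → ℝ} (hf : ContMDiff (𝓡 4) 𝓘(ℝ) ∞ f) (v : TangentSpace (𝓡 4) x)
    {Y : Π x : M, TangentSpace (𝓡 4) x} (hY : SmoothSec E4 Y) :
    secondDeriv g D (fun y => f y • σ y) x v (Y x)
      = f x • secondDeriv g D σ x v (Y x) + mvfderiv (𝓡 4) f x v • D σ x (Y x)
        + mvfderiv (𝓡 4) f x (Y x) • D σ x v
        + (mvfderiv (𝓡 4) (fun y => mvfderiv (𝓡 4) f y (Y y)) x v
            - mvfderiv (𝓡 4) f x (leviCivita g Y x v)) • σ x := by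
  have hfd : ∀ {h : M → ℝ}, ContMDiff (𝓡 4) 𝓘(ℝ) ∞ h → ∀ y, MDifferentiableAt (𝓡 4) 𝓘(ℝ) h y :=
    fun h y => (h y).mdifferentiableAt (by simp)
  rw [secondDeriv_eq g hD (SmoothSec.smul hf hσ) (hY.diffSecAt x),
    secondDeriv_eq g hD hσ (hY.diffSecAt x)]
  simp only [fun y => conn_smul (D := D) (hfd hf y) (hσ.diffSecAt y)]
  have hDY := hD Y σ hY hσ
  have hYf := smooth_mvfderiv hf hY
  rw [conn_add ((SmoothSec.smul hf hDY).diffSecAt x) ((SmoothSec.smul hYf hσ).diffSecAt x),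
    conn_smul (hfd hf x) (hDY.diffSecAt x), conn_smul (hfd hYf x) (hσ.diffSecAt x)]
  module

variable [FiniteDimensional ℝ F] [ContMDiffVectorBundle ∞ F V (𝓡 4)]

/-- Antisymmetrize the product rule for ∇²(fS): the mixed first-order terms cancel, and the Hessian
of f drops out because it is symmetric when the torsion vanishes. Only f times the commutator
survives, so expanding in a smooth frame leaves dependence on the value at `x` alone. -/
theorem secondDeriv_comm_pointwise (g : Metric4 M) (hD : SmoothConnection D) (hσ : SmoothSec F σ)
    (hτ : SmoothSec F τ) (h : τ x = σ x) (v w : TangentSpace (𝓡 4) x) :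
    secondDeriv g D τ x v w - secondDeriv g D τ x w v
      = secondDeriv g D σ x v w - secondDeriv g D σ x w v := by
  obtain ⟨S, hS, c, hc⟩ := exists_smooth_frame F V x
  obtain ⟨X, hX, hXx, -⟩ := exists_smoothSec_extend E4 v
  obtain ⟨Y, hY, hYx, -⟩ := exists_smoothSec_extend E4 w
  have key : ∀ s : Π x : M, V x, SmoothSec F s →
      secondDeriv g D s x v w - secondDeriv g D s x w v
        = ∑ a, c a (s x) • (secondDeriv g D (S a) x v w - secondDeriv g D (S a) x w v) := by
    intro s hs
    obtain ⟨f, hf, hfx, hfe⟩ := hc s hs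
    have hfS : ∀ a, SmoothSec F (fun y => f a y • S a y) := fun a => SmoothSec.smul (hf a) (hS a)
    rw [secondDeriv_congr g hD (SmoothSec.sum _ hfS) hfe,
      secondDeriv_congr g hD (SmoothSec.sum _ hfS) hfe,
      secondDeriv_sum g hD _ hfS, secondDeriv_sum g hD _ hfS, ← Finset.sum_sub_distrib]
    refine Finset.sum_congr rfl fun a _ => ?_
    have h1 := secondDeriv_smul g hD (hS a) (hf a) (X x) hY
    have h2 := secondDeriv_smul g hD (hS a) (hf a) (Y x) hX
    have h3 := mvfderiv_mlieBracket hX hY (hf a) x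
    rw [leviCivita_torsion g (hX.diffSecAt x) (hY.diffSecAt x), map_sub] at h3
    rw [← hXx, ← hYx, h1, h2, ← hfx]
    have h4 : (mvfderiv (𝓡 4) (fun y => mvfderiv (𝓡 4) (f a) y (Y y)) x (X x)
        - mvfderiv (𝓡 4) (f a) x (leviCivita g Y x (X x)))
        = mvfderiv (𝓡 4) (fun y => mvfderiv (𝓡 4) (f a) y (X y)) x (Y x)
        - mvfderiv (𝓡 4) (f a) x (leviCivita g X x (Y x)) := by linarith
    rw [h4]
    module
  rw [key τ hτ, key σ hσ, h]

/-- Vanishing torsion turns the bracket term into the two Levi-Civita corrections. The extension of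
`σ x` in the definition of `curvature` is first replaced by a global section with the same germ,
then by `σ` itself. -/
theorem curvature_eq (g : Metric4 M) (hD : SmoothConnection D) (hσ : SmoothSec F σ)
    (v w : TangentSpace (𝓡 4) x) :
    curvature D x v w (σ x) = secondDeriv g D σ x v w - secondDeriv g D σ x w v := by
  obtain ⟨τ, hτ, hτx, hτe⟩ := exists_smoothSec_extend F (σ x)
  have hX : DiffSecAt E4 (FiberBundle.extend E4 v) x := FiberBundle.mdifferentiableAt_extend ..
  have hY : DiffSecAt E4 (FiberBundle.extend E4 w) x := FiberBundle.mdifferentiableAt_extend ..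
  have hτe' : ∀ᶠ y in 𝓝 x, FiberBundle.extend F (σ x) y = τ y := hτe.mono fun y hy => hy.symm
  rw [← secondDeriv_comm_pointwise g hD hσ hτ hτx]
  simp only [curvature, secondDeriv]
  rw [conn_conn_congr g hD hτ hτe' hX, conn_conn_congr g hD hτ hτe' hY,
    conn_congr (hτ.diffSecAt x) hτe', leviCivita_torsion g hX hY, map_sub]
  simp only [FiberBundle.extend_apply_self]
  abel

theorem curvature_eq_comm (g : Metric4 M) (hD : SmoothConnection D) (hσ : SmoothSec F σ)
    {X Y : Π x : M, TangentSpace (𝓡 4) x} (hX : SmoothSec E4 X) (hY : SmoothSec E4 Y) (x : M) :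
    curvature D x (X x) (Y x) (σ x) = D (fun y => D σ y (Y y)) x (X x)
      - D (fun y => D σ y (X y)) x (Y x) - D σ x (VectorField.mlieBracket (𝓡 4) X Y x) := by
  rw [curvature_eq g hD hσ, secondDeriv_eq g hD hσ (hX.diffSecAt x),
    secondDeriv_eq g hD hσ (hY.diffSecAt x),
    leviCivita_torsion g (hX.diffSecAt x) (hY.diffSecAt x), map_sub]
  abel

theorem curvature_add (g : Metric4 M) (hD : SmoothConnection D) (v w : TangentSpace (𝓡 4) x)
    (s t : V x) : curvature D x v w (s + t) = curvature D x v w s + curvature D x v w t := by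
  obtain ⟨σ, hσ, rfl, -⟩ := exists_smoothSec_extend F s
  obtain ⟨τ, hτ, rfl, -⟩ := exists_smoothSec_extend F t
  rw [curvature_eq g hD hσ, curvature_eq g hD hτ,
    curvature_eq g hD (hσ.add hτ), secondDeriv_add g hD hσ hτ, secondDeriv_add g hD hσ hτ]
  abel

theorem curvature_smul (g : Metric4 M) (hD : SmoothConnection D) (v w : TangentSpace (𝓡 4) x)
    (c : ℝ) (s : V x) : curvature D x v w (c • s) = c • curvature D x v w s := by
  obtain ⟨σ, hσ, rfl, -⟩ := exists_smoothSec_extend F s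
  obtain ⟨X, hX, rfl, -⟩ := exists_smoothSec_extend E4 v
  obtain ⟨Y, hY, rfl, -⟩ := exists_smoothSec_extend E4 w
  rw [curvature_eq g hD hσ, curvature_eq g hD (hσ.const_smul c),
    secondDeriv_smul g hD hσ contMDiff_const _ hX,
    secondDeriv_smul g hD hσ contMDiff_const _ hY]
  simp [smul_sub, mvfderiv_const]

theorem curvature_add_left (g : Metric4 M) (hD : SmoothConnection D)
    (v v' w : TangentSpace (𝓡 4) x) (s : V x) :
    curvature D x (v + v') w s = curvature D x v w s + curvature D x v' w s := by
  obtain ⟨σ, hσ, rfl, -⟩ := exists_smoothSec_extend F s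
  rw [curvature_eq g hD hσ, curvature_eq g hD hσ, curvature_eq g hD hσ, secondDeriv_add_left,
    secondDeriv_add_right g hD hσ]
  abel

theorem curvature_smul_left (g : Metric4 M) (hD : SmoothConnection D) (c : ℝ)
    (v w : TangentSpace (𝓡 4) x) (s : V x) :
    curvature D x (c • v) w s = c • curvature D x v w s := by
  obtain ⟨σ, hσ, rfl, -⟩ := exists_smoothSec_extend F s
  rw [curvature_eq g hD hσ, curvature_eq g hD hσ, secondDeriv_smul_left,
    secondDeriv_smul_right g hD hσ, smul_sub]

theorem curvature_swap (g : Metric4 M) (hD : SmoothConnection D)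
    (v w : TangentSpace (𝓡 4) x) (s : V x) : curvature D x w v s = -curvature D x v w s := by
  obtain ⟨σ, hσ, rfl, -⟩ := exists_smoothSec_extend F s
  rw [curvature_eq g hD hσ, curvature_eq g hD hσ]
  abel

/-- The curvature as a trilinear map. -/
def curvatureHom (g : Metric4 M) (hD : SmoothConnection D) (x : M) :
    TangentSpace (𝓡 4) x →ₗ[ℝ] TangentSpace (𝓡 4) x →ₗ[ℝ] V x →ₗ[ℝ] V x :=
  LinearMap.mk₂ ℝ
    (fun v w =>
      { toFun := curvature D x v w
        map_add' := curvature_add g hD v w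
        map_smul' := curvature_smul g hD v w })
    (fun v v' w => LinearMap.ext fun s => curvature_add_left g hD v v' w s)
    (fun c v w => LinearMap.ext fun s => curvature_smul_left g hD c v w s)
    (fun v w w' => LinearMap.ext fun s => by
      change curvature D x v (w + w') s = curvature D x v w s + curvature D x v w' s
      rw [curvature_swap g hD, curvature_add_left g hD, curvature_swap g hD v w,
        curvature_swap g hD v w']
      abel)
    (fun c v w => LinearMap.ext fun s => by
      change curvature D x v (c • w) s = c • curvature D x v w s
      rw [curvature_swap g hD, curvature_smul_left g hD, curvature_swap g hD v w, smul_neg,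
        neg_neg])

theorem curvatureHom_apply (g : Metric4 M) (hD : SmoothConnection D) (x : M)
    (v w : TangentSpace (𝓡 4) x) (s : V x) : curvatureHom g hD x v w s = curvature D x v w s :=
  rfl

end Curvature

/-! ### The first Bianchi identity and continuity of the scalar curvature. -/

section ScalarCurvature

variable {M : Type*} [TopologicalSpace M] [ChartedSpace E4 M] [IsManifold (𝓡 4) ∞ M] [T2Space M]

/-- The first Bianchi identity. -/
theorem bianchi (g : Metric4 M) (x : M) (u v w : TangentSpace (𝓡 4) x) :
    curvature (leviCivita g) x u v w + curvature (leviCivita g) x v w u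
      + curvature (leviCivita g) x w u v = 0 := by
  obtain ⟨X, hX, rfl, -⟩ := exists_smoothSec_extend E4 u
  obtain ⟨Y, hY, rfl, -⟩ := exists_smoothSec_extend E4 v
  obtain ⟨Z, hZ, rfl, -⟩ := exists_smoothSec_extend E4 w
  have hD := smooth_leviCivita g
  have : IsManifold (𝓡 4) (minSmoothness ℝ 3) M := by
    rw [minSmoothness_of_isRCLikeNormedField]; infer_instance
  have h2 : (minSmoothness ℝ 2 : WithTop ℕ∞) ≤ ∞ := by
    rw [minSmoothness_of_isRCLikeNormedField]; exact WithTop.coe_le_coe.2 (le_top : (2 : ℕ∞) ≤ ⊤)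
  have tor : ∀ {A B : Π x : M, TangentSpace (𝓡 4) x}, SmoothSec E4 A → SmoothSec E4 B →
      VectorField.mlieBracket (𝓡 4) A B
        = fun y => leviCivita g B y (A y) + (-1 : ℝ) • leviCivita g A y (B y) := fun hA hB =>
    funext fun y => by
      rw [leviCivita_torsion g (hA.diffSecAt y) (hB.diffSecAt y)]
      module
  -- Once the brackets are rewritten through the torsion-free connection, the Jacobi identity for X,
  -- Y, Z is the cyclic sum of curvatures.
  have jac := VectorField.leibniz_identity_mlieBracket_apply (I := 𝓡 4) (x := x)
    ((hX x).of_le h2) ((hY x).of_le h2) ((hZ x).of_le h2)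
  have br : ∀ {A B C : Π x : M, TangentSpace (𝓡 4) x}, SmoothSec E4 A → SmoothSec E4 B →
      SmoothSec E4 C → VectorField.mlieBracket (𝓡 4) A (VectorField.mlieBracket (𝓡 4) B C) x
      = leviCivita g (fun y => leviCivita g C y (B y)) x (A x)
        - leviCivita g (fun y => leviCivita g B y (C y)) x (A x)
        - leviCivita g A x (VectorField.mlieBracket (𝓡 4) B C x) := by
    intro A B C hA hB hC
    rw [leviCivita_torsion g (hA.diffSecAt x) ((smooth_mlieBracket hB hC).diffSecAt x)]
    conv_lhs => enter [1]; rw [tor hB hC]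
    have h1 := conn_add (D := leviCivita g) ((hD B C hB hC).diffSecAt x)
      (((hD C B hC hB).const_smul (-1)).diffSecAt x) (A x)
    have h2 := conn_smul (D := leviCivita g) (f := fun _ => (-1 : ℝ)) (x := x)
      mdifferentiableAt_const ((hD C B hC hB).diffSecAt x) (A x)
    rw [h1, h2]
    simp [mvfderiv_const]
    abel
  rw [VectorField.mlieBracket_swap_apply (V := VectorField.mlieBracket (𝓡 4) X Y),
    br hX hY hZ, br hZ hX hY, br hY hX hZ, ← sub_eq_zero] at jac
  rw [curvature_eq_comm g hD hZ hX hY, curvature_eq_comm g hD hX hY hZ,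
    curvature_eq_comm g hD hY hZ hX, VectorField.mlieBracket_swap_apply (V := Z), map_neg, ← jac]
  abel

theorem scalarCurvature_eq (g : Metric4 M) {x : M} {e : Fin 4 → TangentSpace (𝓡 4) x}
    (he : ∀ i j, g.inner x (e i) (e j) = if i = j then 1 else 0) :
    scalarCurvature g x
      = ∑ i, ∑ j, g.inner x (curvature (leviCivita g) x (e i) (e j) (e j)) (e i) := by
  let R := curvatureHom g (smooth_leviCivita g) x
  have h1 : ∀ v, ∑ j, R v (frame g x j) (frame g x j) = ∑ j, R v (e j) (e j) := fun v =>
    orthonormal_trace g (frame_orthonormal g x) he (R v)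
  let B : TangentSpace (𝓡 4) x →ₗ[ℝ] TangentSpace (𝓡 4) x →ₗ[ℝ] ℝ :=
    LinearMap.mk₂ ℝ (fun v w => g.inner x (∑ j, R v (e j) (e j)) w)
      (by intros; simp [Finset.sum_add_distrib])
      (by intros; simp [Finset.mul_sum])
      (by intros; simp [Finset.sum_add_distrib])
      (by intros; simp [Finset.mul_sum])
  have h2 := orthonormal_trace g (frame_orthonormal g x) he B
  simp only [B, LinearMap.mk₂_apply, ← h1] at h2
  simp only [h1] at h2
  have h3 : scalarCurvature g x
      = ∑ i, g.inner x (∑ j, R (frame g x i) (frame g x j) (frame g x j)) (frame g x i) := by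
    simp only [scalarCurvature, map_sum, _root_.sum_apply, R, curvatureHom_apply]
  rw [h3]
  simp only [h1]
  rw [h2]
  simp only [map_sum, _root_.sum_apply, R, curvatureHom_apply]

theorem continuous_scalarCurvature (g : Metric4 M) : Continuous (scalarCurvature g) := by
  rw [continuous_iff_continuousAt]
  intro x
  obtain ⟨E, hE, hEo⟩ := exists_smooth_orthonormal_frame g x
  have hD := smooth_leviCivita g
  have h : Continuous fun y => ∑ i, ∑ j, (g.inner y
      (leviCivita g (fun z => leviCivita g (E j) z (E j z)) y (E i y)) (E i y)
        - g.inner y (leviCivita g (fun z => leviCivita g (E j) z (E i z)) y (E j y)) (E i y)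
        - g.inner y (leviCivita g (E j) y (VectorField.mlieBracket (𝓡 4) (E i) (E j) y)) (E i y)) := by
    refine continuous_finsetSum _ fun i _ => continuous_finsetSum _ fun j _ => ?_
    refine ((ContMDiff.continuous (smooth_inner g ?_ (hE i))).sub
      (ContMDiff.continuous (smooth_inner g ?_ (hE i)))).sub
      (ContMDiff.continuous (smooth_inner g ?_ (hE i)))
    · exact hD _ _ (hE i) (hD _ _ (hE j) (hE j))
    · exact hD _ _ (hE j) (hD _ _ (hE i) (hE j))
    · exact hD _ _ (smooth_mlieBracket (hE i) (hE j)) (hE j)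
  refine h.continuousAt.congr ?_
  filter_upwards [hEo] with y hy
  rw [scalarCurvature_eq g hy]
  refine Finset.sum_congr rfl fun i _ => Finset.sum_congr rfl fun j _ => ?_
  rw [curvature_eq_comm g hD (hE j) (hE i) (hE j)]
  simp

end ScalarCurvature

/-! ### Clifford algebra: spin lift and the contraction forced by the Bianchi identity. -/

section CliffordAlgebra

variable {𝓐 : Type*} [Ring 𝓐] [Algebra ℂ 𝓐] {c : Fin 4 → 𝓐}

/-- `∑ₖₗ rₖₗ cₖ cₗ / 4`, the spin lift of the skew matrix `r`. -/
def spinLift (c : Fin 4 → 𝓐) (r : Fin 4 → Fin 4 → ℂ) : 𝓐 :=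
  (1 / 4 : ℂ) • ∑ k, ∑ l, r k l • (c k * c l)

theorem sum_rotate {ι A : Type*} [Fintype ι] [AddCommMonoid A] (f : ι → ι → ι → A) :
    ∑ i, ∑ j, ∑ k, f i j k = ∑ k, ∑ i, ∑ j, f i j k :=
  (Finset.sum_congr rfl fun _ _ => Finset.sum_comm).trans Finset.sum_comm

theorem sum_rotate₄ {ι A : Type*} [Fintype ι] [AddCommMonoid A] (f : ι → ι → ι → ι → A) :
    ∑ i, ∑ j, ∑ k, ∑ l, f i j k l = ∑ l, ∑ i, ∑ j, ∑ k, f i j k l :=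
  (Finset.sum_congr rfl fun _ _ => sum_rotate _).trans Finset.sum_comm

theorem clifford_mul_comm (hc : ∀ i j, c i * c j + c j * c i = (if i = j then -2 else 0 : ℂ) • 1)
    (i j : Fin 4) : c i * c j = -(c j * c i) + (if i = j then -2 else 0 : ℂ) • 1 :=
  eq_neg_add_of_add_eq (by rw [add_comm]; exact hc i j)

theorem clifford_mul_mul (hc : ∀ i j, c i * c j + c j * c i = (if i = j then -2 else 0 : ℂ) • 1)
    (k i j : Fin 4) :
    c k * c i * c j = c i * c j * c k - (if j = k then -2 else 0 : ℂ) • c i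
      + (if i = k then -2 else 0 : ℂ) • c j := by
  rw [clifford_mul_comm hc k i, add_mul, neg_mul, mul_assoc, clifford_mul_comm hc k j, mul_add,
    mul_neg, mul_smul_comm, mul_one, smul_mul_assoc, one_mul, mul_assoc (c i)]
  simp only [eq_comm (a := k)]
  abel

/-- This is the isomorphism so(4) ≅ spin(4). The commutator of c_k c_l with c_m is -2δ_{lm} c_k +
2δ_{km} c_l; skewness makes the two resulting sums equal, and the factor 1/4 normalizes the total.
-/
theorem spinLift_comm (hc : ∀ i j, c i * c j + c j * c i = (if i = j then -2 else 0 : ℂ) • 1)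
    {r : Fin 4 → Fin 4 → ℂ} (hr : ∀ k l, r k l = -r l k) (m : Fin 4) :
    spinLift c r * c m - c m * spinLift c r = ∑ l, r m l • c l := by
  have h : ∀ k l, (c k * c l) * c m - c m * (c k * c l)
      = (if l = m then -2 else 0 : ℂ) • c k - (if k = m then -2 else 0 : ℂ) • c l := by
    intro k l
    rw [← mul_assoc (c m), clifford_mul_mul hc m k l]
    abel
  have h2 : spinLift c r * c m - c m * spinLift c r
      = (1 / 4 : ℂ) • ∑ k, ∑ l, r k l • ((c k * c l) * c m - c m * (c k * c l)) := by
    simp only [spinLift, smul_mul_assoc, mul_smul_comm, Finset.sum_mul, Finset.mul_sum, smul_sub,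
      Finset.sum_sub_distrib]
  rw [h2]
  simp only [h, smul_sub, Finset.sum_sub_distrib]
  rw [Finset.sum_comm (f := fun k l => r k l • (if k = m then -2 else 0 : ℂ) • c l)]
  simp only [ite_smul, zero_smul, smul_ite, smul_zero, Finset.sum_ite_eq', Finset.mem_univ, if_true]
  rw [← smul_sub, ← Finset.sum_sub_distrib, Finset.smul_sum]
  refine Finset.sum_congr rfl fun l _ => ?_
  rw [hr l m]
  module

/-- The derivation [R, ·] annihilates the scalar c_k c_l + c_l c_k, while the product rule evaluates
it to -2(r_{kl} + r_{lk}). Thus skewness of the Riemann tensor in its last two slots comes from the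
Clifford relations, without a separate argument. -/
theorem skew_of_comm [Nontrivial 𝓐]
    (hc : ∀ i j, c i * c j + c j * c i = (if i = j then -2 else 0 : ℂ) • 1)
    {r : Fin 4 → Fin 4 → ℂ} {R : 𝓐} (h : ∀ m, R * c m - c m * R = ∑ l, r m l • c l)
    (k l : Fin 4) : r k l = -r l k := by
  have h1 : R * (c k * c l + c l * c k) - (c k * c l + c l * c k) * R = 0 := by
    rw [hc]; simp
  have h2 : R * (c k * c l + c l * c k) - (c k * c l + c l * c k) * R
      = (R * c k - c k * R) * c l + c k * (R * c l - c l * R)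
        + ((R * c l - c l * R) * c k + c l * (R * c k - c k * R)) := by
    noncomm_ring
  have h3 : ∀ a b, (∑ m, r a m • c m) * c b + c b * ∑ m, r a m • c m = (-2 * r a b) • (1 : 𝓐) := by
    intro a b
    simp only [Finset.sum_mul, Finset.mul_sum, smul_mul_assoc, mul_smul_comm,
      ← Finset.sum_add_distrib, ← smul_add, hc]
    simp only [ite_smul, zero_smul, smul_ite, smul_zero, Finset.sum_ite_eq', Finset.mem_univ,
      if_true, smul_smul, mul_comm]
  rw [h2, h, h, add_comm ((∑ m, r l m • c m) * c k), add_add_add_comm, h3,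
    add_comm (c k * _), h3, ← add_smul] at h1
  have := (smul_eq_zero.1 h1).resolve_right one_ne_zero
  linear_combination (-1 / 2 : ℂ) * this

/-- Permuting the indices of t cyclically changes the sum Q only by contractions: the three versions
are Q, Q + 4u and Q + 2u, where u is the contracted sum. By `hb` they add to zero, so 3Q + 6u = 0.
-/
theorem sum_cubic (hc : ∀ i j, c i * c j + c j * c i = (if i = j then -2 else 0 : ℂ) • 1)
    {t : Fin 4 → Fin 4 → Fin 4 → ℂ} (ht : ∀ i j k, t i j k = -t j i k)
    (hb : ∀ i j k, t i j k + t j k i + t k i j = 0) :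
    ∑ i, ∑ j, ∑ k, t i j k • (c i * c j * c k) = (-2 : ℂ) • ∑ i, ∑ j, t i j j • c i := by
  set Q := ∑ i, ∑ j, ∑ k, t i j k • (c i * c j * c k) with hQ
  set u := ∑ i, ∑ j, t i j j • c i with hu
  have hu' : ∑ i, ∑ j, t i j i • c j = -u := by
    rw [hu, Finset.sum_comm, ← Finset.sum_neg_distrib]
    refine Finset.sum_congr rfl fun i _ => ?_
    rw [← Finset.sum_neg_distrib]
    exact Finset.sum_congr rfl fun j _ => by rw [ht j i j, neg_smul]
  have ht0 : ∀ i k, t i i k = 0 := fun i k => by linear_combination (1 / 2 : ℂ) * ht i i k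
  have h2 : ∑ i, ∑ j, ∑ k, t j k i • (c i * c j * c k) = Q + (4 : ℂ) • u := by
    rw [Finset.sum_comm]
    have : ∀ j, ∑ i, ∑ k, t j k i • (c i * c j * c k)
        = ∑ k, ∑ i, (t j k i • (c j * c k * c i) - t j k i • (if k = i then -2 else 0 : ℂ) • c j
          + t j k i • (if j = i then -2 else 0 : ℂ) • c k) := by
      intro j
      rw [Finset.sum_comm]
      refine Finset.sum_congr rfl fun k _ => Finset.sum_congr rfl fun i _ => ?_
      rw [clifford_mul_mul hc i j k]
      module
    simp only [this, Finset.sum_add_distrib, Finset.sum_sub_distrib]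
    simp only [ite_smul, zero_smul, smul_ite, smul_zero, Finset.sum_ite_eq, Finset.mem_univ,
      if_true, smul_comm _ (-2 : ℂ), ← Finset.smul_sum, hu', ← hQ, ← hu]
    module
  have h3 : ∑ i, ∑ j, ∑ k, t k i j • (c i * c j * c k) = Q + (2 : ℂ) • u := by
    rw [sum_rotate]
    have : ∀ k i j, t k i j • (c i * c j * c k) = t k i j • (c k * c i * c j)
        + t k i j • (if j = k then -2 else 0 : ℂ) • c i
        - t k i j • (if i = k then -2 else 0 : ℂ) • c j := by
      intro k i j
      rw [clifford_mul_mul hc k i j]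
      module
    simp only [this, Finset.sum_add_distrib, Finset.sum_sub_distrib]
    rw [Finset.sum_congr rfl fun k _ => Finset.sum_comm
      (f := fun i j => t k i j • (if i = k then -2 else 0 : ℂ) • c j)]
    simp only [ite_smul, zero_smul, smul_ite, smul_zero, Finset.sum_ite_eq', Finset.mem_univ,
      if_true, smul_comm _ (-2 : ℂ), ← Finset.smul_sum, hu', ← hQ, ht0, Finset.sum_const_zero]
    module
  have h0 : Q + (∑ i, ∑ j, ∑ k, t j k i • (c i * c j * c k))
      + ∑ i, ∑ j, ∑ k, t k i j • (c i * c j * c k) = 0 := by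
    simp only [hQ, ← Finset.sum_add_distrib, ← add_smul, hb, zero_smul, Finset.sum_const_zero]
  rw [h2, h3] at h0
  have : (3 : ℂ) • (Q + (2 : ℂ) • u) = 0 := by rw [← h0]; module
  have := (smul_eq_zero.1 this).resolve_left (by norm_num)
  rw [eq_neg_of_add_eq_zero_left this, neg_smul]

/-- The algebraic core of the R/4 term: for each fixed l the first three Clifford factors form a
cubic sum to which `sum_cubic` applies, leaving a Ricci contraction with coefficient (1/4)(-2). -/
theorem sum_mul_spinLift
    (hc : ∀ i j, c i * c j + c j * c i = (if i = j then -2 else 0 : ℂ) • 1)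
    {r : Fin 4 → Fin 4 → Fin 4 → Fin 4 → ℂ} (hr : ∀ i j k l, r i j k l = -r j i k l)
    (hb : ∀ i j k l, r i j k l + r j k i l + r k i j l = 0) :
    ∑ i, ∑ j, c i * c j * spinLift c (r i j)
      = (-1 / 2 : ℂ) • ∑ l, ∑ i, (∑ j, r i j j l) • (c i * c l) := by
  have h1 : ∑ i, ∑ j, c i * c j * spinLift c (r i j)
      = (1 / 4 : ℂ) • ∑ l, (∑ i, ∑ j, ∑ k, r i j k l • (c i * c j * c k)) * c l := by
    simp only [spinLift, mul_smul_comm, ← Finset.smul_sum, Finset.sum_mul, Finset.mul_sum,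
      smul_mul_assoc, mul_assoc]
    congr 1
    exact sum_rotate₄ fun i j k l => r i j k l • (c i * (c j * (c k * c l)))
  rw [h1]
  simp only [fun l => sum_cubic hc (t := fun i j k => r i j k l) (fun i j k => hr i j k l)
    (fun i j k => hb i j k l), smul_mul_assoc, Finset.sum_mul, ← Finset.smul_sum, smul_smul,
    Finset.sum_smul]
  norm_num

end CliffordAlgebra

/-! ### Schur's lemma and traces on a complex plane. -/

section Schur

variable {P : Type*} [AddCommGroup P] [Module ℂ P]

/-- Commuting with two anticommuting square roots of `-1` forces a linear map of a complex plane to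
be scalar. -/
theorem eq_smul_of_commute (hP : Module.finrank ℂ P = 2) {I J T : P →ₗ[ℂ] P}
    (hI : ∀ s, I (I s) = -s) (hJ : ∀ s, J (J s) = -s) (hIJ : ∀ s, I (J s) = -J (I s))
    (hTI : ∀ s, T (I s) = I (T s)) (hTJ : ∀ s, T (J s) = J (T s)) :
    T = (LinearMap.trace ℂ P T / 2) • LinearMap.id := by
  have : FiniteDimensional ℂ P := Module.finite_of_finrank_pos (by omega)
  have : Nontrivial P := Module.nontrivial_of_finrank_pos (R := ℂ) (by omega)
  -- An eigenvector s of T cannot be an eigenvector of both I and J: their eigenvalues would square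
  -- to -1 while anticommutation makes their product zero. So I s or J s completes s to a basis, on
  -- which T acts by the single scalar α.
  obtain ⟨α, hα⟩ := Module.End.exists_eigenvalue T
  obtain ⟨s, hs⟩ := hα.exists_hasEigenvector
  have hs0 : s ≠ 0 := hs.2
  have hTs : T s = α • s := hs.apply_eq_smul
  have span : ∀ Q : P →ₗ[ℂ] P, (∀ s, T (Q s) = Q (T s)) → LinearIndependent ℂ ![s, Q s] →
      T = α • LinearMap.id := by
    intro Q hQ hli
    let B := basisOfLinearIndependentOfCardEqFinrank hli (by simp [hP])
    refine B.ext fun i => ?_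
    fin_cases i
    · simp [B, hTs]
    · simp [B, hTs, hQ]
  have dep : ∀ Q : P →ₗ[ℂ] P, ¬ LinearIndependent ℂ ![s, Q s] → ∃ μ : ℂ, Q s = μ • s := by
    intro Q hQ
    rw [LinearIndependent.pair_iff' hs0] at hQ
    push Not at hQ
    obtain ⟨μ, hμ⟩ := hQ
    exact ⟨μ, hμ.symm⟩
  have key : T = α • LinearMap.id := by
    by_cases h1 : LinearIndependent ℂ ![s, I s]
    · exact span I hTI h1
    by_cases h2 : LinearIndependent ℂ ![s, J s]
    · exact span J hTJ h2
    obtain ⟨μ, hμ⟩ := dep I h1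
    obtain ⟨ν, hν⟩ := dep J h2
    exfalso
    have e1 := hI s
    have e2 := hJ s
    have e3 := hIJ s
    simp only [hμ, hν, map_smul, smul_smul] at e1 e2 e3
    have f1 : (μ * μ + 1) • s = 0 := by rw [add_smul, e1]; simp
    have f2 : (ν * ν + 1) • s = 0 := by rw [add_smul, e2]; simp
    have f3 : (2 * (μ * ν)) • s = 0 := by
      rw [two_mul, add_smul]
      nth_rewrite 1 [mul_comm]
      rw [e3, mul_comm]
      simp
    have g1 := (smul_eq_zero.1 f1).resolve_right hs0
    have g2 := (smul_eq_zero.1 f2).resolve_right hs0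
    have g3 := (smul_eq_zero.1 f3).resolve_right hs0
    have : (1 : ℂ) = 0 := by linear_combination g2 - (ν * ν) * g1 + (ν * μ / 2) * g3
    exact one_ne_zero this
  rw [key]
  simp [hP]

/-- Anticommutation gives J Q J = Q, whereas cyclicity of the trace and J² = -1 give tr(J Q J) = -tr
Q. -/
theorem trace_eq_zero_of_anticomm {Q J : P →ₗ[ℂ] P} (hJ : ∀ s, J (J s) = -s)
    (hQJ : ∀ s, Q (J s) = -J (Q s)) : LinearMap.trace ℂ P Q = 0 := by
  have h1 : J * Q * J = Q := by
    ext s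
    simp [hQJ, hJ]
  have h2 : LinearMap.trace ℂ P (J * Q * J) = -LinearMap.trace ℂ P Q := by
    rw [LinearMap.trace_mul_comm, ← mul_assoc]
    have : J * J = -1 := by ext s; simp [hJ]
    rw [this]
    simp
  rw [h1] at h2
  linear_combination (1 / 2 : ℂ) * h2

/-- The derivation that T induces on Λ² of a plane is multiplication by tr T, the infinitesimal form
of the determinant. It links the curvature of W⁺ to that of L. -/
theorem alternating_trace (hP : Module.finrank ℂ P = 2) {L : Type*} [AddCommGroup L] [Module ℂ L]
    (η : P →ₗ[ℂ] P →ₗ[ℂ] L) (hη : ∀ s, η s s = 0) (T : P →ₗ[ℂ] P) (s t : P) :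
    η (T s) t + η s (T t) = LinearMap.trace ℂ P T • η s t := by
  have : FiniteDimensional ℂ P := Module.finite_of_finrank_pos (by omega)
  let B := Module.finBasisOfFinrankEq ℂ P hP
  have hswap : ∀ s t, η t s = -η s t := fun s t => by
    have := hη (s + t)
    simp only [map_add, LinearMap.add_apply, hη, zero_add, add_zero] at this
    exact eq_neg_of_add_eq_zero_left this
  have hT : ∀ j, T (B j) = ∑ i, LinearMap.toMatrix B B T i j • B i := fun j => by
    conv_lhs => rw [← B.sum_repr (T (B j))]
    simp [LinearMap.toMatrix_apply]
  have h : η ∘ₗ T + (η.compl₂ T) = LinearMap.trace ℂ P T • η := by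
    refine B.ext fun i => B.ext fun j => ?_
    rw [LinearMap.trace_eq_matrix_trace ℂ B]
    simp only [LinearMap.add_apply, LinearMap.comp_apply, LinearMap.compl₂_apply,
      LinearMap.smul_apply, Matrix.trace_fin_two, hT, Fin.sum_univ_two, map_add, map_smul]
    fin_cases i <;> fin_cases j <;> simp [hη, hswap (B 0) (B 1)] <;> module
  exact congrArg (fun f => f s t) h

end Schur

/-! ### The Weitzenböck curvature term at a point. -/

section PointwiseWeitzenboeck

variable {P N : Type*} [AddCommGroup P] [Module ℂ P] [AddCommGroup N] [Module ℂ N]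
  {a : Fin 4 → P →ₗ[ℂ] N} {b : Fin 4 → N →ₗ[ℂ] P}

/-- Clifford multiplication on `P × N`, exchanging the two factors. -/
def cliffordPair (a : Fin 4 → P →ₗ[ℂ] N) (b : Fin 4 → N →ₗ[ℂ] P) (i : Fin 4) :
    Module.End ℂ (P × N) :=
  (b i ∘ₗ LinearMap.snd ℂ P N).prod (a i ∘ₗ LinearMap.fst ℂ P N)

theorem cliffordPair_apply (i : Fin 4) (p : P × N) : cliffordPair a b i p = (b i p.2, a i p.1) :=
  rfl

/-- On P × N the curvature and the spin lift of r have the same commutators with Clifford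
multiplication, so their difference commutes with it and is scalar on P by `eq_smul_of_commute`. The
spin lift is traceless there, so the scalar is tr(RP)/2. The spin lift contributes the Ricci term by
`sum_mul_spinLift`, the scalar contributes the trace term. -/
theorem clifford_curvature_sum (hP : Module.finrank ℂ P = 2)
    (hba : ∀ i j s, b i (a j s) + b j (a i s) = (if i = j then -2 else 0 : ℂ) • s)
    (hab : ∀ i j t, a i (b j t) + a j (b i t) = (if i = j then -2 else 0 : ℂ) • t)
    {RP : Fin 4 → Fin 4 → P →ₗ[ℂ] P} {RN : Fin 4 → Fin 4 → N →ₗ[ℂ] N}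
    {r : Fin 4 → Fin 4 → Fin 4 → Fin 4 → ℂ}
    (hRN : ∀ i j k s, RN i j (a k s) = a k (RP i j s) + ∑ l, r i j k l • a l s)
    (hRP : ∀ i j k t, RP i j (b k t) = b k (RN i j t) + ∑ l, r i j k l • b l t)
    (hr : ∀ i j k l, r i j k l = -r j i k l)
    (hb : ∀ i j k l, r i j k l + r j k i l + r k i j l = 0) (s : P) :
    (1 / 2 : ℂ) • ∑ i, ∑ j, b i (a j (RP i j s))
      = (-1 / 4 : ℂ) • ∑ l, ∑ i, (∑ j, r i j j l) • b i (a l s)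
        + (1 / 4 : ℂ) • ∑ i, ∑ j, LinearMap.trace ℂ P (RP i j) • b i (a j s) := by
  have : Nontrivial P := Module.nontrivial_of_finrank_pos (R := ℂ) (by omega)
  let c := cliffordPair a b
  have hc : ∀ i j, c i * c j + c j * c i = (if i = j then -2 else 0 : ℂ) • 1 := by
    intro i j
    refine LinearMap.ext fun p => ?_
    exact Prod.ext (hba i j p.1) (hab i j p.2)
  let R : Fin 4 → Fin 4 → Module.End ℂ (P × N) := fun i j => (RP i j).prodMap (RN i j)
  have hR : ∀ i j m, R i j * c m - c m * R i j = ∑ l, r i j m l • c l := by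
    intro i j m
    refine LinearMap.ext fun p => ?_
    ext
    · simp [R, c, cliffordPair_apply, hRP, LinearMap.sum_apply, Prod.fst_sum]
    · simp [R, c, cliffordPair_apply, hRN, LinearMap.sum_apply, Prod.snd_sum]
  have hskew : ∀ i j k l, r i j k l = -r i j l k := fun i j => skew_of_comm hc (hR i j)
  have hT : ∀ i j m, (R i j - spinLift c (r i j)) * c m = c m * (R i j - spinLift c (r i j)) := by
    intro i j m
    have h1 := hR i j m
    rw [← spinLift_comm hc (hskew i j) m] at h1
    rw [← sub_eq_zero] at h1 ⊢
    rw [← h1]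
    simp only [sub_mul, mul_sub]
    abel
  -- The block of the spin lift acting on P; an even Clifford element preserves P.
  let S : Fin 4 → Fin 4 → P →ₗ[ℂ] P := fun i j =>
    (1 / 4 : ℂ) • ∑ k, ∑ l, r i j k l • (b k ∘ₗ a l)
  have hS : ∀ i j (p : P), spinLift c (r i j) (p, 0) = (S i j p, 0) := by
    intro i j p
    ext <;> simp [spinLift, S, c, cliffordPair_apply, LinearMap.sum_apply, Prod.fst_sum,
      Prod.snd_sum]
  have hba' : ∀ {i j}, i ≠ j → ∀ s, b i (a j s) = -b j (a i s) := fun hij s =>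
    eq_neg_of_add_eq_zero_left (by rw [hba, if_neg hij, zero_smul])
  have hab' : ∀ {i j}, i ≠ j → ∀ s, a i (b j s) = -a j (b i s) := fun hij s =>
    eq_neg_of_add_eq_zero_left (by rw [hab, if_neg hij, zero_smul])
  have hbb : ∀ i s, b i (a i s) = -s := fun i s => by
    have h : (2 : ℂ) • (b i (a i s) + s) = 0 := by
      have := hba i i s
      rw [if_pos rfl] at this
      rw [smul_add, two_smul ℂ (b i (a i s)), this]
      module
    exact eq_neg_of_add_eq_zero_left ((smul_eq_zero.1 h).resolve_left two_ne_zero)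
  have haa : ∀ i s, a i (b i s) = -s := fun i s => by
    have h : (2 : ℂ) • (a i (b i s) + s) = 0 := by
      have := hab i i s
      rw [if_pos rfl] at this
      rw [smul_add, two_smul ℂ (a i (b i s)), this]
      module
    exact eq_neg_of_add_eq_zero_left ((smul_eq_zero.1 h).resolve_left two_ne_zero)
  have hsq : ∀ {i j}, i ≠ j → ∀ s, b i (a j (b i (a j s))) = -s := by
    intro i j hij s
    rw [hba' hij (b i (a j s)), haa, map_neg, neg_neg, hbb]
  have hanti : ∀ {i j k}, i ≠ j → k ≠ i → k ≠ j → ∀ s,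
      b i (a j (b i (a k s))) = -b i (a k (b i (a j s))) := by
    intro i j k hij hki hkj s
    rw [hba' hij (b i (a k s)), haa, hba' hki.symm (b i (a j s)), haa]
    simp [hba' hkj]
  have htrQ : ∀ i j, i ≠ j → LinearMap.trace ℂ P (b i ∘ₗ a j) = 0 := by
    intro i j hij
    -- With a third index k, the operator c_i c_k squares to -1 and anticommutes with c_i c_j, which
    -- forces the trace of c_i c_j to vanish.
    obtain ⟨k, hki, hkj⟩ : ∃ k : Fin 4, k ≠ i ∧ k ≠ j := by
      revert i j; decide
    exact trace_eq_zero_of_anticomm (J := b i ∘ₗ a k) (fun s => hsq hki.symm s)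
      fun s => hanti hij hki hkj s
  have htrS : ∀ i j, LinearMap.trace ℂ P (S i j) = 0 := by
    intro i j
    simp only [S, map_smul, map_sum]
    rw [Finset.sum_eq_zero, smul_zero]
    intro k _
    refine Finset.sum_eq_zero fun l _ => ?_
    by_cases hkl : k = l
    · subst hkl
      have : r i j k k = 0 := by linear_combination (1 / 2 : ℂ) * hskew i j k k
      simp [this]
    · simp [htrQ k l hkl]
  have hcomm : ∀ i j k l s, (RP i j - S i j) (b k (a l s)) = b k (a l ((RP i j - S i j) s)) := by
    intro i j k l s
    have h : (R i j - spinLift c (r i j)) * (c k * c l)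
        = (c k * c l) * (R i j - spinLift c (r i j)) := by
      rw [← mul_assoc, hT, mul_assoc, hT, mul_assoc]
    have h2 := congrArg (fun f => (f (s, 0)).1) h
    simpa [R, c, cliffordPair_apply, hS] using h2
  have hscal : ∀ i j s, RP i j s = S i j s + (LinearMap.trace ℂ P (RP i j) / 2) • s := by
    intro i j s
    have h := eq_smul_of_commute hP (I := b 0 ∘ₗ a 1) (J := b 0 ∘ₗ a 2) (T := RP i j - S i j)
      (fun s => hsq (by decide) s) (fun s => hsq (by decide) s)
      (fun s => hanti (by decide) (by decide) (by decide) s)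
      (fun s => hcomm i j 0 1 s) (fun s => hcomm i j 0 2 s)
    have h2 := congrArg (fun f => f s) h
    simp only [LinearMap.sub_apply, map_sub, htrS, sub_zero, LinearMap.smul_apply,
      LinearMap.id_apply] at h2
    rw [← h2]
    abel
  have hsum := congrArg (fun f => (f (s, 0)).1) (sum_mul_spinLift hc hr hb)
  simp only [LinearMap.sum_apply, Module.End.mul_apply, hS, c, cliffordPair_apply, Prod.fst_sum,
    LinearMap.smul_apply, Prod.smul_fst] at hsum
  simp only [hscal, map_add, map_smul, Finset.sum_add_distrib, hsum]
  rw [smul_add, smul_smul]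
  congr 1
  · norm_num
  · simp only [Finset.smul_sum]
    refine Finset.sum_congr rfl fun i _ => Finset.sum_congr rfl fun j _ => ?_
    module

end PointwiseWeitzenboeck

/-! ### Curvature and parallel bilinear products. -/

section BundleProducts

variable {M : Type*} [TopologicalSpace M] [ChartedSpace E4 M] [IsManifold (𝓡 4) ∞ M] [T2Space M]
variable {F₁ : Type*} [NormedAddCommGroup F₁] [NormedSpace ℝ F₁] {V₁ : M → Type*}
    [TopologicalSpace (Bundle.TotalSpace F₁ V₁)] [∀ x, AddCommGroup (V₁ x)] [∀ x, Module ℝ (V₁ x)]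
    [∀ x, TopologicalSpace (V₁ x)] [∀ x, IsTopologicalAddGroup (V₁ x)]
    [∀ x, ContinuousSMul ℝ (V₁ x)] [FiberBundle F₁ V₁] [VectorBundle ℝ F₁ V₁]
  {F₂ : Type*} [NormedAddCommGroup F₂] [NormedSpace ℝ F₂] {V₂ : M → Type*}
    [TopologicalSpace (Bundle.TotalSpace F₂ V₂)] [∀ x, AddCommGroup (V₂ x)] [∀ x, Module ℝ (V₂ x)]
    [∀ x, TopologicalSpace (V₂ x)] [∀ x, IsTopologicalAddGroup (V₂ x)]
    [∀ x, ContinuousSMul ℝ (V₂ x)] [FiberBundle F₂ V₂] [VectorBundle ℝ F₂ V₂]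
  {F₃ : Type*} [NormedAddCommGroup F₃] [NormedSpace ℝ F₃] {V₃ : M → Type*}
    [TopologicalSpace (Bundle.TotalSpace F₃ V₃)] [∀ x, AddCommGroup (V₃ x)] [∀ x, Module ℝ (V₃ x)]
    [∀ x, TopologicalSpace (V₃ x)] [∀ x, IsTopologicalAddGroup (V₃ x)]
    [∀ x, ContinuousSMul ℝ (V₃ x)] [FiberBundle F₃ V₃] [VectorBundle ℝ F₃ V₃]
  {D₁ : CovariantDerivative (𝓡 4) F₁ V₁} {D₂ : CovariantDerivative (𝓡 4) F₂ V₂}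
  {D₃ : CovariantDerivative (𝓡 4) F₃ V₃} {m : ∀ x, V₁ x → V₂ x → V₃ x}

theorem secondDeriv_product (g : Metric4 M) (h₁ : SmoothConnection D₁) (h₂ : SmoothConnection D₂)
    (h₃ : SmoothConnection D₃) (hl : ∀ x a b t, m x (a - b) t = m x a t - m x b t)
    (hr : ∀ x s a b, m x s (a - b) = m x s a - m x s b)
    (hm : ∀ s t, SmoothSec F₁ s → SmoothSec F₂ t → SmoothSec F₃ (fun x => m x (s x) (t x)))
    (hp : ∀ s t x v, SmoothSec F₁ s → SmoothSec F₂ t →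
      D₃ (fun y => m y (s y) (t y)) x v = m x (D₁ s x v) (t x) + m x (s x) (D₂ t x v))
    {s : Π x, V₁ x} {t : Π x, V₂ x} (hs : SmoothSec F₁ s) (ht : SmoothSec F₂ t) (x : M)
    (v w : TangentSpace (𝓡 4) x) :
    secondDeriv g D₃ (fun y => m y (s y) (t y)) x v w
      = m x (secondDeriv g D₁ s x v w) (t x) + m x (D₁ s x w) (D₂ t x v)
        + m x (D₁ s x v) (D₂ t x w) + m x (s x) (secondDeriv g D₂ t x v w) := by
  obtain ⟨Y, hY, rfl, -⟩ := exists_smoothSec_extend E4 w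
  rw [secondDeriv_eq g h₃ (hm _ _ hs ht) (hY.diffSecAt x), secondDeriv_eq g h₁ hs (hY.diffSecAt x),
    secondDeriv_eq g h₂ ht (hY.diffSecAt x), hl, hr, hp _ _ _ _ hs ht]
  simp only [fun y => hp s t y (Y y) hs ht]
  rw [conn_add ((hm _ _ (h₁ Y s hY hs) ht).diffSecAt x) ((hm _ _ hs (h₂ Y t hY ht)).diffSecAt x),
    hp _ _ _ _ (h₁ Y s hY hs) ht, hp _ _ _ _ hs (h₂ Y t hY ht)]
  abel

/-- In the second derivative of a product the two mixed terms are together symmetric in v and w, so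
they cancel in the commutator. It serves for both Clifford multiplications and for the determinant
pairing. -/
theorem curvature_product [FiniteDimensional ℝ F₁] [ContMDiffVectorBundle ∞ F₁ V₁ (𝓡 4)]
    [FiniteDimensional ℝ F₂] [ContMDiffVectorBundle ∞ F₂ V₂ (𝓡 4)]
    [FiniteDimensional ℝ F₃] [ContMDiffVectorBundle ∞ F₃ V₃ (𝓡 4)]
    (g : Metric4 M) (h₁ : SmoothConnection D₁) (h₂ : SmoothConnection D₂)
    (h₃ : SmoothConnection D₃) (hl : ∀ x a b t, m x (a - b) t = m x a t - m x b t)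
    (hr : ∀ x s a b, m x s (a - b) = m x s a - m x s b)
    (hm : ∀ s t, SmoothSec F₁ s → SmoothSec F₂ t → SmoothSec F₃ (fun x => m x (s x) (t x)))
    (hp : ∀ s t x v, SmoothSec F₁ s → SmoothSec F₂ t →
      D₃ (fun y => m y (s y) (t y)) x v = m x (D₁ s x v) (t x) + m x (s x) (D₂ t x v))
    (x : M) (v w : TangentSpace (𝓡 4) x) (s : V₁ x) (t : V₂ x) :
    curvature D₃ x v w (m x s t) = m x (curvature D₁ x v w s) t + m x s (curvature D₂ x v w t) := by
  obtain ⟨s, hs, rfl, -⟩ := exists_smoothSec_extend F₁ s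
  obtain ⟨t, ht, rfl, -⟩ := exists_smoothSec_extend F₂ t
  have h := fun v w => secondDeriv_product g h₁ h₂ h₃ hl hr hm hp hs ht x v w
  rw [curvature_eq g h₃ (hm _ _ hs ht), curvature_eq g h₁ hs, curvature_eq g h₂ ht, hl, hr, h, h]
  abel

end BundleProducts

/-! ### Chain rules for derivatives of functions on M. -/

section ChainRule

variable {M : Type*} [TopologicalSpace M] [ChartedSpace E4 M]
  {G G' : Type*} [NormedAddCommGroup G] [NormedSpace ℝ G] [NormedAddCommGroup G'] [NormedSpace ℝ G']

theorem mvfderiv_comp_hasFDerivAt {f : M → G} {x : M} {h : G → G'} {h' : G →L[ℝ] G'}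
    (hh : HasFDerivAt h h' (f x)) (hf : MDifferentiableAt (𝓡 4) 𝓘(ℝ, G) f x)
    (v : TangentSpace (𝓡 4) x) :
    mvfderiv (𝓡 4) (fun y => h (f y)) x v = h' (mvfderiv (𝓡 4) f x v) := by
  have h1 := (hh.hasMFDerivAt.comp x hf.hasMFDerivAt).mfderiv
  exact congrArg (fun L : TangentSpace (𝓡 4) x →L[ℝ] G' => L v) h1

theorem mvfderiv_clm_comp {f : M → G} {x : M} (ℓ : G →L[ℝ] G')
    (hf : MDifferentiableAt (𝓡 4) 𝓘(ℝ, G) f x) (v : TangentSpace (𝓡 4) x) :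
    mvfderiv (𝓡 4) (fun y => ℓ (f y)) x v = ℓ (mvfderiv (𝓡 4) f x v) :=
  mvfderiv_comp_hasFDerivAt ℓ.hasFDerivAt hf v

theorem mvfderiv_comp_hasDerivAt {f : M → ℝ} {x : M} {h : ℝ → ℝ} {h' : ℝ}
    (hh : HasDerivAt h h' (f x)) (hf : MDifferentiableAt (𝓡 4) 𝓘(ℝ) f x)
    (v : TangentSpace (𝓡 4) x) :
    mvfderiv (𝓡 4) (fun y => h (f y)) x v = h' * mvfderiv (𝓡 4) f x v := by
  rw [mvfderiv_comp_hasFDerivAt hh.hasFDerivAt hf]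
  simp [mul_comm]

end ChainRule

/-! ### Complex linearity of unitary connections and of their curvature. -/

section Unitary

variable {M : Type*} [TopologicalSpace M] [ChartedSpace E4 M] [IsManifold (𝓡 4) ∞ M]
  {F : Type*} [NormedAddCommGroup F] [NormedSpace ℂ F]
  {V : M → Type*} [∀ x, NormedAddCommGroup (V x)] [∀ x, InnerProductSpace ℂ (V x)]
  [TopologicalSpace (Bundle.TotalSpace F V)] [FiberBundle F V] [VectorBundle ℝ F V]
  {D : CovariantDerivative (𝓡 4) F V}

theorem IsUnitaryConnection.smoothConnection (hD : IsUnitaryConnection D) :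
    SmoothConnection D := by
  intro X σ hX hσ
  have h := contMDiffOn_univ.1 (hD.smooth.contMDiff.contMDiff (σ := σ)
    (by simpa using hσ.contMDiffOn))
  exact ContMDiff.clm_bundle_apply (F₁ := E4) (F₂ := F) h hX

variable [VectorBundle ℂ F V]

theorem SmoothSec.complex_smul [ContMDiffVectorBundle ∞ F V (𝓡 4)] {s : Π x : M, V x} (c : ℂ)
    (hs : SmoothSec F s) : SmoothSec F (fun x => c • s x) := by
  intro x
  have h := (Bundle.contMDiffAt_section (F := F) x).1 (hs x)
  refine (Bundle.contMDiffAt_section (F := F) x).2 ?_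
  have hc : ContDiff ℝ ∞ (fun v : F => c • v) := by fun_prop
  refine (hc.contMDiff.contMDiffAt.comp x h).congr_of_eventuallyEq ?_
  filter_upwards [(trivializationAt F V x).open_baseSet.mem_nhds
    (FiberBundle.mem_baseSet_trivializationAt F V x)] with y hy
  exact ((trivializationAt F V x).linear ℂ hy).map_smul c (s y)

variable [T2Space M] [ContMDiffVectorBundle ∞ F V (𝓡 4)] [SmoothHermitian F V]

/-- Pair with an arbitrary smooth section: the Hermitian product rule and complex linearity of the
pairing in its second slot force the derivative to commute with `c`. -/
theorem IsUnitaryConnection.complex_smul (hD : IsUnitaryConnection D) {s : Π x : M, V x}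
    (hs : SmoothSec F s) (c : ℂ) (x : M) (v : TangentSpace (𝓡 4) x) :
    D (fun y => c • s y) x v = c • D s x v := by
  refine ext_inner_left ℂ fun u => ?_
  obtain ⟨t, ht, rfl, -⟩ := exists_smoothSec_extend F u
  have h1 := hD.unitary t (fun y => c • s y) x (ht.diffSecAt x) ((hs.complex_smul c).diffSecAt x) v
  have h2 := hD.unitary t s x (ht.diffSecAt x) (hs.diffSecAt x) v
  have h3 : MDifferentiableAt (𝓡 4) 𝓘(ℝ, ℂ) (fun y => ⟪t y, s y⟫_ℂ) x :=
    ((SmoothHermitian.smooth_inner t s ht hs) x).mdifferentiableAt (by simp)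
  have h4 := mvfderiv_clm_comp (ContinuousLinearMap.mul ℝ ℂ c) h3 v
  simp only [inner_smul_right, ContinuousLinearMap.mul_apply'] at h1 h4 ⊢
  rw [h4, h2] at h1
  linear_combination -h1

variable [FiniteDimensional ℝ F]

theorem IsUnitaryConnection.secondDeriv_complex_smul (g : Metric4 M) (hD : IsUnitaryConnection D)
    {s : Π x : M, V x} (hs : SmoothSec F s) (c : ℂ) (x : M) (v w : TangentSpace (𝓡 4) x) :
    secondDeriv g D (fun y => c • s y) x v w = c • secondDeriv g D s x v w := by
  obtain ⟨Y, hY, rfl, -⟩ := exists_smoothSec_extend E4 w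
  rw [secondDeriv_eq g hD.smoothConnection (hs.complex_smul c) (hY.diffSecAt x),
    secondDeriv_eq g hD.smoothConnection hs (hY.diffSecAt x)]
  simp only [hD.complex_smul hs]
  rw [hD.complex_smul (hD.smoothConnection Y s hY hs), smul_sub]

theorem IsUnitaryConnection.curvature_complex_smul (g : Metric4 M) (hD : IsUnitaryConnection D)
    (x : M) (v w : TangentSpace (𝓡 4) x) (c : ℂ) (s : V x) :
    curvature D x v w (c • s) = c • curvature D x v w s := by
  obtain ⟨s, hs, rfl, -⟩ := exists_smoothSec_extend F s
  rw [curvature_eq g hD.smoothConnection hs, curvature_eq g hD.smoothConnection (hs.complex_smul c),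
    hD.secondDeriv_complex_smul g hs, hD.secondDeriv_complex_smul g hs, smul_sub]

/-- The curvature endomorphism of a unitary connection. -/
def IsUnitaryConnection.curvatureEnd (g : Metric4 M) (hD : IsUnitaryConnection D)
    (x : M) (v w : TangentSpace (𝓡 4) x) : V x →ₗ[ℂ] V x where
  toFun := curvature D x v w
  map_add' := curvature_add g hD.smoothConnection v w
  map_smul' := hD.curvature_complex_smul g x v w

end Unitary

/-! ### Oriented orthonormal frames and the Levi-Civita symbol. -/

section Orthonormal

variable {M : Type*} [TopologicalSpace M] [ChartedSpace E4 M] [IsManifold (𝓡 4) ∞ M]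

theorem orientedFrame_orthonormal (g : Metric4 M) (o : Orientation4 M) (x : M) (i j : Fin 4) :
    g.inner x (orientedFrame g o x i) (orientedFrame g o x j) = if i = j then 1 else 0 := by
  have h := fun i => (frame g x).adjustToOrientation_apply_eq_or_eq_neg (o.orient x) i
  have hf := frame_orthonormal g x
  unfold orientedFrame
  by_cases hij : i = j
  · subst hij
    rcases h i with hi | hi <;> simp [hi, hf]
  · rcases h i with hi | hi <;> rcases h j with hj | hj <;> simp [hi, hj, hf, hij]

theorem orientedFrame_orientation (g : Metric4 M) (o : Orientation4 M) (x : M) :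
    (orientedFrame g o x).orientation = o.orient x :=
  Module.Basis.orientation_adjustToOrientation _ _

/-- A Vandermonde product in the indices: it vanishes on repetitions, changes sign under
transpositions, and equals 1!·2!·3! = 12 at (0, 1, 2, 3). This form can be evaluated numerically. -/
theorem leviCivitaSymbol_eq (i j k l : Fin 4) :
    (leviCivitaSymbol i j k l : ℂ) = (((j : ℂ) - i) * (k - i) * (l - i) * (k - j) * (l - j) * (l - k)) / 12 := by
  have h : ∀ i j k l : Fin 4, 12 * leviCivitaSymbol i j k l
      = ((j : ℤ) - i) * (k - i) * (l - i) * (k - j) * (l - j) * (l - k) := by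
    simp only [leviCivitaSymbol, Matrix.det_succ_row_zero, Fin.sum_univ_succ]
    decide
  have h2 := congrArg (fun z : ℤ => (z : ℂ)) (h i j k l)
  push_cast at h2
  rw [eq_div_iff (by norm_num), mul_comm, h2]

end Orthonormal

/-! ### Gradient and Laplacian in smooth orthonormal frames. -/

section Frame

variable {M : Type*} [TopologicalSpace M] [ChartedSpace E4 M] [IsManifold (𝓡 4) ∞ M]

theorem inner_grad (g : Metric4 M) (f : M → ℝ) (x : M) (v : TangentSpace (𝓡 4) x) :
    g.inner x (grad g f x) v = mvfderiv (𝓡 4) f x v := by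
  conv_rhs => rw [← frame_expand g x v]
  simp only [grad, map_sum, map_smul, _root_.sum_apply, _root_.smul_apply, smul_eq_mul]
  exact Finset.sum_congr rfl fun i _ => by rw [g.symm x v, mul_comm]

theorem smooth_grad [T2Space M] (g : Metric4 M) {f : M → ℝ} (hf : ContMDiff (𝓡 4) 𝓘(ℝ) ∞ f) :
    SmoothSec E4 (grad g f) := by
  intro x
  obtain ⟨E, hE, hEo⟩ := exists_smooth_orthonormal_frame g x
  have h : SmoothSec E4 (fun y => ∑ i, mvfderiv (𝓡 4) f y (E i y) • E i y) :=
    SmoothSec.sum _ fun i => SmoothSec.smul (smooth_mvfderiv hf (hE i)) (hE i)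
  refine (h x).congr_of_eventuallyEq ?_
  filter_upwards [hEo] with y hy
  congr 1
  rw [← orthonormal_expand g hy (grad g f y)]
  simp only [inner_grad]

theorem laplacian_eq [T2Space M] (g : Metric4 M) {f : M → ℝ} (hf : ContMDiff (𝓡 4) 𝓘(ℝ) ∞ f) {x : M}
    {E : Fin 4 → Π y : M, TangentSpace (𝓡 4) y} (hE : ∀ i, SmoothSec E4 (E i))
    (he : ∀ i j, g.inner x (E i x) (E j x) = if i = j then 1 else 0) :
    laplacian g f x = ∑ i, (mvfderiv (𝓡 4) (fun y => mvfderiv (𝓡 4) f y (E i y)) x (E i x)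
      - mvfderiv (𝓡 4) f x (leviCivita g (E i) x (E i x))) := by
  have h := orthonormal_trace g (frame_orthonormal g x) he
    (LinearMap.mk₂ ℝ (fun v w => g.inner x (leviCivita g (grad g f) x v) w)
      (by simp) (by simp) (by simp) (by simp))
  simp only [LinearMap.mk₂_apply] at h
  rw [laplacian, h]
  refine Finset.sum_congr rfl fun i _ => ?_
  have h2 := leviCivita_metric g ((smooth_grad g hf).diffSecAt x) ((hE i).diffSecAt x) (E i x)
  simp only [inner_grad] at h2
  rw [h2]
  ring

end Frame

/-! ### Chirality: only self-dual forms act on positive spinors. -/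

section LinearAlgebra

/-- Multiply e₀e₁e₂e₃ = -1 by e₀e₁, e₀e₂ and e₀e₃ after suitable reordering; each of these squares
to -1. The result says that a 2-form and its Hodge star act alike on P. -/
theorem chirality_relations {P N : Type*} [AddCommGroup P] [Module ℂ P] [AddCommGroup N]
    [Module ℂ N] {a : Fin 4 → P →ₗ[ℂ] N} {b : Fin 4 → N →ₗ[ℂ] P}
    (hba : ∀ i j s, b i (a j s) + b j (a i s) = (if i = j then -2 else 0 : ℂ) • s)
    (hab : ∀ i j t, a i (b j t) + a j (b i t) = (if i = j then -2 else 0 : ℂ) • t)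
    (hχ : ∀ s, b 0 (a 1 (b 2 (a 3 s))) = -s) (s : P) :
    b 2 (a 3 s) = b 0 (a 1 s) ∧ b 1 (a 3 s) = -b 0 (a 2 s) ∧ b 1 (a 2 s) = b 0 (a 3 s) := by
  have hba' : ∀ {i j}, i ≠ j → ∀ s, b i (a j s) = -b j (a i s) := fun hij s =>
    eq_neg_of_add_eq_zero_left (by rw [hba, if_neg hij, zero_smul])
  have hab' : ∀ {i j}, i ≠ j → ∀ s, a i (b j s) = -a j (b i s) := fun hij s =>
    eq_neg_of_add_eq_zero_left (by rw [hab, if_neg hij, zero_smul])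
  have hbb : ∀ i s, b i (a i s) = -s := fun i s => by
    have h : (2 : ℂ) • (b i (a i s) + s) = 0 := by
      have := hba i i s
      rw [if_pos rfl] at this
      rw [smul_add, two_smul ℂ (b i (a i s)), this]
      module
    exact eq_neg_of_add_eq_zero_left ((smul_eq_zero.1 h).resolve_left two_ne_zero)
  have haa : ∀ i s, a i (b i s) = -s := fun i s => by
    have h : (2 : ℂ) • (a i (b i s) + s) = 0 := by
      have := hab i i s
      rw [if_pos rfl] at this
      rw [smul_add, two_smul ℂ (a i (b i s)), this]
      module
    exact eq_neg_of_add_eq_zero_left ((smul_eq_zero.1 h).resolve_left two_ne_zero)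
  have hsq : ∀ {i j}, i ≠ j → ∀ s, b i (a j (b i (a j s))) = -s := by
    intro i j hij s
    rw [hba' hij (b i (a j s)), haa, map_neg, neg_neg, hbb]
  have h02 : b 0 (a 2 (b 1 (a 3 s))) = s := by
    rw [hab' (by decide), map_neg, hχ, neg_neg]
  have h03 : b 0 (a 3 (b 1 (a 2 s))) = -s := by
    rw [hba' (i := 1) (j := 2) (by decide), map_neg, map_neg, hab' (i := 3) (j := 2) (by decide),
      map_neg, neg_neg, hba' (i := 3) (j := 1) (by decide)]
    rw [map_neg, map_neg, h02]
  refine ⟨?_, ?_, ?_⟩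
  · have := congrArg (fun t => b 0 (a 1 t)) (hχ s)
    simp only [hsq (show (0 : Fin 4) ≠ 1 by decide), map_neg] at this
    exact neg_injective this
  · have := congrArg (fun t => b 0 (a 2 t)) h02
    simp only [hsq (show (0 : Fin 4) ≠ 2 by decide)] at this
    rw [← this, neg_neg]
  · have := congrArg (fun t => b 0 (a 3 t)) h03
    simp only [hsq (show (0 : Fin 4) ≠ 3 by decide), map_neg] at this
    exact neg_injective this

/-- The relations `h1`, `h2`, `h3` make Q self-dual, so the anti-self-dual part of F pairs with it
to zero. -/
theorem selfDual_clifford {P : Type*} [AddCommGroup P] [Module ℂ P] {F : Fin 4 → Fin 4 → ℂ}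
    (hF : ∀ i j, F i j = -F j i) {Q : Fin 4 → Fin 4 → P} (hQ : ∀ i j, i ≠ j → Q i j = -Q j i)
    (h1 : Q 2 3 = Q 0 1) (h2 : Q 1 3 = -Q 0 2) (h3 : Q 1 2 = Q 0 3) :
    ∑ i, ∑ j, ((F i j + (1 / 2) * ∑ k, ∑ l, (leviCivitaSymbol i j k l : ℂ) * F k l) / 2) • Q i j
      = ∑ i, ∑ j, F i j • Q i j := by
  have hF0 : ∀ i, F i i = 0 := fun i => by linear_combination (1 / 2 : ℂ) * hF i i
  simp only [leviCivitaSymbol_eq, Fin.sum_univ_four, hF0, hF 1 0, hF 2 0, hF 3 0, hF 2 1, hF 3 1,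
    hF 3 2, hQ 1 0 (by decide), hQ 2 0 (by decide), hQ 3 0 (by decide), hQ 2 1 (by decide),
    hQ 3 1 (by decide), hQ 3 2 (by decide), h1, h2, h3]
  norm_num
  module

end LinearAlgebra

/-! ### The Weitzenböck and Bochner formulas for harmonic spinors and monopoles. -/

section Weitzenboeck

variable {M : Type*} [TopologicalSpace M] [T2Space M]
    [ChartedSpace E4 M] [IsManifold (𝓡 4) ∞ M]
    {g : Metric4 M} {o : Orientation4 M}
    {Wp Wm L : M → Type*}
    [∀ x, NormedAddCommGroup (Wp x)] [∀ x, InnerProductSpace ℂ (Wp x)]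
    [TopologicalSpace (Bundle.TotalSpace C2 Wp)] [FiberBundle C2 Wp]
    [VectorBundle ℂ C2 Wp] [VectorBundle ℝ C2 Wp]
    [ContMDiffVectorBundle ∞ C2 Wp (𝓡 4)] [SmoothHermitian C2 Wp]
    [∀ x, NormedAddCommGroup (Wm x)] [∀ x, InnerProductSpace ℂ (Wm x)]
    [TopologicalSpace (Bundle.TotalSpace C2 Wm)] [FiberBundle C2 Wm]
    [VectorBundle ℂ C2 Wm] [VectorBundle ℝ C2 Wm]
    [ContMDiffVectorBundle ∞ C2 Wm (𝓡 4)] [SmoothHermitian C2 Wm]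
    [∀ x, NormedAddCommGroup (L x)] [∀ x, InnerProductSpace ℂ (L x)]
    [TopologicalSpace (Bundle.TotalSpace ℂ L)] [FiberBundle ℂ L]
    [VectorBundle ℂ ℂ L] [VectorBundle ℝ ℂ L]
    [ContMDiffVectorBundle ∞ ℂ L (𝓡 4)] [SmoothHermitian ℂ L]
    {𝔰 : SpinCStructure Wp Wm L g o} (A : SpinCConnection 𝔰)

theorem curvature_cP (x : M) (v w u : TangentSpace (𝓡 4) x) (s : Wp x) :
    curvature A.nablaM x v w (𝔰.cP x u s)
      = 𝔰.cP x (curvature (leviCivita g) x v w u) s + 𝔰.cP x u (curvature A.nablaP x v w s) :=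
  curvature_product (m := fun x u s => 𝔰.cP x u s) g (smooth_leviCivita g)
    A.unitary_P.smoothConnection A.unitary_M.smoothConnection (by simp) (by simp)
    𝔰.smooth_P (fun X s x v hX hs => A.clifford_P X s x (hX.diffSecAt x) (hs.diffSecAt x) v)
    x v w u s

theorem curvature_cM (x : M) (v w u : TangentSpace (𝓡 4) x) (s : Wm x) :
    curvature A.nablaP x v w (𝔰.cM x u s)
      = 𝔰.cM x (curvature (leviCivita g) x v w u) s + 𝔰.cM x u (curvature A.nablaM x v w s) :=
  curvature_product (m := fun x u s => 𝔰.cM x u s) g (smooth_leviCivita g)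
    A.unitary_M.smoothConnection A.unitary_P.smoothConnection (by simp) (by simp)
    𝔰.smooth_M (fun X s x v hX hs => A.clifford_M X s x (hX.diffSecAt x) (hs.diffSecAt x) v)
    x v w u s

theorem curvature_det (x : M) (v w : TangentSpace (𝓡 4) x) (s t : Wp x) :
    curvature A.A x v w (𝔰.det x s t)
      = 𝔰.det x (curvature A.nablaP x v w s) t + 𝔰.det x s (curvature A.nablaP x v w t) :=
  curvature_product (m := fun x s t => 𝔰.det x s t) g A.unitary_P.smoothConnection
    A.unitary_P.smoothConnection A.unitary_A.smoothConnection (by simp) (by simp)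
    𝔰.smooth_det (fun s t x v hs ht => A.det_compat s t x (hs.diffSecAt x) (ht.diffSecAt x) v)
    x v w s t

theorem finrank_fibre {F : Type*} [NormedAddCommGroup F] [NormedSpace ℂ F] {V : M → Type*}
    [∀ x, NormedAddCommGroup (V x)] [∀ x, InnerProductSpace ℂ (V x)]
    [TopologicalSpace (Bundle.TotalSpace F V)] [FiberBundle F V] [VectorBundle ℂ F V] (x : M) :
    Module.finrank ℂ (V x) = Module.finrank ℂ F :=
  ((trivializationAt F V x).linearEquivAt ℂ x
    (FiberBundle.mem_baseSet_trivializationAt F V x)).finrank_eq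

theorem curvature_line (x : M) (v w : TangentSpace (𝓡 4) x) (l : L x) :
    curvature A.A x v w l = A.curvatureForm x v w • l := by
  set l₀ : L x := (trivializationAt ℂ L x).symm x 1 with hl₀
  have hx := FiberBundle.mem_baseSet_trivializationAt ℂ L x
  have hne : l₀ ≠ 0 := by
    intro h
    have h1 := (trivializationAt ℂ L x).apply_mk_symm hx (1 : ℂ)
    have h2 := ((trivializationAt ℂ L x).linearEquivAt ℂ x hx).map_zero
    rw [← hl₀, h] at h1
    have h3 : ((trivializationAt ℂ L x) ⟨x, 0⟩).2 = (0 : ℂ) := h2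
    rw [h1] at h3
    exact one_ne_zero h3
  have hfin : Module.finrank ℂ (L x) = 1 := by rw [finrank_fibre (F := ℂ)]; simp
  obtain ⟨c, hc⟩ := (finrank_eq_one_iff_of_nonzero' l₀ hne).1 hfin (curvature A.A x v w l₀)
  have hF : A.curvatureForm x v w = c := by
    simp only [SpinCConnection.curvatureForm, ← hl₀, ← hc, inner_smul_right]
    rw [mul_div_cancel_right₀ _ (inner_self_ne_zero.2 hne)]
  obtain ⟨d, rfl⟩ := (finrank_eq_one_iff_of_nonzero' l₀ hne).1 hfin l
  rw [A.unitary_A.curvature_complex_smul g, ← hc, hF, smul_comm]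

theorem curvatureForm_swap (x : M) (v w : TangentSpace (𝓡 4) x) :
    A.curvatureForm x v w = -A.curvatureForm x w v := by
  simp only [SpinCConnection.curvatureForm]
  rw [curvature_swap g A.unitary_A.smoothConnection w v]
  simp [neg_div]

theorem finrank_Wp (x : M) : Module.finrank ℂ (Wp x) = 2 := by
  rw [finrank_fibre (F := C2)]; simp

/-- The parallel pairing `det` transports the curvature of W⁺ to that of L as a derivation, which is
the trace by `alternating_trace`. The scalar can be read off because `norm_det` gives `det` unit
length on an orthonormal pair. -/
theorem trace_curvature (x : M) (v w : TangentSpace (𝓡 4) x) :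
    LinearMap.trace ℂ (Wp x) (A.unitary_P.curvatureEnd g x v w) = A.curvatureForm x v w := by
  have hfin := finrank_Wp (Wp := Wp) x
  have : FiniteDimensional ℂ (Wp x) := Module.finite_of_finrank_pos (by omega)
  let B := (stdOrthonormalBasis ℂ (Wp x)).reindex (finCongr hfin)
  have hB := orthonormal_iff_ite.1 B.orthonormal
  have hne : 𝔰.det x (B 0) (B 1) ≠ 0 := by
    intro h
    have h1 := 𝔰.norm_det x (B 0) (B 1)
    rw [h, hB, B.orthonormal.1, B.orthonormal.1] at h1
    simp at h1
  have h1 := alternating_trace hfin (𝔰.det x) (𝔰.det_self x) (A.unitary_P.curvatureEnd g x v w)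
    (B 0) (B 1)
  have h2 := curvature_det A x v w (B 0) (B 1)
  rw [curvature_line] at h2
  have h3 : (LinearMap.trace ℂ (Wp x) (A.unitary_P.curvatureEnd g x v w)
      - A.curvatureForm x v w) • 𝔰.det x (B 0) (B 1) = 0 := by
    rw [sub_smul, ← h1, h2]
    exact sub_self _
  exact sub_eq_zero.1 ((smul_eq_zero.1 h3).resolve_right hne)

theorem cliff_P_ortho {x : M} {e : Fin 4 → TangentSpace (𝓡 4) x}
    (he : ∀ i j, g.inner x (e i) (e j) = if i = j then 1 else 0) (i j : Fin 4) (s : Wp x) :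
    𝔰.cM x (e i) (𝔰.cP x (e j) s) + 𝔰.cM x (e j) (𝔰.cP x (e i) s)
      = (if i = j then -2 else 0 : ℂ) • s := by
  rw [𝔰.clifford_P, he]
  split_ifs
  · rw [mul_one, ← Complex.coe_smul]; norm_num
  · simp

theorem cliff_M_ortho {x : M} {e : Fin 4 → TangentSpace (𝓡 4) x}
    (he : ∀ i j, g.inner x (e i) (e j) = if i = j then 1 else 0) (i j : Fin 4) (s : Wm x) :
    𝔰.cP x (e i) (𝔰.cM x (e j) s) + 𝔰.cP x (e j) (𝔰.cM x (e i) s)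
      = (if i = j then -2 else 0 : ℂ) • s := by
  rw [𝔰.clifford_M, he]
  split_ifs
  · rw [mul_one, ← Complex.coe_smul]; norm_num
  · simp

/-- The Clifford action of the full curvature of `L` on `W⁺` is that of its self-dual part. -/
theorem curvature_action (x : M) (χ : Wp x) :
    A.selfDualAction x χ = (1 / 2 : ℂ) • ∑ i, ∑ j,
      A.curvatureForm x (orientedFrame g o x i) (orientedFrame g o x j) •
        𝔰.cM x (orientedFrame g o x i) (𝔰.cP x (orientedFrame g o x j) χ) := by
  have he := orientedFrame_orthonormal g o x
  have hba := cliff_P_ortho (𝔰 := 𝔰) he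
  obtain ⟨h1, h2, h3⟩ := chirality_relations (a := fun i => 𝔰.cP x (orientedFrame g o x i))
    (b := fun i => 𝔰.cM x (orientedFrame g o x i)) hba (cliff_M_ortho (𝔰 := 𝔰) he)
    (𝔰.chirality x (orientedFrame g o x) he (orientedFrame_orientation g o x)) χ
  unfold SpinCConnection.selfDualAction SpinCConnection.selfDualCurvature
  congr 1
  exact selfDual_clifford (F := fun i j =>
      A.curvatureForm x (orientedFrame g o x i) (orientedFrame g o x j))
    (Q := fun i j => 𝔰.cM x (orientedFrame g o x i) (𝔰.cP x (orientedFrame g o x j) χ))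
    (fun i j => curvatureForm_swap A x _ _)
    (fun i j hij => eq_neg_of_add_eq_zero_left (by rw [hba, if_neg hij, zero_smul])) h1 h2 h3

theorem dirac_eq_sum {x : M} {e : Fin 4 → TangentSpace (𝓡 4) x}
    (he : ∀ i j, g.inner x (e i) (e j) = if i = j then 1 else 0) (φ : Π x : M, Wp x) :
    A.dirac φ x = ∑ i, 𝔰.cP x (e i) (A.nablaP φ x (e i)) := by
  have h := orthonormal_trace g (frame_orthonormal g x) he
    (LinearMap.mk₂ ℝ (fun v w => 𝔰.cP x v (A.nablaP φ x w))
      (by simp) (by simp) (by simp) (fun c v w => by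
        rw [map_smul, ← Complex.coe_smul, map_smul, Complex.coe_smul]))
  exact h

theorem normSqNabla_eq_sum {x : M} {e : Fin 4 → TangentSpace (𝓡 4) x}
    (he : ∀ i j, g.inner x (e i) (e j) = if i = j then 1 else 0) (φ : Π x : M, Wp x) :
    A.normSqNabla φ x = ∑ i, ‖A.nablaP φ x (e i)‖ ^ 2 := by
  have h := orthonormal_trace g (frame_orthonormal g x) he
    (LinearMap.mk₂ ℝ (fun v w => (⟪A.nablaP φ x v, A.nablaP φ x w⟫_ℂ).re)
      (by simp) (fun c v w => by
        rw [map_smul, ← Complex.coe_smul, inner_smul_left]; simp)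
      (by simp) (fun c v w => by
        rw [map_smul, ← Complex.coe_smul, inner_smul_right]; simp))
  simp only [LinearMap.mk₂_apply] at h
  have hn : ∀ s : Wp x, (⟪s, s⟫_ℂ).re = ‖s‖ ^ 2 := fun s => by
    rw [inner_self_eq_norm_sq_to_K]; norm_cast
  simp only [hn] at h
  exact h

/-- For i ≠ j the operator e_i e_j is skew-adjoint. Hence pairing with φ retains only the diagonal
of the Ricci contraction, and symmetry of Ricci is not needed. -/
theorem re_inner_clifford {x : M} {e : Fin 4 → TangentSpace (𝓡 4) x}
    (he : ∀ i j, g.inner x (e i) (e j) = if i = j then 1 else 0) (i j : Fin 4) (s : Wp x) :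
    (⟪s, 𝔰.cM x (e i) (𝔰.cP x (e j) s)⟫_ℂ).re = if i = j then -‖s‖ ^ 2 else 0 := by
  have h1 := 𝔰.skew x (e i) s (𝔰.cP x (e j) s)
  have h2 := 𝔰.skew x (e j) s (𝔰.cP x (e i) s)
  have h3 := congrArg (fun t => (⟪s, t⟫_ℂ).re) (cliff_P_ortho (𝔰 := 𝔰) he i j s)
  have h4 := congrArg Complex.re (inner_conj_symm (𝕜 := ℂ) (𝔰.cP x (e i) s) (𝔰.cP x (e j) s))
  rw [Complex.conj_re, h2, h1, Complex.neg_re, Complex.neg_re] at h4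
  simp only [inner_add_right, Complex.add_re, inner_smul_right] at h3
  have hn : (⟪s, s⟫_ℂ).re = ‖s‖ ^ 2 := by
    rw [inner_self_eq_norm_sq_to_K]; norm_cast
  split_ifs at h3 ⊢ with hij
  · subst hij
    rw [Complex.mul_re, hn] at h3
    norm_num at h3
    linarith
  · simp at h3
    linarith

/-- `∇^* ∇ φ` of a harmonic spinor, in terms of the curvature of the spin-c connection. -/
theorem sum_secondDeriv_of_dirac {φ : Π x : M, Wp x} (hφ : SmoothSec C2 φ)
    (hD : ∀ x, A.dirac φ x = 0) {x : M} {e : Fin 4 → TangentSpace (𝓡 4) x}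
    (he : ∀ i j, g.inner x (e i) (e j) = if i = j then 1 else 0) :
    ∑ i, secondDeriv g A.nablaP φ x (e i) (e i)
      = (1 / 2 : ℂ) • ∑ i, ∑ j,
        𝔰.cM x (e i) (𝔰.cP x (e j) (curvature A.nablaP x (e i) (e j) (φ x))) := by
  obtain ⟨E, hE, hEx, hEo⟩ := exists_smooth_orthonormal_extension g x 4 e he
  obtain rfl : (fun i => E i x) = e := funext hEx
  have hP := A.unitary_P.smoothConnection
  have hsec : ∀ i, SmoothSec C2 (fun y => A.nablaP φ y (E i y)) := fun i => hP _ _ (hE i) hφ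
  have hc : ∀ i, SmoothSec C2 (fun y => 𝔰.cP y (E i y) (A.nablaP φ y (E i y))) := fun i =>
    𝔰.smooth_P _ _ (hE i) (hsec i)
  -- Differentiate Σ E_i · ∇_{E_i} φ = 0 along v, separating the derivatives of the frame from the
  -- second derivatives of φ.
  have h0 : ∀ v, ∑ i, (𝔰.cP x (leviCivita g (E i) x v) (A.nablaP φ x (E i x))
      + 𝔰.cP x (E i x) (A.nablaP φ x (leviCivita g (E i) x v)))
      + ∑ i, 𝔰.cP x (E i x) (secondDeriv g A.nablaP φ x v (E i x)) = 0 := by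
    intro v
    have h1 : A.nablaM (fun y => ∑ i, 𝔰.cP y (E i y) (A.nablaP φ y (E i y))) x v = 0 := by
      have hz : ContMDiff (𝓡 4) ((𝓡 4).prod 𝓘(ℝ, C2)) ∞
          (fun y => (Bundle.TotalSpace.mk' C2 y (0 : Wm y) : Bundle.TotalSpace C2 Wm)) :=
        Bundle.contMDiff_zeroSection ℝ Wm
      rw [conn_congr (σ := fun y => (0 : Wm y)) (SmoothSec.diffSecAt hz x), conn_zero]
      filter_upwards [hEo] with y hy
      rw [← dirac_eq_sum A hy, hD]
    rw [conn_sum _ hc] at h1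
    rw [← Finset.sum_add_distrib, ← h1]
    refine Finset.sum_congr rfl fun i _ => ?_
    rw [A.clifford_P _ _ x ((hE i).diffSecAt x) ((hsec i).diffSecAt x),
      secondDeriv_eq g hP hφ ((hE i).diffSecAt x), map_sub]
    abel
  -- The frame need not be parallel at `x`: orthonormality near `x` makes its connection matrix w
  -- skew, and the two families of frame terms cancel.
  have hω : ∀ v, ∑ i, (𝔰.cP x (leviCivita g (E i) x v) (A.nablaP φ x (E i x))
      + 𝔰.cP x (E i x) (A.nablaP φ x (leviCivita g (E i) x v))) = 0 := by
    intro v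
    let w : Fin 4 → Fin 4 → ℝ := fun i k => g.inner x (leviCivita g (E i) x v) (E k x)
    have hw : ∀ i k, w i k = -w k i := by
      intro i k
      have h1 := leviCivita_metric g ((hE i).diffSecAt x) ((hE k).diffSecAt x) v
      have h2 : mvfderiv (𝓡 4) (fun y => g.inner y (E i y) (E k y)) x v = 0 := by
        have : (fun y => g.inner y (E i y) (E k y)) =ᶠ[𝓝 x] fun _ => if i = k then 1 else 0 :=
          hEo.mono fun y hy => hy i k
        have h3 : mvfderiv (𝓡 4) (fun y => g.inner y (E i y) (E k y)) x
            = mvfderiv (𝓡 4) (fun _ : M => if i = k then (1 : ℝ) else 0) x := by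
          ext u
          exact congrArg (fun L : TangentSpace (𝓡 4) x →L[ℝ] ℝ => L u) this.mfderiv_eq
        rw [h3, mvfderiv_const]
        rfl
      rw [h2, g.symm x (E i x)] at h1
      simp only [w]
      linarith
    have hexp : ∀ i, leviCivita g (E i) x v = ∑ k, w i k • E k x := fun i =>
      (orthonormal_expand g he _).symm
    have h1 : ∀ i, 𝔰.cP x (leviCivita g (E i) x v) (A.nablaP φ x (E i x))
        = ∑ k, w i k • 𝔰.cP x (E k x) (A.nablaP φ x (E i x)) := fun i => by
      rw [hexp]; simp
    have h2 : ∀ i, 𝔰.cP x (E i x) (A.nablaP φ x (leviCivita g (E i) x v))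
        = ∑ k, w i k • 𝔰.cP x (E i x) (A.nablaP φ x (E k x)) := fun i => by
      rw [hexp, map_sum, map_sum]
      refine Finset.sum_congr rfl fun k _ => ?_
      rw [map_smul, ← Complex.coe_smul, map_smul, Complex.coe_smul]
    simp only [h1, h2, Finset.sum_add_distrib]
    rw [Finset.sum_comm, ← Finset.sum_add_distrib]
    refine Finset.sum_eq_zero fun i _ => ?_
    rw [← Finset.sum_add_distrib]
    refine Finset.sum_eq_zero fun k _ => ?_
    rw [hw k i, neg_smul, neg_add_cancel]
  simp only [hω, zero_add] at h0
  set S := fun i j => secondDeriv g A.nablaP φ x (E i x) (E j x) with hS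
  -- Clifford multiplication of the differentiated equation gives Σ e_i e_j S_{ij} = 0. Renaming
  -- indices and using the Clifford relation gives Σ e_i e_j S_{ji} = -2 Σ S_{ii}. Their difference
  -- is the curvature sum.
  have h1 : ∑ i, ∑ j, 𝔰.cM x (E i x) (𝔰.cP x (E j x) (S i j)) = 0 := by
    refine Finset.sum_eq_zero fun i _ => ?_
    rw [← map_sum, h0, map_zero]
  have h2 : ∑ i, ∑ j, 𝔰.cM x (E j x) (𝔰.cP x (E i x) (S j i)) = 0 := by
    rw [Finset.sum_comm, h1]
  have h3 : ∀ i j, 𝔰.cM x (E j x) (𝔰.cP x (E i x) (S j i))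
      = (if i = j then -2 else 0 : ℂ) • S j i - 𝔰.cM x (E i x) (𝔰.cP x (E j x) (S j i)) :=
    fun i j => eq_sub_of_add_eq (by rw [add_comm]; exact cliff_P_ortho (𝔰 := 𝔰) he i j _)
  simp only [h3, Finset.sum_sub_distrib, ite_smul, zero_smul, Finset.sum_ite_eq, Finset.mem_univ,
    if_true, ← Finset.smul_sum] at h2
  have h4 : ∑ i, ∑ j, 𝔰.cM x (E i x) (𝔰.cP x (E j x)
      (curvature A.nablaP x (E i x) (E j x) (φ x)))
      = (0 : Wp x) - ∑ i, ∑ j, 𝔰.cM x (E i x) (𝔰.cP x (E j x) (S j i)) := by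
    rw [← h1, ← Finset.sum_sub_distrib]
    refine Finset.sum_congr rfl fun i _ => ?_
    rw [← Finset.sum_sub_distrib]
    refine Finset.sum_congr rfl fun j _ => ?_
    rw [curvature_eq g hP hφ, map_sub, map_sub]
  rw [h4, ← sub_eq_zero.1 h2]
  change ∑ i, S i i = _
  module

/-- Apply `clifford_curvature_sum` with RP the curvature of W⁺, whose trace is F_A, and r the
Riemann tensor. The coefficient -1/4 of the Ricci term meets e_i e_i = -1 and yields +R/4; the trace
term is half of the action of F_A, hence of F_A⁺. -/
theorem weitzenboeck {φ : Π x : M, Wp x} (hφ : SmoothSec C2 φ)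
    (hD : ∀ x, A.dirac φ x = 0) (x : M) :
    (⟪φ x, ∑ i, secondDeriv g A.nablaP φ x (orientedFrame g o x i) (orientedFrame g o x i)⟫_ℂ).re
      = scalarCurvature g x / 4 * ‖φ x‖ ^ 2
        + 1 / 2 * (⟪φ x, A.selfDualAction x (φ x)⟫_ℂ).re := by
  have he := orientedFrame_orthonormal g o x
  set e := orientedFrame g o x
  have hLC := smooth_leviCivita g
  let r : Fin 4 → Fin 4 → Fin 4 → Fin 4 → ℝ := fun i j k l =>
    g.inner x (curvature (leviCivita g) x (e i) (e j) (e k)) (e l)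
  have hexp : ∀ i j k, curvature (leviCivita g) x (e i) (e j) (e k) = ∑ l, r i j k l • e l :=
    fun i j k => (orthonormal_expand g he _).symm
  have key := clifford_curvature_sum (P := Wp x) (N := Wm x) (finrank_Wp x)
    (a := fun i => 𝔰.cP x (e i)) (b := fun i => 𝔰.cM x (e i))
    (cliff_P_ortho (𝔰 := 𝔰) he) (cliff_M_ortho (𝔰 := 𝔰) he)
    (RP := fun i j => A.unitary_P.curvatureEnd g x (e i) (e j))
    (RN := fun i j => A.unitary_M.curvatureEnd g x (e i) (e j))
    (r := fun i j k l => (r i j k l : ℂ))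
    (fun i j k s => by
      refine (curvature_cP A x (e i) (e j) (e k) s).trans ?_
      rw [hexp, add_comm]
      simp [Complex.coe_smul]
      rfl)
    (fun i j k s => by
      refine (curvature_cM A x (e i) (e j) (e k) s).trans ?_
      rw [hexp, add_comm]
      simp [Complex.coe_smul]
      rfl)
    (fun i j k l => by
      simp only [r]
      rw [curvature_swap g hLC (e j) (e i)]
      simp)
    (fun i j k l => by
      have := congrArg (fun v => g.inner x v (e l)) (bianchi g x (e i) (e j) (e k))
      simp only [map_add, _root_.add_apply, map_zero, _root_.zero_apply] at this
      simp only [r]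
      exact_mod_cast this) (φ x)
  simp only [trace_curvature] at key
  have h1 := curvature_action A x (φ x)
  rw [sum_secondDeriv_of_dirac A hφ hD he]
  refine (congrArg (fun t => (⟪φ x, t⟫_ℂ).re) key).trans ?_
  have h2 : ((1 / 4 : ℂ) • ∑ i, ∑ j, A.curvatureForm x (e i) (e j) •
      𝔰.cM x (e i) (𝔰.cP x (e j) (φ x))) = (1 / 2 : ℂ) • A.selfDualAction x (φ x) := by
    rw [h1, smul_smul]; norm_num [e]
  rw [h2]
  simp only [inner_add_right, Complex.add_re, inner_smul_right, inner_sum]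
  have hq := re_inner_clifford (𝔰 := 𝔰) he
  have hre : ∀ (c : ℝ) (z : ℂ), ((c : ℂ) * z).re = c * z.re := fun c z => by simp
  have h3 : ∀ i l : Fin 4, (∑ j, (r i j j l : ℂ)) = ((∑ j, r i j j l : ℝ) : ℂ) := fun i l => by
    push_cast; rfl
  have h4 : (-1 / 4 : ℂ) = ((-1 / 4 : ℝ) : ℂ) := by push_cast; rfl
  have h5 : (1 / 2 : ℂ) = ((1 / 2 : ℝ) : ℂ) := by push_cast; rfl
  rw [h4, h5, hre, hre]
  simp only [h3, Complex.re_sum, hre, hq]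
  rw [scalarCurvature_eq g he]
  simp only [mul_ite, mul_zero, Finset.sum_ite_eq', Finset.mem_univ, if_true, ← Finset.sum_mul]
  simp only [r]
  ring

theorem smooth_normSq {φ : Π x : M, Wp x} (hφ : SmoothSec C2 φ) :
    ContMDiff (𝓡 4) 𝓘(ℝ) ∞ (fun x => ‖φ x‖ ^ 2) := by
  have h := Complex.reCLM.contDiff.contMDiff.comp
    (SmoothHermitian.smooth_inner (F := C2) φ φ hφ hφ) (n := ∞)
  refine h.congr fun x => ?_
  simp only [Function.comp, inner_self_eq_norm_sq_to_K, Complex.reCLM_apply]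
  norm_cast

theorem mvfderiv_normSq {φ : Π x : M, Wp x} (hφ : SmoothSec C2 φ) (x : M)
    (v : TangentSpace (𝓡 4) x) :
    mvfderiv (𝓡 4) (fun x => ‖φ x‖ ^ 2) x v = 2 * (⟪φ x, A.nablaP φ x v⟫_ℂ).re := by
  have h := A.unitary_P.unitary φ φ x (hφ.diffSecAt x) (hφ.diffSecAt x) v
  have h1 := mvfderiv_clm_comp Complex.reCLM
    ((SmoothHermitian.smooth_inner (F := C2) φ φ hφ hφ x).mdifferentiableAt (by simp)) v
  have h2 : (fun y => Complex.reCLM ⟪φ y, φ y⟫_ℂ) = fun y => ‖φ y‖ ^ 2 := by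
    funext y
    rw [inner_self_eq_norm_sq_to_K, Complex.reCLM_apply]
    norm_cast
  rw [h2, h, ← inner_conj_symm] at h1
  rw [h1, Complex.reCLM_apply, Complex.add_re, Complex.conj_re]
  ring

/-- Unitarity is used twice along a smooth frame; the Levi-Civita corrections in the Laplacian are
absorbed into `secondDeriv`. -/
theorem laplacian_normSq {φ : Π x : M, Wp x} (hφ : SmoothSec C2 φ) (x : M) :
    laplacian g (fun x => ‖φ x‖ ^ 2) x = 2 * A.normSqNabla φ x
      + 2 * (⟪φ x, ∑ i, secondDeriv g A.nablaP φ x (orientedFrame g o x i)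
          (orientedFrame g o x i)⟫_ℂ).re := by
  have he := orientedFrame_orthonormal g o x
  obtain ⟨E, hE, hEx, -⟩ := exists_smooth_orthonormal_extension g x 4 _ he
  simp only [← hEx] at he ⊢
  have hP := A.unitary_P.smoothConnection
  rw [laplacian_eq g (smooth_normSq hφ) hE he, normSqNabla_eq_sum A he, inner_sum, Complex.re_sum,
    Finset.mul_sum, Finset.mul_sum, ← Finset.sum_add_distrib]
  refine Finset.sum_congr rfl fun i _ => ?_
  have hs := hP _ _ (hE i) hφ
  have h1 := A.unitary_P.unitary φ _ x (hφ.diffSecAt x) (hs.diffSecAt x) (E i x)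
  have h2 := mvfderiv_clm_comp ((2 : ℝ) • Complex.reCLM)
    ((SmoothHermitian.smooth_inner (F := C2) φ _ hφ hs x).mdifferentiableAt (by simp)) (E i x)
  rw [h1] at h2
  simp only [mvfderiv_normSq A hφ]
  rw [secondDeriv_eq g hP hφ ((hE i).diffSecAt x), inner_sub_right, Complex.sub_re]
  have hn : (⟪A.nablaP φ x (E i x), A.nablaP φ x (E i x)⟫_ℂ).re = ‖A.nablaP φ x (E i x)‖ ^ 2 := by
    rw [inner_self_eq_norm_sq_to_K]; norm_cast
  simp only [_root_.smul_apply, Complex.reCLM_apply, smul_eq_mul, Complex.add_re, hn] at h2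
  rw [h2]
  ring

/-- The Bochner formula for monopoles. -/
theorem laplacian_normSq_of_isMonopole {φ : Π x : M, Wp x} (hφ : A.IsMonopole φ) (x : M) :
    laplacian g (fun x => ‖φ x‖ ^ 2) x = 2 * A.normSqNabla φ x
      + scalarCurvature g x / 2 * ‖φ x‖ ^ 2 + 1 / 2 * ‖φ x‖ ^ 4 := by
  have hn : (⟪φ x, φ x⟫_ℂ) = ((‖φ x‖ ^ 2 : ℝ) : ℂ) := by
    rw [inner_self_eq_norm_sq_to_K]; norm_cast
  -- φ is an eigenvector of (φ ⊗ φ*)° with eigenvalue |φ|² - ½|φ|².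
  have h1 : (⟪φ x, A.selfDualAction x (φ x)⟫_ℂ).re = ‖φ x‖ ^ 4 / 2 := by
    rw [hφ.curvature_eq, ← Complex.coe_smul, inner_sub_right, inner_smul_right, inner_smul_right, hn]
    norm_cast
    ring
  rw [laplacian_normSq A hφ.smooth, weitzenboeck A hφ.smooth hφ.dirac_eq, h1]
  ring

end Weitzenboeck

/-! ### Derivative of the determinant. -/

section DetDerivative

theorem sum_det_updateRow {G B : Matrix (Fin 4) (Fin 4) ℝ} :
    ∑ i, (G.updateRow i (B i)).det = (G.adjugate * B).trace := by
  have h : ∀ i, (G.updateRow i (B i)).det = ∑ j, G.adjugate j i * B i j := by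
    intro i
    rw [← Matrix.cramer_transpose_apply, Matrix.cramer_eq_adjugate_mulVec, ← Matrix.adjugate_transpose]
    rfl
  simp only [h, Matrix.trace, Matrix.diag, Matrix.mul_apply]
  exact Finset.sum_comm

/-- The determinant as a multilinear function of the rows. -/
def detRows : ContinuousMultilinearMap ℝ (fun _ : Fin 4 => Fin 4 → ℝ) ℝ :=
  { (Matrix.detRowAlternating (R := ℝ) (n := Fin 4)).toMultilinearMap with
    cont := by
      change Continuous fun m : Fin 4 → Fin 4 → ℝ => (Matrix.of m).det
      exact Continuous.matrix_det continuous_id }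

theorem contDiff_det : ContDiff ℝ ∞ (fun m : Fin 4 → Fin 4 → ℝ => (Matrix.of m).det) :=
  detRows.contDiff

theorem hasFDerivAt_det (G : Fin 4 → Fin 4 → ℝ) :
    ∃ L : (Fin 4 → Fin 4 → ℝ) →L[ℝ] ℝ, HasFDerivAt (fun m : Fin 4 → Fin 4 → ℝ =>
      (Matrix.of m).det) L G ∧ ∀ B : Fin 4 → Fin 4 → ℝ,
        L B = ((Matrix.of G).adjugate * Matrix.of B).trace := by
  refine ⟨detRows.linearDeriv G, detRows.hasFDerivAt G, fun B => ?_⟩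
  rw [ContinuousMultilinearMap.linearDeriv_apply, ← sum_det_updateRow]
  rfl

end DetDerivative

/-! ### Coordinate vector fields and coordinate functions. -/

section Coordinates

variable {M : Type*} [TopologicalSpace M] [ChartedSpace E4 M] [IsManifold (𝓡 4) ∞ M]

theorem mdifferentiable_chartAt (x₀ : M) :
    (chartAt E4 x₀).MDifferentiable (𝓡 4) 𝓘(ℝ, E4) :=
  haveI : IsManifold (𝓡 4) 1 M := IsManifold.of_le (n := ∞) (by simp)
  mdifferentiable_chart x₀

/-- The coordinate vector field `∂ᵢ` of the chart at `x₀`. -/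
def coordField (x₀ : M) (i : Fin 4) (y : M) : TangentSpace (𝓡 4) y :=
  (trivializationAt E4 (TangentSpace (𝓡 4)) x₀).symmL ℝ y (EuclideanSpace.single i (1 : ℝ))

/-- Reconciles the bundle description of ∂ᵢ, which gives smoothness on M, with the derivative of the
inverse chart that enters `chartGram`. -/
theorem coordField_symm {x₀ : M} {z : E4} (hz : z ∈ (chartAt E4 x₀).target) (i : Fin 4) :
    coordField x₀ i ((chartAt E4 x₀).symm z) =
      mfderiv 𝓘(ℝ, E4) (𝓡 4) (chartAt E4 x₀).symm z (EuclideanSpace.single i (1 : ℝ)) := by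
  have : IsManifold (𝓡 4) 1 M := IsManifold.of_le (n := ∞) (by simp)
  have h := TangentBundle.symmL_trivializationAt (I := 𝓡 4) (𝕜 := ℝ)
    ((chartAt E4 x₀).map_target hz)
  have h1 : (mfderivWithin 𝓘(ℝ, E4) (𝓡 4) (extChartAt (𝓡 4) x₀).symm (Set.range (𝓡 4))
      (extChartAt (𝓡 4) x₀ ((chartAt E4 x₀).symm z)) : E4 →L[ℝ] E4)
      = mfderiv 𝓘(ℝ, E4) (𝓡 4) (chartAt E4 x₀).symm z := by
    have hr : Set.range (𝓡 4 : E4 → E4) = Set.univ := (𝓡 4).range_eq_univ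
    have hz' : extChartAt (𝓡 4) x₀ ((chartAt E4 x₀).symm z) = z := by
      simp [hz]
    rw [hz', hr, mfderivWithin_univ]
    rfl
  exact congrArg (fun T : E4 →L[ℝ] E4 => T (EuclideanSpace.single i (1 : ℝ))) (h.trans h1)

theorem exists_smooth_coordField [T2Space M] {x₀ x : M} (hx : x ∈ (chartAt E4 x₀).source) (i : Fin 4) :
    ∃ X : Π y : M, TangentSpace (𝓡 4) y, SmoothSec E4 X ∧ ∀ᶠ y in 𝓝 x, X y = coordField x₀ i y := by
  let t := trivializationAt E4 (TangentSpace (𝓡 4) : M → Type _) x₀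
  have hb : t.baseSet = (chartAt E4 x₀).source := TangentBundle.trivializationAt_baseSet x₀
  have hU : t.baseSet ∈ 𝓝 x := t.open_baseSet.mem_nhds (by rw [hb]; exact hx)
  have : ContMDiffVectorBundle 1 E4 (TangentSpace (𝓡 4) : M → Type _) (𝓡 4) :=
    ContMDiffVectorBundle.of_le (n := ∞) (by simp)
  let b := (EuclideanSpace.basisFun (Fin 4) ℝ).toBasis
  obtain ⟨X, hX, hXe⟩ := exists_smoothSec_eventuallyEq hU
    (t.contMDiffOn_localFrame_baseSet (I := 𝓡 4) ∞ b i)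
  refine ⟨X, hX, ?_⟩
  filter_upwards [hXe, hU] with y hy hyU
  rw [hy, t.localFrame_apply_of_mem_baseSet b hyU]
  have hbi : b i = EuclideanSpace.single i (1 : ℝ) := by simp [b]
  change (t.linearEquivAt ℝ y hyU).symm (b i) = t.symmL ℝ y _
  rw [hbi, Bundle.Trivialization.symmL_apply _ hyU]
  rfl

theorem mvfderiv_coordField {G : Type*} [NormedAddCommGroup G] [NormedSpace ℝ G] {x₀ : M} {z : E4}
    (hz : z ∈ (chartAt E4 x₀).target) (i : Fin 4) {k : M → G}
    (hk : MDifferentiableAt (𝓡 4) 𝓘(ℝ, G) k ((chartAt E4 x₀).symm z)) :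
    mvfderiv (𝓡 4) k ((chartAt E4 x₀).symm z) (coordField x₀ i ((chartAt E4 x₀).symm z))
      = fderiv ℝ (fun z => k ((chartAt E4 x₀).symm z)) z (EuclideanSpace.single i (1 : ℝ)) := by
  rw [coordField_symm hz]
  have h := (hk.hasMFDerivAt.comp z
    ((mdifferentiable_chartAt x₀).mdifferentiableAt_symm hz).hasMFDerivAt).mfderiv
  rw [mfderiv_eq_fderiv] at h
  exact (congrArg (fun T : E4 →L[ℝ] G => T (EuclideanSpace.single i (1 : ℝ))) h).symm

/-- The coordinate functions of the chart at `x₀`. -/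
theorem exists_smooth_coord [T2Space M] {x₀ x : M} (hx : x ∈ (chartAt E4 x₀).source) (j : Fin 4) :
    ∃ h : M → ℝ, ContMDiff (𝓡 4) 𝓘(ℝ) ∞ h ∧ ∀ᶠ y in 𝓝 x, h y = chartAt E4 x₀ y j := by
  have h1 : ContMDiffOn (𝓡 4) 𝓘(ℝ, E4) ∞ (chartAt E4 x₀) (chartAt E4 x₀).source := contMDiffOn_chart
  have h2 : ContDiff ℝ ∞ (fun v : E4 => v j) := by fun_prop
  exact exists_smoothFun_eventuallyEq ((chartAt E4 x₀).open_source.mem_nhds hx)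
    (h2.contMDiff.comp_contMDiffOn h1)

theorem mvfderiv_congr {G : Type*} [NormedAddCommGroup G] [NormedSpace ℝ G] {k k' : M → G} {x : M}
    (h : ∀ᶠ y in 𝓝 x, k y = k' y) (v : TangentSpace (𝓡 4) x) :
    mvfderiv (𝓡 4) k x v = mvfderiv (𝓡 4) k' x v := by
  have h' : k =ᶠ[𝓝 x] k' := h
  exact congrArg (fun L : TangentSpace (𝓡 4) x →L[ℝ] G => L v) h'.mfderiv_eq

theorem coord_coordField {x₀ y : M} (hy : y ∈ (chartAt E4 x₀).source) (i j : Fin 4)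
    {h : M → ℝ} (he : ∀ᶠ y in 𝓝 y, h y = chartAt E4 x₀ y j) :
    mvfderiv (𝓡 4) h y (coordField x₀ i y) = if i = j then 1 else 0 := by
  rw [mvfderiv_congr he]
  obtain ⟨z, hz, rfl⟩ : ∃ z ∈ (chartAt E4 x₀).target, y = (chartAt E4 x₀).symm z :=
    ⟨_, (chartAt E4 x₀).map_source hy, ((chartAt E4 x₀).left_inv hy).symm⟩
  have h2 : ContDiff ℝ ∞ (fun v : E4 => v j) := by fun_prop
  have h3 := ((h2.contMDiff _).mdifferentiableAt (by simp)).comp _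
    ((mdifferentiable_chartAt x₀).mdifferentiableAt hy)
  rw [mvfderiv_coordField hz i (k := fun y => chartAt E4 x₀ y j) h3]
  have h4 : (fun z => chartAt E4 x₀ ((chartAt E4 x₀).symm z) j) =ᶠ[𝓝 z]
      fun z => EuclideanSpace.proj (𝕜 := ℝ) j z := by
    filter_upwards [(chartAt E4 x₀).open_target.mem_nhds hz] with w hw
    rw [(chartAt E4 x₀).right_inv hw]
    rfl
  rw [h4.fderiv_eq, ContinuousLinearMap.fderiv]
  simp [eq_comm]

/-- A vector is determined by its coordinates. -/
theorem coordField_expand {x₀ y : M} (hy : y ∈ (chartAt E4 x₀).source) {h : Fin 4 → M → ℝ}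
    (he : ∀ j, ∀ᶠ y in 𝓝 y, h j y = chartAt E4 x₀ y j) (v : TangentSpace (𝓡 4) y) :
    ∑ j, mvfderiv (𝓡 4) (h j) y v • coordField x₀ j y = v := by
  have hli : LinearIndependent ℝ (fun i => coordField x₀ i y) := by
    rw [Fintype.linearIndependent_iff]
    intro c hc j
    have := congrArg (mvfderiv (𝓡 4) (h j) y) hc
    simpa [coord_coordField hy _ j (he j)] using this
  have : FiniteDimensional ℝ (TangentSpace (𝓡 4) y) := inferInstanceAs (FiniteDimensional ℝ E4)
  have hrank : Module.finrank ℝ (TangentSpace (𝓡 4) y) = 4 := by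
    change Module.finrank ℝ E4 = 4
    simp
  let b := basisOfLinearIndependentOfCardEqFinrank hli (by simp [hrank])
  have hb : ∀ i, b i = coordField x₀ i y := fun i => by simp [b]
  conv_rhs => rw [← b.sum_repr v]
  refine Finset.sum_congr rfl fun j _ => ?_
  rw [← hb]
  congr 1
  conv_lhs => rw [← b.sum_repr v]
  simp [hb, coord_coordField hy _ j (he j)]

end Coordinates

/-! ### The divergence in coordinates. -/

section Divergence

variable {M : Type*} [TopologicalSpace M] [ChartedSpace E4 M] [IsManifold (𝓡 4) ∞ M]

/-- The divergence of a vector field. -/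
def divergence (g : Metric4 M) (X : Π x : M, TangentSpace (𝓡 4) x) (x : M) : ℝ :=
  ∑ i, g.inner x (leviCivita g X x (frame g x i)) (frame g x i)

theorem laplacian_eq_divergence (g : Metric4 M) (f : M → ℝ) (x : M) :
    laplacian g f x = divergence g (grad g f) x := rfl

/-- The matrix `g_{ij}` of the chart at `x₀`, as a function on `M`. -/
def gram (g : Metric4 M) (x₀ y : M) : Matrix (Fin 4) (Fin 4) ℝ :=
  Matrix.of fun i j => g.inner y (coordField x₀ i y) (coordField x₀ j y)

theorem chartGram_eq (g : Metric4 M) {x₀ : M} {z : E4} (hz : z ∈ (chartAt E4 x₀).target) :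
    chartGram g x₀ z = gram g x₀ ((chartAt E4 x₀).symm z) := by
  simp only [chartGram, gram, coordField_symm hz]

variable [T2Space M]

theorem gram_posDef (g : Metric4 M) {x₀ y : M} (hy : y ∈ (chartAt E4 x₀).source) :
    (gram g x₀ y).PosDef := by
  choose h hh he using fun j => exists_smooth_coord hy j
  refine Matrix.PosDef.of_dotProduct_mulVec_pos ?_ fun c hc => ?_
  · ext i j
    simp [gram, g.symm y (coordField x₀ j y)]
  · have hne : ∑ i, c i • coordField x₀ i y ≠ 0 := by
      intro h0
      apply hc
      funext j
      have := congrArg (mvfderiv (𝓡 4) (h j) y) h0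
      simpa [coord_coordField hy _ j (he j)] using this
    have := g.pos y _ hne
    simp only [map_sum, map_smul, _root_.sum_apply, _root_.smul_apply, smul_eq_mul] at this
    simp only [gram, dotProduct, Matrix.mulVec, Matrix.of_apply, star_trivial, Finset.mul_sum]
      at this ⊢
    rw [Finset.sum_comm] at this
    exact this.trans_eq (Finset.sum_congr rfl fun _ _ => Finset.sum_congr rfl fun _ _ => by ring)

theorem gram_det_pos (g : Metric4 M) {x₀ y : M} (hy : y ∈ (chartAt E4 x₀).source) :
    0 < (gram g x₀ y).det := (gram_posDef g hy).det_pos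

/-- The divergence is the trace of v ↦ ∇_v X, here computed in the basis ∂_j and its dual basis
dx_j. -/
theorem divergence_eq_sum_coord (g : Metric4 M) {x₀ y : M} (hy : y ∈ (chartAt E4 x₀).source)
    {h : Fin 4 → M → ℝ} (he : ∀ j, ∀ᶠ y in 𝓝 y, h j y = chartAt E4 x₀ y j)
    (X : Π x : M, TangentSpace (𝓡 4) x) :
    divergence g X y = ∑ j, mvfderiv (𝓡 4) (h j) y (leviCivita g X y (coordField x₀ j y)) := by
  have h1 : ∀ i, g.inner y (leviCivita g X y (frame g y i)) (frame g y i)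
      = ∑ j, mvfderiv (𝓡 4) (h j) y (frame g y i) *
        g.inner y (leviCivita g X y (coordField x₀ j y)) (frame g y i) := by
    intro i
    conv_lhs => enter [1, 2, 2]; rw [← coordField_expand hy he (frame g y i)]
    simp
  simp only [divergence, h1]
  rw [Finset.sum_comm]
  refine Finset.sum_congr rfl fun j _ => ?_
  conv_rhs => rw [← frame_expand g y (leviCivita g X y (coordField x₀ j y))]
  simp only [map_sum, map_smul, smul_eq_mul]
  exact Finset.sum_congr rfl fun i _ => mul_comm _ _

theorem smooth_mdiff {f : M → ℝ} (hf : ContMDiff (𝓡 4) 𝓘(ℝ) ∞ f) (x : M) :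
    MDifferentiableAt (𝓡 4) 𝓘(ℝ) f x := (hf x).mdifferentiableAt (by simp)

/-- Jacobi's formula for the volume density of a frame. -/
theorem mvfderiv_det_gram (g : Metric4 M) {X : Fin 4 → Π x : M, TangentSpace (𝓡 4) x}
    (hX : ∀ i, SmoothSec E4 (X i)) {y : M} {θ : Fin 4 → TangentSpace (𝓡 4) y →L[ℝ] ℝ}
    (hθ : ∀ v, ∑ j, θ j v • X j y = v) (v : TangentSpace (𝓡 4) y) :
    MDifferentiableAt (𝓡 4) 𝓘(ℝ)
      (fun p => (Matrix.of fun i j => g.inner p (X i p) (X j p)).det) y ∧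
    mvfderiv (𝓡 4) (fun p => (Matrix.of fun i j => g.inner p (X i p) (X j p)).det) y v
      = 2 * (∑ k, θ k (leviCivita g (X k) y v))
        * (Matrix.of fun i j => g.inner y (X i y) (X j y)).det := by
  let m : M → Fin 4 → Fin 4 → ℝ := fun p i j => g.inner p (X i p) (X j p)
  have hm : MDifferentiableAt (𝓡 4) 𝓘(ℝ, Fin 4 → Fin 4 → ℝ) m y :=
    (ContMDiff.contMDiffAt (contMDiff_pi_space.2 fun i => contMDiff_pi_space.2 fun j =>
      smooth_inner g (hX i) (hX j))).mdifferentiableAt (n := ∞) (by simp)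
  obtain ⟨T, hT, hTB⟩ := hasFDerivAt_det (m y)
  have hd : MDifferentiableAt (𝓡 4) 𝓘(ℝ) (fun p => (Matrix.of (m p)).det) y :=
    (hT.hasMFDerivAt.comp y hm.hasMFDerivAt).mdifferentiableAt
  refine ⟨hd, ?_⟩
  have h1 : mvfderiv (𝓡 4) (fun p => (Matrix.of (m p)).det) y v = T (mvfderiv (𝓡 4) m y v) :=
    mvfderiv_comp_hasFDerivAt hT hm v
  have h2 : ∀ i j, mvfderiv (𝓡 4) m y v i j = mvfderiv (𝓡 4) (fun p => m p i j) y v := by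
    intro i j
    exact (mvfderiv_clm_comp ((ContinuousLinearMap.proj (R := ℝ) (φ := fun _ : Fin 4 => ℝ) j).comp
      (ContinuousLinearMap.proj (R := ℝ) (φ := fun _ : Fin 4 => Fin 4 → ℝ) i)) hm v).symm
  let Γ : Matrix (Fin 4) (Fin 4) ℝ := Matrix.of fun a k => θ a (leviCivita g (X k) y v)
  -- Metric compatibility in matrix form; tracing against the adjugate gives 2 tr Γ · det.
  have h3 : Matrix.of (mvfderiv (𝓡 4) m y v) = Γ.transpose * Matrix.of (m y) + Matrix.of (m y) * Γ := by
    ext i j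
    rw [Matrix.of_apply, h2]
    simp only [m]
    rw [leviCivita_metric g ((hX i).diffSecAt y) ((hX j).diffSecAt y)]
    conv_lhs => rw [← hθ (leviCivita g (X i) y v), ← hθ (leviCivita g (X j) y v)]
    simp only [map_sum, map_smul, _root_.sum_apply, _root_.smul_apply, smul_eq_mul,
      Matrix.add_apply, Matrix.mul_apply, Matrix.transpose_apply, Matrix.of_apply, Γ]
    congr 1
    exact Finset.sum_congr rfl fun k _ => mul_comm _ _
  change mvfderiv (𝓡 4) (fun p => (Matrix.of (m p)).det) y v = _ * (Matrix.of (m y)).det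
  rw [h1, hTB, h3, Matrix.mul_add, Matrix.trace_add, Matrix.trace_mul_comm, Matrix.mul_assoc,
    Matrix.mul_adjugate, ← Matrix.mul_assoc, Matrix.adjugate_mul, Matrix.mul_smul, Matrix.mul_one,
    Matrix.smul_mul, Matrix.one_mul, Matrix.trace_smul, Matrix.trace_smul, Matrix.trace_transpose]
  simp only [Matrix.trace, Matrix.diag, Γ, Matrix.of_apply, smul_eq_mul]
  ring

/-- The classical √g div X = Σ ∂_j(√g X^j). Jacobi's formula writes the logarithmic derivative of √g
as a trace of Christoffel symbols, which matches the connection terms in div X by their symmetry. -/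
theorem sqrt_det_mul_divergence (g : Metric4 M) {x₀ y : M} (hy : y ∈ (chartAt E4 x₀).source)
    {X : Π x : M, TangentSpace (𝓡 4) x} (hX : SmoothSec E4 X) :
    Real.sqrt (gram g x₀ y).det * divergence g X y
      = ∑ j, mvfderiv (𝓡 4) (fun p => Real.sqrt (gram g x₀ p).det *
          mvfderiv (𝓡 4) (fun q => chartAt E4 x₀ q j) p (X p)) y (coordField x₀ j y) := by
  choose h hh he using fun j => exists_smooth_coord hy j
  choose Z hZ hZe using fun i => exists_smooth_coordField hy i
  have hZy : ∀ i, Z i y = coordField x₀ i y := fun i => (hZe i).self_of_nhds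
  have hyU := (chartAt E4 x₀).open_source.mem_nhds hy
  let c : Fin 4 → M → ℝ := fun j p => mvfderiv (𝓡 4) (h j) p (X p)
  have hc : ∀ j, ContMDiff (𝓡 4) 𝓘(ℝ) ∞ (c j) := fun j => smooth_mvfderiv (hh j) hX
  let D : M → ℝ := fun p => (Matrix.of fun i j => g.inner p (Z i p) (Z j p)).det
  have hDe : ∀ᶠ p in 𝓝 y, (gram g x₀ p).det = D p := by
    filter_upwards [Filter.eventually_all.2 hZe] with p hp
    simp only [D, gram, hp]
  have hXe : ∀ᶠ p in 𝓝 y, X p = ∑ j, c j p • Z j p := by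
    filter_upwards [Filter.eventually_all.2 hZe, hyU,
      Filter.eventually_all.2 fun j => eventually_eventually_nhds.2 (he j)] with p hp hpU hep
    simp only [hp, c]
    exact (coordField_expand hpU hep _).symm
  have hDy : 0 < D y := by
    rw [← hDe.self_of_nhds]
    exact gram_det_pos g hy
  have hθ : ∀ v, ∑ j, mvfderiv (𝓡 4) (h j) y v • Z j y = v := fun v => by
    simp only [hZy]
    exact coordField_expand hy he v
  have hJ := fun v => mvfderiv_det_gram g hZ (θ := fun j => mvfderiv (𝓡 4) (h j) y) hθ v
  have hdual : ∀ i j, mvfderiv (𝓡 4) (h j) y (Z i y) = if i = j then 1 else 0 := fun i j => by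
    rw [hZy, coord_coordField hy i j (he j)]
  -- Coordinate fields commute: the bracket applied to a coordinate function differentiates the
  -- constants ∂_a x_k.
  have hcomm : ∀ i j, leviCivita g (Z i) y (Z j y) = leviCivita g (Z j) y (Z i y) := by
    intro i j
    rw [← sub_eq_zero, ← leviCivita_torsion g ((hZ j).diffSecAt y) ((hZ i).diffSecAt y),
      ← hθ (VectorField.mlieBracket (𝓡 4) (Z j) (Z i) y)]
    refine Finset.sum_eq_zero fun k _ => ?_
    have hconst : ∀ a, mvfderiv (𝓡 4) (fun p => mvfderiv (𝓡 4) (h k) p (Z a p)) y = 0 := by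
      intro a
      ext v
      rw [mvfderiv_congr (k' := fun _ => if a = k then (1 : ℝ) else 0), mvfderiv_const]
      filter_upwards [hZe a, hyU, eventually_eventually_nhds.2 (he k)] with p hp hpU hep
      rw [hp, coord_coordField hpU a k hep]
    rw [mvfderiv_mlieBracket (hZ j) (hZ i) (hh k), hconst, hconst]
    simp
  have hs : ∀ v, mvfderiv (𝓡 4) (fun p => Real.sqrt (D p)) y v
      = Real.sqrt (D y) * ∑ k, mvfderiv (𝓡 4) (h k) y (leviCivita g (Z k) y v) := by
    intro v
    rw [mvfderiv_comp_hasDerivAt (Real.hasDerivAt_sqrt hDy.ne') (hJ v).1, (hJ v).2]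
    change 1 / (2 * Real.sqrt (D y)) * (2 * _ * D y) = _
    have h5 := Real.sqrt_pos.2 hDy
    have h6 := Real.mul_self_sqrt hDy.le
    generalize (∑ k, mvfderiv (𝓡 4) (h k) y (leviCivita g (Z k) y v)) = S
    nth_rewrite 2 [← h6]
    field_simp
  have hsd : MDifferentiableAt (𝓡 4) 𝓘(ℝ) (fun p => Real.sqrt (D p)) y :=
    ((Real.hasDerivAt_sqrt hDy.ne').hasFDerivAt.hasMFDerivAt.comp y
      (hJ 0).1.hasMFDerivAt).mdifferentiableAt
  have hrhs : ∀ j, mvfderiv (𝓡 4) (fun p => Real.sqrt (gram g x₀ p).det *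
          mvfderiv (𝓡 4) (fun q => chartAt E4 x₀ q j) p (X p)) y (coordField x₀ j y)
      = Real.sqrt (D y) * mvfderiv (𝓡 4) (c j) y (Z j y)
        + c j y * (Real.sqrt (D y) * ∑ k, mvfderiv (𝓡 4) (h k) y (leviCivita g (Z k) y (Z j y))) := by
    intro j
    rw [mvfderiv_congr (k' := fun p => Real.sqrt (D p) * c j p), ← hZy j,
      mvfderiv_fun_mul hsd (smooth_mdiff (hc j) y), ← hs]
    · simp
    · filter_upwards [hDe, eventually_eventually_nhds.2 (he j)] with p hp hep
      rw [hp]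
      congr 1
      exact (mvfderiv_congr hep _).symm
  have hcs : ∀ i, SmoothSec E4 (fun p => c i p • Z i p) := fun i => SmoothSec.smul (hc i) (hZ i)
  have hdiv : divergence g X y = ∑ j, (mvfderiv (𝓡 4) (c j) y (Z j y)
      + ∑ i, c i y * mvfderiv (𝓡 4) (h j) y (leviCivita g (Z i) y (Z j y))) := by
    rw [divergence_eq_sum_coord g hy he]
    refine Finset.sum_congr rfl fun j _ => ?_
    rw [← hZy, conn_congr ((SmoothSec.sum _ hcs).diffSecAt y) hXe, conn_sum _ hcs]
    simp only [fun i => conn_smul (D := leviCivita g) (smooth_mdiff (hc i) y)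
      ((hZ i).diffSecAt y) (Z j y), map_sum, map_add, map_smul, smul_eq_mul, hdual,
      Finset.sum_add_distrib, mul_ite, mul_one, mul_zero, Finset.sum_ite_eq', Finset.mem_univ, if_true]
    ring
  rw [hDe.self_of_nhds, hdiv]
  simp only [hrhs, Finset.sum_add_distrib, mul_add, Finset.mul_sum]
  congr 1
  rw [Finset.sum_comm]
  refine Finset.sum_congr rfl fun i _ => Finset.sum_congr rfl fun j _ => ?_
  rw [hcomm i j]
  ring

end Divergence

/-! ### The Riemannian volume measure. -/

section Volume

variable {M : Type*} [TopologicalSpace M] [ChartedSpace E4 M] [IsManifold (𝓡 4) ∞ M] [T2Space M]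

theorem contMDiffAt_sqrt_det (g : Metric4 M) {x₀ y : M} (hy : y ∈ (chartAt E4 x₀).source) :
    ContMDiffAt (𝓡 4) 𝓘(ℝ) ∞ (fun p => Real.sqrt (gram g x₀ p).det) y := by
  choose Z hZ hZe using fun i => exists_smooth_coordField hy i
  have h1 : ContMDiff (𝓡 4) 𝓘(ℝ) ∞
      (fun p => (Matrix.of fun i j => g.inner p (Z i p) (Z j p)).det) :=
    contDiff_det.contMDiff.comp (contMDiff_pi_space.2 fun i => contMDiff_pi_space.2 fun j =>
      smooth_inner g (hZ i) (hZ j))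
  have h2 : ∀ᶠ p in 𝓝 y, (gram g x₀ p).det
      = (Matrix.of fun i j => g.inner p (Z i p) (Z j p)).det := by
    filter_upwards [Filter.eventually_all.2 hZe] with p hp
    simp only [gram, hp]
  have h3 : (Matrix.of fun i j => g.inner y (Z i y) (Z j y)).det ≠ 0 := by
    rw [← h2.self_of_nhds]
    exact (gram_det_pos g hy).ne'
  have h4 := ((Real.contDiffAt_sqrt (n := ∞) h3).contMDiffAt).comp y (h1 y)
  refine h4.congr_of_eventuallyEq ?_
  filter_upwards [h2] with p hp
  simp only [hp, Function.comp]

theorem continuousOn_sqrt_det (g : Metric4 M) (x₀ : M) :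
    ContinuousOn (fun z => Real.sqrt (chartGram g x₀ z).det) (chartAt E4 x₀).target := by
  have h : ContinuousOn (fun z => Real.sqrt (gram g x₀ ((chartAt E4 x₀).symm z)).det)
      (chartAt E4 x₀).target := by
    intro z hz
    have h1 := (contMDiffAt_sqrt_det g ((chartAt E4 x₀).map_target hz)).continuousAt
    exact (ContinuousAt.comp (f := (chartAt E4 x₀).symm) (x := z) h1
      ((chartAt E4 x₀).continuousAt_symm hz)).continuousWithinAt
  exact h.congr fun z hz => by simp only [chartGram_eq g hz]

theorem sqrt_det_pos (g : Metric4 M) {x₀ : M} {z : E4} (hz : z ∈ (chartAt E4 x₀).target) :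
    0 < Real.sqrt (chartGram g x₀ z).det := by
  rw [chartGram_eq g hz]
  exact Real.sqrt_pos.2 (gram_det_pos g ((chartAt E4 x₀).map_target hz))

theorem det_eq_det_coord (T : E4 →L[ℝ] E4) :
    T.det = (Matrix.of fun k i => T (EuclideanSpace.single i (1 : ℝ)) k).det := by
  rw [ContinuousLinearMap.det, ← LinearMap.det_toMatrix (EuclideanSpace.basisFun (Fin 4) ℝ).toBasis]
  congr 1

theorem mdifferentiableAt_chart_coord {x₀ p : M} (hp : p ∈ (chartAt E4 x₀).source) (k : Fin 4) :
    MDifferentiableAt (𝓡 4) 𝓘(ℝ) (fun q => chartAt E4 x₀ q k) p := by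
  have h2 : ContDiff ℝ ∞ (fun v : E4 => v k) := by fun_prop
  exact ((h2.contMDiff _).mdifferentiableAt (by simp)).comp _
    ((mdifferentiable_chartAt x₀).mdifferentiableAt hp)

theorem transition_hasFDerivAt {x y : M} {z : E4} (hz : z ∈ (chartAt E4 y).target)
    (hp : (chartAt E4 y).symm z ∈ (chartAt E4 x).source) :
    HasFDerivAt (fun w => chartAt E4 x ((chartAt E4 y).symm w))
      (fderiv ℝ (fun w => chartAt E4 x ((chartAt E4 y).symm w)) z) z := by
  have h := ((mdifferentiable_chartAt x).mdifferentiableAt hp).comp z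
    ((mdifferentiable_chartAt y).mdifferentiableAt_symm hz)
  exact (mdifferentiableAt_iff_differentiableAt.1 h).hasFDerivAt

/-- The Gram matrices are related by G_y = Jᵀ G_x J with J the Jacobian of the transition map.
Together with change of variables this makes the chart volumes agree on overlaps. -/
theorem sqrt_det_transition (g : Metric4 M) {x y : M} {z : E4} (hz : z ∈ (chartAt E4 y).target)
    (hp : (chartAt E4 y).symm z ∈ (chartAt E4 x).source) :
    Real.sqrt (chartGram g y z).det
      = |(fderiv ℝ (fun w => chartAt E4 x ((chartAt E4 y).symm w)) z).det|
        * Real.sqrt (chartGram g x (chartAt E4 x ((chartAt E4 y).symm z))).det := by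
  set p := (chartAt E4 y).symm z with hpz
  rw [chartGram_eq g hz, chartGram_eq g ((chartAt E4 x).map_source hp), (chartAt E4 x).left_inv hp,
    det_eq_det_coord]
  set J : Matrix (Fin 4) (Fin 4) ℝ := Matrix.of fun k i =>
    fderiv ℝ (fun w => chartAt E4 x ((chartAt E4 y).symm w)) z (EuclideanSpace.single i (1 : ℝ)) k
  have hJ : ∀ i, coordField y i p = ∑ k, J k i • coordField x k p := by
    intro i
    rw [← coordField_expand hp (h := fun k q => chartAt E4 x q k)
      (fun j => Filter.Eventually.of_forall fun _ => rfl) (coordField y i p)]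
    refine Finset.sum_congr rfl fun k _ => ?_
    rw [mvfderiv_coordField hz i (mdifferentiableAt_chart_coord hp k)]
    congr 1
    have h1 := (EuclideanSpace.proj k : E4 →L[ℝ] ℝ).hasFDerivAt.comp z
      (transition_hasFDerivAt hz hp)
    exact congrArg (fun T : E4 →L[ℝ] ℝ => T (EuclideanSpace.single i (1 : ℝ))) h1.fderiv
  have hG : gram g y p = J.transpose * gram g x p * J := by
    ext i j
    simp only [gram, Matrix.of_apply, hJ, map_sum, map_smul, _root_.sum_apply, _root_.smul_apply,
      smul_eq_mul, Matrix.mul_apply, Matrix.transpose_apply, Finset.sum_mul, Finset.mul_sum]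
    refine Finset.sum_congr rfl fun a _ => Finset.sum_congr rfl fun b _ => ?_
    ring
  rw [← hpz, hG, Matrix.det_mul, Matrix.det_mul, Matrix.det_transpose, mul_right_comm,
    Real.sqrt_mul (mul_self_nonneg _), Real.sqrt_mul_self_eq_abs]

variable [MeasurableSpace M] [BorelSpace M]

theorem aemeasurable_chart_symm (x : M) (ν : Measure E4) (hν : ν ≪ volume.restrict (chartAt E4 x).target) :
    AEMeasurable (chartAt E4 x).symm ν :=
  ((chartAt E4 x).continuousOn_symm.aemeasurable (chartAt E4 x).open_target.measurableSet).mono_ac hν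

theorem chartVolume_apply (g : Metric4 M) (x : M) {s : Set M} (hs : MeasurableSet s) :
    chartVolume g x s = ∫⁻ z in (chartAt E4 x).symm ⁻¹' s ∩ (chartAt E4 x).target,
      ENNReal.ofReal (Real.sqrt (chartGram g x z).det) := by
  rw [chartVolume, Measure.map_apply_of_aemeasurable
    (aemeasurable_chart_symm x _ (withDensity_absolutelyContinuous _ _)) hs, withDensity_apply',
    Measure.restrict_restrict' (chartAt E4 x).open_target.measurableSet]

theorem chartVolume_overlap (g : Metric4 M) (x y : M) {s : Set M} (hs : MeasurableSet s)
    (hx : s ⊆ (chartAt E4 x).source) (hy : s ⊆ (chartAt E4 y).source) :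
    chartVolume g x s = chartVolume g y s := by
  rw [chartVolume_apply g x hs, chartVolume_apply g y hs]
  set A := (chartAt E4 y).symm ⁻¹' s ∩ (chartAt E4 y).target with hA
  have hAm : MeasurableSet A := by
    have h := (continuousOn_iff_continuous_domRestrict.1 (chartAt E4 y).continuousOn_symm).measurable hs
    have h2 := (chartAt E4 y).open_target.measurableSet.subtype_image h
    convert h2 using 1
    ext z
    simp [A, and_comm]
  have himg : (fun w => chartAt E4 x ((chartAt E4 y).symm w)) '' A
      = (chartAt E4 x).symm ⁻¹' s ∩ (chartAt E4 x).target := by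
    ext w
    constructor
    · rintro ⟨z, ⟨hz, hzt⟩, rfl⟩
      exact ⟨by simpa [(chartAt E4 x).left_inv (hx hz)] using hz, (chartAt E4 x).map_source (hx hz)⟩
    · rintro ⟨hw, hwt⟩
      refine ⟨chartAt E4 y ((chartAt E4 x).symm w), ⟨?_, (chartAt E4 y).map_source (hy hw)⟩, ?_⟩
      · simpa [(chartAt E4 y).left_inv (hy hw)] using hw
      · simp only [(chartAt E4 y).left_inv (hy hw), (chartAt E4 x).right_inv hwt]
  have hinj : Set.InjOn (fun w => chartAt E4 x ((chartAt E4 y).symm w)) A := by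
    rintro z ⟨hz, hzt⟩ w ⟨hw, hwt⟩ h
    exact (chartAt E4 y).symm.injOn hzt hwt ((chartAt E4 x).injOn (hx hz) (hx hw) h)
  rw [← himg, lintegral_image_eq_lintegral_abs_det_fderiv_mul volume hAm
    (fun z hz => (transition_hasFDerivAt hz.2 (hx hz.1)).hasFDerivWithinAt) hinj]
  refine setLIntegral_congr_fun hAm fun z hz => ?_
  rw [sqrt_det_transition g hz.2 (hx hz.1), ENNReal.ofReal_mul (abs_nonneg _)]

theorem chartVolume_compl_source (g : Metric4 M) (x : M) :
    chartVolume g x (chartAt E4 x).sourceᶜ = 0 := by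
  rw [chartVolume_apply g x (chartAt E4 x).open_source.measurableSet.compl]
  have : (chartAt E4 x).symm ⁻¹' (chartAt E4 x).sourceᶜ ∩ (chartAt E4 x).target = ∅ := by
    ext z
    simp only [Set.mem_inter_iff, Set.mem_preimage, Set.mem_compl_iff, Set.mem_empty_iff_false,
      iff_false, not_and]
    intro h hz
    exact h ((chartAt E4 x).map_target hz)
  rw [this]
  simp

/-- A supremum of measures is controlled through an upper bound: chart volume on the chart domain
plus the total measure off it. Every chart volume lies below this sum because chart volumes agree on
overlaps. -/
theorem riemannianVolume_apply (g : Metric4 M) (x₀ : M) {s : Set M} (hs : MeasurableSet s)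
    (hsU : s ⊆ (chartAt E4 x₀).source) : riemannianVolume g s = chartVolume g x₀ s := by
  refine le_antisymm ?_ (le_iSup (chartVolume g) x₀ s)
  set U := (chartAt E4 x₀).source
  have hU : MeasurableSet U := (chartAt E4 x₀).open_source.measurableSet
  have h : riemannianVolume g ≤ chartVolume g x₀ + (riemannianVolume g).restrict Uᶜ := by
    refine iSup_le fun x => Measure.le_iff.2 fun t ht => ?_
    rw [← measure_inter_add_sdiff t hU, Measure.add_apply, Measure.restrict_apply ht]
    refine add_le_add ?_ ?_
    · set V := (chartAt E4 x).source
      have hV : MeasurableSet V := (chartAt E4 x).open_source.measurableSet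
      rw [← measure_inter_add_sdiff (t ∩ U) hV]
      have h0 : chartVolume g x ((t ∩ U) \ V) = 0 :=
        measure_mono_null (fun p hp => hp.2) (chartVolume_compl_source g x)
      rw [h0, add_zero, chartVolume_overlap g x x₀ ((ht.inter hU).inter hV)
        Set.inter_subset_right (fun p hp => hp.1.2)]
      exact measure_mono fun p hp => hp.1.1
    · exact le_iSup (chartVolume g) x _
  refine (h s).trans ?_
  rw [Measure.add_apply, Measure.restrict_apply hs]
  have : s ∩ Uᶜ = ∅ := by
    ext p
    simp only [Set.mem_inter_iff, Set.mem_compl_iff, Set.mem_empty_iff_false, iff_false, not_and,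
      not_not]
    exact fun hp => hsU hp
  rw [this]
  simp

theorem riemannianVolume_restrict (g : Metric4 M) (x₀ : M) :
    (riemannianVolume g).restrict (chartAt E4 x₀).source = chartVolume g x₀ := by
  have hU := (chartAt E4 x₀).open_source.measurableSet
  ext s hs
  have h0 : chartVolume g x₀ (s \ (chartAt E4 x₀).source) = 0 :=
    measure_mono_null (fun p hp => hp.2) (chartVolume_compl_source g x₀)
  rw [Measure.restrict_apply hs, riemannianVolume_apply g x₀ (hs.inter hU) Set.inter_subset_right,
    ← measure_inter_add_sdiff s hU, h0, add_zero]

/-- The density √det is positive on chart targets. This gives strict positivity of ∫|φ|² and of the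
normalizing integral of w². -/
instance (g : Metric4 M) : (riemannianVolume g).IsOpenPosMeasure where
  open_pos W hW hne h0 := by
    obtain ⟨p, hp⟩ := hne
    have hU := (chartAt E4 p).open_source
    have h1 : chartVolume g p (W ∩ (chartAt E4 p).source) = 0 := by
      rw [← riemannianVolume_apply g p (hW.inter hU).measurableSet Set.inter_subset_right]
      exact measure_mono_null Set.inter_subset_left h0
    rw [chartVolume_apply g p (hW.inter hU).measurableSet] at h1
    set A := (chartAt E4 p).symm ⁻¹' (W ∩ (chartAt E4 p).source) ∩ (chartAt E4 p).target
    have hAo : IsOpen A := by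
      have := (chartAt E4 p).isOpen_inter_preimage_symm (hW.inter hU)
      rwa [Set.inter_comm] at this
    have hAne : A.Nonempty := ⟨chartAt E4 p p, by
      simp [A, hp, (chartAt E4 p).left_inv (mem_chart_source E4 p)]⟩
    have hAt : A ⊆ (chartAt E4 p).target := Set.inter_subset_right
    rw [setLIntegral_eq_zero_iff' hAo.measurableSet
      (((continuousOn_sqrt_det g p).mono hAt).aemeasurable hAo.measurableSet).ennreal_ofReal] at h1
    have h2 : volume A = 0 := by
      refine measure_mono_null ?_ (ae_iff.1 h1)
      intro z hz hcon
      have := hcon hz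
      simp only [ENNReal.ofReal_eq_zero] at this
      exact absurd (sqrt_det_pos g (hAt hz)) (not_lt.2 this)
    exact (hAo.measure_pos volume hAne).ne' h2

/-- The continuous density is integrable on a compact neighbourhood inside the chart. With
compactness of M, all continuous functions become integrable. -/
instance (g : Metric4 M) : IsLocallyFiniteMeasure (riemannianVolume g) where
  finiteAtNhds p := by
    have hU := (chartAt E4 p).open_source
    have hpt : chartAt E4 p p ∈ (chartAt E4 p).target := mem_chart_target E4 p
    obtain ⟨K, hK, hKt, hKc⟩ := local_compact_nhds ((chartAt E4 p).open_target.mem_nhds hpt)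
    obtain ⟨O, hOK, hO, hpO⟩ := mem_nhds_iff.1 hK
    have hWo := (chartAt E4 p).isOpen_inter_preimage hO
    refine ⟨(chartAt E4 p).source ∩ chartAt E4 p ⁻¹' O,
      hWo.mem_nhds ⟨mem_chart_source E4 p, hpO⟩, ?_⟩
    rw [riemannianVolume_apply g p hWo.measurableSet Set.inter_subset_left,
      chartVolume_apply g p hWo.measurableSet]
    have hsub : (chartAt E4 p).symm ⁻¹' ((chartAt E4 p).source ∩ chartAt E4 p ⁻¹' O)
        ∩ (chartAt E4 p).target ⊆ K := by
      rintro z ⟨⟨-, hz⟩, hzt⟩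
      have : chartAt E4 p ((chartAt E4 p).symm z) ∈ O := hz
      rw [(chartAt E4 p).right_inv hzt] at this
      exact hOK this
    refine (lintegral_mono_set hsub).trans_lt ?_
    have hint : IntegrableOn (fun z => Real.sqrt (chartGram g p z).det) K :=
      ((continuousOn_sqrt_det g p).mono hKt).integrableOn_compact hKc
    exact hint.lintegral_lt_top

end Volume

/-! ### Integrals of derivatives over ℝ⁴. -/

section Euclidean

theorem integrable_fderiv_apply {H : E4 → ℝ} (hH : ContDiff ℝ 1 H) (hc : HasCompactSupport H)
    (v : E4) : Integrable (fun z => fderiv ℝ H z v) :=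
  ((hH.continuous_fderiv (by simp)).clm_apply continuous_const).integrable_of_hasCompactSupport
    (hc.fderiv_apply ℝ v)

theorem integral_fderiv_apply_eq_zero {H : E4 → ℝ} (hH : ContDiff ℝ 1 H) (hc : HasCompactSupport H)
    (v : E4) : ∫ z, fderiv ℝ H z v = 0 := by
  have h := integral_mul_fderiv_eq_neg_fderiv_mul_of_integrable (μ := (volume : Measure E4))
    (f := fun _ : E4 => (1 : ℝ)) (g := H) (v := v) (by simp)
    (by simpa using integrable_fderiv_apply hH hc v)
    (by simpa using hH.continuous.integrable_of_hasCompactSupport hc)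
    (fun x _ => differentiableAt_const _) (fun x _ => hH.differentiable (by simp) x)
  simpa using h

end Euclidean

/-! ### The divergence theorem on a closed manifold. -/

section DivergenceTheorem

variable {M : Type*} [TopologicalSpace M] [ChartedSpace E4 M] [IsManifold (𝓡 4) ∞ M] [T2Space M]

theorem divergence_eq (g : Metric4 M) {x : M} {e : Fin 4 → TangentSpace (𝓡 4) x}
    (he : ∀ i j, g.inner x (e i) (e j) = if i = j then 1 else 0) (X : Π x : M, TangentSpace (𝓡 4) x) :
    divergence g X x = ∑ i, g.inner x (leviCivita g X x (e i)) (e i) := by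
  have h := orthonormal_trace g (frame_orthonormal g x) he
    (LinearMap.mk₂ ℝ (fun v w => g.inner x (leviCivita g X x v) w)
      (by simp) (by simp) (by simp) (by simp))
  exact h

theorem smooth_divergence (g : Metric4 M) {X : Π x : M, TangentSpace (𝓡 4) x}
    (hX : SmoothSec E4 X) : ContMDiff (𝓡 4) 𝓘(ℝ) ∞ (divergence g X) := by
  intro x
  obtain ⟨E, hE, hEo⟩ := exists_smooth_orthonormal_frame g x
  have h : ContMDiff (𝓡 4) 𝓘(ℝ) ∞
      (fun y => ∑ i, g.inner y (leviCivita g X y (E i y)) (E i y)) :=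
    contMDiff_finsetSum fun i _ => smooth_inner g (smooth_leviCivita g _ _ (hE i) hX) (hE i)
  refine (h x).congr_of_eventuallyEq ?_
  filter_upwards [hEo] with y hy
  exact divergence_eq g hy X

theorem divergence_smul (g : Metric4 M) {h : M → ℝ} (hh : ContMDiff (𝓡 4) 𝓘(ℝ) ∞ h)
    {X : Π x : M, TangentSpace (𝓡 4) x} (hX : SmoothSec E4 X) (x : M) :
    divergence g (fun y => h y • X y) x = h x * divergence g X x + mvfderiv (𝓡 4) h x (X x) := by
  simp only [divergence, conn_smul (smooth_mdiff hh x) (hX.diffSecAt x)]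
  conv_rhs => rw [← frame_expand g x (X x)]
  simp only [map_add, map_smul, _root_.add_apply, _root_.smul_apply, smul_eq_mul, map_sum,
    Finset.sum_add_distrib, Finset.mul_sum]
  congr 1
  exact Finset.sum_congr rfl fun i _ => mul_comm _ _

theorem divergence_sum (g : Metric4 M) {ι : Type*} (t : Finset ι)
    {X : ι → Π x : M, TangentSpace (𝓡 4) x} (hX : ∀ i, SmoothSec E4 (X i)) (x : M) :
    divergence g (fun y => ∑ i ∈ t, X i y) x = ∑ i ∈ t, divergence g (X i) x := by
  simp only [divergence, conn_sum t hX, map_sum, _root_.sum_apply]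
  exact Finset.sum_comm

theorem divergence_eq_zero (g : Metric4 M) {X : Π x : M, TangentSpace (𝓡 4) x} {x : M}
    (h : ∀ᶠ y in 𝓝 x, X y = 0) : divergence g X x = 0 := by
  have h0 : SmoothSec E4 (fun y : M => (0 : TangentSpace (𝓡 4) y)) :=
    Bundle.contMDiff_zeroSection ℝ (TangentSpace (𝓡 4) : M → Type _)
  have h1 : leviCivita g X x = leviCivita g (fun y : M => (0 : TangentSpace (𝓡 4) y)) x :=
    conn_congr (h0.diffSecAt x) h
  simp [divergence, h1, conn_zero]

variable [CompactSpace M]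

/-- The expression in a chart of a smooth function supported in the chart. -/
theorem integral_fderiv_chart {x₀ : M} {k : M → ℝ} (hk : ContMDiff (𝓡 4) 𝓘(ℝ) ∞ k)
    (hks : tsupport k ⊆ (chartAt E4 x₀).source) (v : E4) :
    IntegrableOn (fun z => fderiv ℝ (fun z => k ((chartAt E4 x₀).symm z)) z v)
      (chartAt E4 x₀).target ∧
    ∫ z in (chartAt E4 x₀).target, fderiv ℝ (fun z => k ((chartAt E4 x₀).symm z)) z v = 0 := by
  set e := chartAt E4 x₀
  -- Extension by zero is smooth on all of ℝ⁴, since the support corresponds to a compact subset of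
  -- the open chart target.
  let H : E4 → ℝ := e.target.indicator fun z => k (e.symm z)
  have hKc : IsCompact (e '' tsupport k) :=
    (isClosed_tsupport k).isCompact.image_of_continuousOn (e.continuousOn.mono hks)
  have hHe : ∀ z ∈ e.target, H =ᶠ[𝓝 z] fun z => k (e.symm z) := fun z hz => by
    filter_upwards [e.open_target.mem_nhds hz] with w hw
    exact Set.indicator_of_mem hw _
  have hH0 : ∀ z, z ∉ e '' tsupport k → H z = 0 := by
    intro z hz
    by_cases hzt : z ∈ e.target
    · simp only [H, Set.indicator_of_mem hzt]
      by_contra hne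
      exact hz ⟨e.symm z, subset_tsupport k hne, e.right_inv hzt⟩
    · exact Set.indicator_of_notMem hzt _
  have hHc : ContDiff ℝ ∞ H := by
    rw [contDiff_iff_contDiffAt]
    intro z
    by_cases hzt : z ∈ e.target
    · have h1 : ContMDiffAt 𝓘(ℝ, E4) (𝓡 4) ∞ e.symm z :=
        contMDiffOn_chart_symm.contMDiffAt (e.open_target.mem_nhds hzt)
      have h2 : ContMDiffAt 𝓘(ℝ, E4) 𝓘(ℝ) ∞ (fun z => k (e.symm z)) z := (hk _).comp z h1
      exact h2.contDiffAt.congr_of_eventuallyEq (hHe z hzt)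
    · have hz : z ∉ e '' tsupport k := by
        rintro ⟨p, hp, rfl⟩
        exact hzt (e.map_source (hks hp))
      refine (contDiffAt_const (c := (0 : ℝ))).congr_of_eventuallyEq ?_
      filter_upwards [hKc.isClosed.isOpen_compl.mem_nhds hz] with w hw
      exact hH0 w hw
  have hHs : HasCompactSupport H := HasCompactSupport.intro hKc hH0
  have hH1 : ContDiff ℝ 1 H := hHc.of_le (by simp)
  have hfd : ∀ z ∈ e.target, fderiv ℝ (fun z => k (e.symm z)) z v = fderiv ℝ H z v :=
    fun z hz => by rw [(hHe z hz).fderiv_eq]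
  have hout : ∀ z, z ∉ e.target → fderiv ℝ H z v = 0 := by
    intro z hz
    have hz' : z ∉ e '' tsupport k := by
      rintro ⟨p, hp, rfl⟩
      exact hz (e.map_source (hks hp))
    have : H =ᶠ[𝓝 z] fun _ => 0 := by
      filter_upwards [hKc.isClosed.isOpen_compl.mem_nhds hz'] with w hw
      exact hH0 w hw
    rw [this.fderiv_eq]
    simp
  constructor
  · exact (integrable_fderiv_apply hH1 hHs v).integrableOn.congr_fun (fun z hz => (hfd z hz).symm)
      e.open_target.measurableSet
  · rw [setIntegral_congr_fun e.open_target.measurableSet hfd,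
      setIntegral_eq_integral_of_forall_compl_eq_zero hout, integral_fderiv_apply_eq_zero hH1 hHs]

variable [MeasurableSpace M] [BorelSpace M]

theorem continuous_integrable (g : Metric4 M) {k : M → ℝ} (hk : Continuous k) :
    Integrable k (riemannianVolume g) :=
  hk.integrable_of_hasCompactSupport (HasCompactSupport.of_compactSpace k)

theorem integral_chartVolume (g : Metric4 M) (x₀ : M) {k : M → ℝ} (hk : Continuous k) :
    ∫ x, k x ∂(chartVolume g x₀) = ∫ z in (chartAt E4 x₀).target,
      Real.sqrt (chartGram g x₀ z).det * k ((chartAt E4 x₀).symm z) := by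
  have ht := (chartAt E4 x₀).open_target.measurableSet
  rw [chartVolume, integral_map
    (aemeasurable_chart_symm x₀ _ (withDensity_absolutelyContinuous _ _))
    hk.aestronglyMeasurable, integral_withDensity_eq_integral_toReal_smul₀
    ((continuousOn_sqrt_det g x₀).aemeasurable ht).ennreal_ofReal (by simp)]
  refine integral_congr_ae (Filter.Eventually.of_forall fun z => ?_)
  simp only [ENNReal.toReal_ofReal (Real.sqrt_nonneg _), smul_eq_mul]

/-- In the chart the density times the divergence is a sum of partial derivatives of the functions
√g Y^j, which are supported in `K`; each integrates to zero. -/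
theorem integral_divergence_of_tsupport (g : Metric4 M) {x₀ : M}
    {Y : Π x : M, TangentSpace (𝓡 4) x} (hY : SmoothSec E4 Y) {K : Set M} (hK : IsClosed K)
    (hKU : K ⊆ (chartAt E4 x₀).source) (hYK : ∀ x, x ∉ K → Y x = 0) :
    ∫ x, divergence g Y x ∂(riemannianVolume g) = 0 := by
  set e := chartAt E4 x₀
  let c : Fin 4 → M → ℝ := fun j p => mvfderiv (𝓡 4) (fun q => e q j) p (Y p)
  let k : Fin 4 → M → ℝ := fun j p => Real.sqrt (gram g x₀ p).det * c j p
  have hk0 : ∀ j x, x ∉ K → k j x = 0 := fun j x hx => by simp [k, c, hYK x hx]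
  have hks : ∀ j, tsupport (k j) ⊆ K := fun j =>
    closure_minimal (fun x hx => by
      by_contra hxK
      exact hx (hk0 j x hxK)) hK
  have hc : ∀ j, ∀ y ∈ e.source, ContMDiffAt (𝓡 4) 𝓘(ℝ) ∞ (c j) y := by
    intro j y hy
    obtain ⟨h, hh, he⟩ := exists_smooth_coord hy j
    refine (smooth_mvfderiv hh hY y).congr_of_eventuallyEq ?_
    filter_upwards [eventually_eventually_nhds.2 he] with p hp
    exact (mvfderiv_congr hp _).symm
  have hk : ∀ j, ContMDiff (𝓡 4) 𝓘(ℝ) ∞ (k j) := fun j =>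
    contMDiff_of_tsupport fun y hy =>
      (contMDiffAt_sqrt_det g (hKU (hks j hy))).mul (hc j y (hKU (hks j hy)))
  have hout : ∀ x, x ∉ e.source → divergence g Y x = 0 := fun x hx =>
    divergence_eq_zero g (Filter.eventually_of_mem
      (hK.isOpen_compl.mem_nhds fun h => hx (hKU h)) fun y hy => hYK y hy)
  rw [← setIntegral_eq_integral_of_forall_compl_eq_zero hout, riemannianVolume_restrict,
    integral_chartVolume g x₀ (smooth_divergence g hY).continuous]
  have hpt : ∀ z ∈ e.target, Real.sqrt (chartGram g x₀ z).det * divergence g Y (e.symm z)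
      = ∑ j, fderiv ℝ (fun z => k j (e.symm z)) z (EuclideanSpace.single j 1) := by
    intro z hz
    rw [chartGram_eq g hz, sqrt_det_mul_divergence g (e.map_target hz) hY]
    refine Finset.sum_congr rfl fun j _ => ?_
    exact mvfderiv_coordField hz j (smooth_mdiff (hk j) _)
  rw [setIntegral_congr_fun e.open_target.measurableSet hpt, integral_finsetSum]
  · exact Finset.sum_eq_zero fun j _ => (integral_fderiv_chart (hk j) ((hks j).trans hKU) _).2
  · exact fun j _ => (integral_fderiv_chart (hk j) ((hks j).trans hKU) _).1

/-- The divergence theorem on a closed manifold. -/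
theorem integral_divergence (g : Metric4 M) {X : Π x : M, TangentSpace (𝓡 4) x}
    (hX : SmoothSec E4 X) : ∫ x, divergence g X x ∂(riemannianVolume g) = 0 := by
  obtain ⟨t, ht⟩ := isCompact_univ.elim_finite_subcover (fun x : M => (chartAt E4 x).source)
    (fun x => (chartAt E4 x).open_source)
    (fun x _ => Set.mem_iUnion.2 ⟨x, mem_chart_source E4 x⟩)
  -- Indexing by a finite subcover makes X = Σ ρ_i X a finite sum of fields, each supported in one
  -- chart.
  obtain ⟨ρ, hρ⟩ := SmoothPartitionOfUnity.exists_isSubordinate (𝓡 4) (s := (Set.univ : Set M))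
    isClosed_univ (fun i : t => (chartAt E4 (i : M)).source)
    (fun i => (chartAt E4 (i : M)).open_source)
    (fun x hx => by
      obtain ⟨i, hi⟩ := Set.mem_iUnion.1 (ht hx)
      obtain ⟨hit, hxi⟩ := Set.mem_iUnion.1 hi
      exact Set.mem_iUnion.2 ⟨⟨i, hit⟩, hxi⟩)
  have hρX : ∀ i, SmoothSec E4 (fun y => ρ i y • X y) := fun i =>
    SmoothSec.smul (ρ i).contMDiff hX
  have hsum : X = fun y => ∑ i, ρ i y • X y := by
    funext y
    have := ρ.sum_eq_one (Set.mem_univ y)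
    rw [finsum_eq_sum_of_fintype] at this
    rw [← Finset.sum_smul, this, one_smul]
  rw [hsum]
  simp only [divergence_sum g Finset.univ hρX]
  rw [integral_finsetSum _ fun i _ => continuous_integrable g (smooth_divergence g (hρX i)).continuous]
  refine Finset.sum_eq_zero fun i _ => ?_
  refine integral_divergence_of_tsupport g (hρX i) (isClosed_tsupport (ρ i)) (hρ i) fun x hx => ?_
  rw [image_eq_zero_of_notMem_tsupport hx, zero_smul]

theorem integral_laplacian (g : Metric4 M) {f : M → ℝ} (hf : ContMDiff (𝓡 4) 𝓘(ℝ) ∞ f) :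
    ∫ x, laplacian g f x ∂(riemannianVolume g) = 0 :=
  integral_divergence g (smooth_grad g hf)

end DivergenceTheorem

/-! ### Calculus of gradients. -/

section Gradient

variable {M : Type*} [TopologicalSpace M] [ChartedSpace E4 M] [IsManifold (𝓡 4) ∞ M] [T2Space M]

theorem grad_comp (g : Metric4 M) {f : M → ℝ} (hf : ContMDiff (𝓡 4) 𝓘(ℝ) ∞ f) {h : ℝ → ℝ} {h' : ℝ}
    {x : M} (hh : HasDerivAt h h' (f x)) : grad g (fun y => h (f y)) x = h' • grad g f x := by
  simp only [grad, mvfderiv_comp_hasDerivAt hh (smooth_mdiff hf x), Finset.smul_sum, smul_smul]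

theorem grad_mul (g : Metric4 M) {f h : M → ℝ} (hf : ContMDiff (𝓡 4) 𝓘(ℝ) ∞ f)
    (hh : ContMDiff (𝓡 4) 𝓘(ℝ) ∞ h) (x : M) :
    grad g (fun y => f y * h y) x = f x • grad g h x + h x • grad g f x := by
  simp only [grad, mvfderiv_fun_mul (smooth_mdiff hf x) (smooth_mdiff hh x), Finset.smul_sum,
    smul_smul, ← Finset.sum_add_distrib, ← add_smul]
  rfl

theorem grad_add_smul (g : Metric4 M) {f h : M → ℝ} (hf : ContMDiff (𝓡 4) 𝓘(ℝ) ∞ f)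
    (hh : ContMDiff (𝓡 4) 𝓘(ℝ) ∞ h) (t : ℝ) (x : M) :
    grad g (fun y => f y + t * h y) x = grad g f x + t • grad g h x := by
  have h1 : mvfderiv (𝓡 4) (fun y => f y + t * h y) x = mvfderiv (𝓡 4) f x
      + mvfderiv (𝓡 4) (fun y => t * h y) x :=
    mvfderiv_fun_add (smooth_mdiff hf x) (smooth_mdiff (contMDiff_const.mul hh) x)
  have h2 : ∀ v, mvfderiv (𝓡 4) (fun y => t * h y) x v = t * mvfderiv (𝓡 4) h x v := fun v =>
    mvfderiv_clm_comp (ContinuousLinearMap.mul ℝ ℝ t) (smooth_mdiff hh x) v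
  simp only [grad, h1, _root_.add_apply, h2, Finset.smul_sum, smul_smul, ← Finset.sum_add_distrib,
    ← add_smul]

theorem grad_sum_sq (g : Metric4 M) {f : M → ℝ} {x : M} {e : Fin 4 → TangentSpace (𝓡 4) x}
    (he : ∀ i j, g.inner x (e i) (e j) = if i = j then 1 else 0) (h : M → ℝ) :
    g.inner x (grad g f x) (grad g h x)
      = ∑ i, mvfderiv (𝓡 4) f x (e i) * mvfderiv (𝓡 4) h x (e i) := by
  conv_lhs => rw [← orthonormal_expand g he (grad g h x)]
  simp only [map_sum, map_smul, smul_eq_mul, inner_grad]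
  exact Finset.sum_congr rfl fun i _ => mul_comm _ _

theorem smooth_gradInner (g : Metric4 M) {f h : M → ℝ} (hf : ContMDiff (𝓡 4) 𝓘(ℝ) ∞ f)
    (hh : ContMDiff (𝓡 4) 𝓘(ℝ) ∞ h) :
    ContMDiff (𝓡 4) 𝓘(ℝ) ∞ (fun x => g.inner x (grad g f x) (grad g h x)) :=
  smooth_inner g (smooth_grad g hf) (smooth_grad g hh)

theorem smooth_exp_mul {f : M → ℝ} (hf : ContMDiff (𝓡 4) 𝓘(ℝ) ∞ f) (c : ℝ) :
    ContMDiff (𝓡 4) 𝓘(ℝ) ∞ (fun x => Real.exp (c * f x)) :=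
  (Real.contDiff_exp.comp (contDiff_const.mul contDiff_id)).contMDiff.comp hf

theorem grad_exp_mul (g : Metric4 M) {f : M → ℝ} (hf : ContMDiff (𝓡 4) 𝓘(ℝ) ∞ f) (c : ℝ) (x : M) :
    grad g (fun x => Real.exp (c * f x)) x = (c * Real.exp (c * f x)) • grad g f x := by
  refine grad_comp g hf (h := fun r => Real.exp (c * r)) ?_
  have := ((hasDerivAt_id (f x)).const_mul c).exp
  simpa [mul_comm] using this

end Gradient

/-! ### The λ-functional as a quadratic form and its Euler-Lagrange equation. -/

section Entropy

variable {M : Type*} [TopologicalSpace M] [ChartedSpace E4 M] [IsManifold (𝓡 4) ∞ M] [T2Space M]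
  [CompactSpace M] [MeasurableSpace M] [BorelSpace M]

/-- `∫ (R w² + 4 |∇ w|²) dV`, the entropy functional in terms of `w = e^{-f/2}`. -/
def energy (g : Metric4 M) (w : M → ℝ) : ℝ :=
  ∫ x, (scalarCurvature g x * w x ^ 2 + 4 * g.inner x (grad g w x) (grad g w x))
    ∂(riemannianVolume g)

/-- Pointwise R_f e^{-f} = R w² + 4|∇w|² - 2Δ(e^{-f}) with w = e^{-f/2}, and the Laplacian
integrates to zero. -/
theorem hilbertEinstein_eq_energy (g : Metric4 M) {f : M → ℝ} (hf : ContMDiff (𝓡 4) 𝓘(ℝ) ∞ f) :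
    hilbertEinstein g f = energy g (fun x => Real.exp (-1 / 2 * f x)) := by
  have hE := smooth_exp_mul hf (-1)
  have hpt : ∀ x, weightedScalarCurvature g f x * Real.exp (-f x)
      = (scalarCurvature g x * Real.exp (-1 / 2 * f x) ^ 2
          + 4 * g.inner x (grad g (fun x => Real.exp (-1 / 2 * f x)) x)
            (grad g (fun x => Real.exp (-1 / 2 * f x)) x))
        - 2 * laplacian g (fun x => Real.exp (-1 * f x)) x := by
    intro x
    have h1 : laplacian g (fun x => Real.exp (-1 * f x)) x
        = -Real.exp (-1 * f x) * laplacian g f x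
          + Real.exp (-1 * f x) * g.inner x (grad g f x) (grad g f x) := by
      have h2 : grad g (fun x => Real.exp (-1 * f x))
          = fun x => (-Real.exp (-1 * f x)) • grad g f x := by
        funext y
        rw [grad_exp_mul g hf]
        ring_nf
      rw [laplacian_eq_divergence, h2, divergence_smul g hE.neg (smooth_grad g hf),
        laplacian_eq_divergence, inner_grad]
      congr 1
      have h3 := mvfderiv_comp_hasDerivAt (((hasDerivAt_id (f x)).const_mul (-1 : ℝ)).exp.neg)
        (smooth_mdiff hf x) (grad g f x)
      simpa using h3
    have h4 : Real.exp (-1 / 2 * f x) ^ 2 = Real.exp (-f x) := by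
      rw [← Real.exp_nat_mul]
      ring_nf
    rw [h1, grad_exp_mul g hf, weightedScalarCurvature]
    simp only [map_smul, _root_.smul_apply, smul_eq_mul]
    rw [h4, show -1 * f x = -f x by ring]
    linear_combination (-(g.inner x (grad g f x) (grad g f x))) * h4
  unfold hilbertEinstein energy
  simp only [hpt]
  have hw := smooth_exp_mul hf (-1 / 2)
  rw [integral_sub, integral_const_mul, integral_laplacian g hE, mul_zero, sub_zero]
  · exact continuous_integrable g (((continuous_scalarCurvature g).mul (hw.continuous.pow 2)).add
      (continuous_const.mul (smooth_gradInner g hw hw).continuous))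
  · exact continuous_integrable g
      (continuous_const.mul (smooth_divergence g (smooth_grad g hE)).continuous)

theorem energy_const_mul (g : Metric4 M) {w : M → ℝ} (hw : ContMDiff (𝓡 4) 𝓘(ℝ) ∞ w) (c : ℝ) :
    energy g (fun x => c * w x) = c ^ 2 * energy g w := by
  unfold energy
  rw [← integral_const_mul]
  refine integral_congr_ae (Filter.Eventually.of_forall fun x => ?_)
  have h : grad g (fun x => c * w x) x = c • grad g w x :=
    grad_comp g hw (h := fun r => c * r) (by simpa using (hasDerivAt_id (w x)).const_mul c)
  simp only [h, map_smul, _root_.smul_apply, smul_eq_mul]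
  ring

theorem energy_add_smul (g : Metric4 M) {u v : M → ℝ} (hu : ContMDiff (𝓡 4) 𝓘(ℝ) ∞ u)
    (hv : ContMDiff (𝓡 4) 𝓘(ℝ) ∞ v) (t : ℝ) :
    energy g (fun x => u x + t * v x) = energy g u
      + 2 * t * ∫ x, (scalarCurvature g x * (u x * v x)
          + 4 * g.inner x (grad g u x) (grad g v x)) ∂(riemannianVolume g)
      + t ^ 2 * energy g v := by
  have hR := continuous_scalarCurvature g
  have huu := (smooth_gradInner g hu hu).continuous
  have huv := (smooth_gradInner g hu hv).continuous
  have hvv := (smooth_gradInner g hv hv).continuous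
  have hu' := hu.continuous
  have hv' := hv.continuous
  have hint : ∀ {k : M → ℝ}, Continuous k → Integrable k (riemannianVolume g) := fun hk =>
    continuous_integrable g hk
  unfold energy
  rw [← integral_const_mul, ← integral_const_mul, ← integral_add (hint (by fun_prop))
    (hint (by fun_prop)), ← integral_add (hint (by fun_prop)) (hint (by fun_prop))]
  refine integral_congr_ae (Filter.Eventually.of_forall fun x => ?_)
  simp only [grad_add_smul g hu hv, map_add, map_smul, _root_.add_apply, _root_.smul_apply,
    smul_eq_mul]
  rw [g.symm x (grad g v x) (grad g u x)]
  ring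

/-- Homogeneity removes the constraint: any positive w, scaled to unit L² norm, is e^{-h/2} for an
admissible h. The minimizing property thus becomes a quadratic inequality. -/
theorem IsLambdaMinimizer.mul_integral_sq_le {g : Metric4 M} {f : M → ℝ} (hf : IsLambdaMinimizer g f)
    [Nonempty M] {w : M → ℝ} (hw : ContMDiff (𝓡 4) 𝓘(ℝ) ∞ w) (hpos : ∀ x, 0 < w x) :
    hilbertEinstein g f * ∫ x, w x ^ 2 ∂(riemannianVolume g) ≤ energy g w := by
  set N := ∫ x, w x ^ 2 ∂(riemannianVolume g) with hN
  have hw2 : Continuous fun x => w x ^ 2 := hw.continuous.pow 2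
  have hNpos : 0 < N := by
    obtain ⟨x⟩ := ‹Nonempty M›
    exact hw2.integral_pos_of_hasCompactSupport_nonneg_nonzero
      (HasCompactSupport.of_compactSpace _) (fun x => sq_nonneg _) (pow_pos (hpos x) 2).ne'
  -- Chosen so that e^{-h} = w²/N.
  let h : M → ℝ := fun x => -2 * Real.log (w x) + Real.log N
  have hh : ContMDiff (𝓡 4) 𝓘(ℝ) ∞ h := by
    intro x
    have h1 : ContDiffAt ℝ ∞ (fun r : ℝ => -2 * Real.log r + Real.log N) (w x) :=
      (contDiffAt_const.mul (Real.contDiffAt_log.2 (hpos x).ne')).add contDiffAt_const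
    exact h1.contMDiffAt.comp x (hw x)
  have hexp : ∀ x, Real.exp (-h x) = N⁻¹ * w x ^ 2 := fun x => by
    have : -h x = Real.log (w x) + Real.log (w x) - Real.log N := by simp only [h]; ring
    rw [this, Real.exp_sub, Real.exp_add, Real.exp_log (hpos x), Real.exp_log hNpos]
    field_simp
  have hhalf : ∀ x, Real.exp (-1 / 2 * h x) = (Real.sqrt N)⁻¹ * w x := fun x => by
    have : -1 / 2 * h x = Real.log (w x) - Real.log (Real.sqrt N) := by
      rw [Real.log_sqrt hNpos.le]
      simp only [h]
      ring
    rw [this, Real.exp_sub, Real.exp_log (hpos x), Real.exp_log (Real.sqrt_pos.2 hNpos)]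
    field_simp
  have hnorm : Normalized g h := by
    refine ⟨hh, ?_⟩
    simp only [hexp]
    rw [integral_const_mul, ← hN, inv_mul_cancel₀ hNpos.ne']
  have := hf.2 h hnorm
  rw [hilbertEinstein_eq_energy g hh] at this
  simp only [hhalf] at this
  rw [energy_const_mul g hw, inv_pow, Real.sq_sqrt hNpos.le, inv_mul_eq_div,
    le_div_iff₀ hNpos] at this
  exact this

/-- By compactness v/u is bounded, so 1 + t v/u stays positive for small t, uniformly in x. -/
theorem exists_pos_perturbation {u v : M → ℝ} (hu : Continuous u) (hv : Continuous v)
    (hpos : ∀ x, 0 < u x) : ∀ᶠ t in 𝓝 (0 : ℝ), ∀ x, 0 < u x + t * v x := by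
  obtain ⟨C, hC⟩ := isCompact_univ.exists_bound_of_continuousOn (f := fun x => v x / u x)
    (hv.div hu fun x => (hpos x).ne').continuousOn
  have hlim : ∀ᶠ t in 𝓝 (0 : ℝ), |t| * (|C| + 1) < 1 := by
    have : Continuous fun t : ℝ => |t| * (|C| + 1) := by fun_prop
    exact this.continuousAt.eventually (gt_mem_nhds (by simp))
  filter_upwards [hlim] with t ht x
  have h1 : |v x / u x| ≤ |C| := (hC x trivial).trans (le_abs_self C)
  have h2 : |t * (v x / u x)| < 1 := by
    rw [abs_mul]
    have := mul_le_mul_of_nonneg_left h1 (abs_nonneg t)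
    nlinarith [abs_nonneg t]
  have h3 : u x + t * v x = u x * (1 + t * (v x / u x)) := by
    have := (hpos x).ne'
    field_simp
  rw [h3]
  exact mul_pos (hpos x) (by linarith [neg_lt_of_abs_lt h2])

theorem eq_zero_of_eventually_quadratic_nonneg {a b : ℝ}
    (h : ∀ᶠ t in 𝓝 (0 : ℝ), 0 ≤ 2 * t * a + t ^ 2 * b) : a = 0 := by
  have hmin : IsLocalMin (fun t : ℝ => 2 * t * a + t ^ 2 * b) 0 := by
    filter_upwards [h] with t ht
    simpa using ht
  have hd : HasDerivAt (fun t : ℝ => 2 * t * a + t ^ 2 * b) (2 * a) 0 := by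
    have h1 := ((hasDerivAt_id (0 : ℝ)).const_mul 2).mul_const a
    have h2 := ((hasDerivAt_id (0 : ℝ)).pow 2).mul_const b
    exact (h1.add h2).congr_deriv (by simp)
  linarith [hmin.hasDerivAt_eq_zero hd]

/-- The Euler-Lagrange equation of the entropy, tested against `p e^{f/2}`. -/
theorem IsLambdaMinimizer.euler_lagrange {g : Metric4 M} {f : M → ℝ} (hf : IsLambdaMinimizer g f)
    [Nonempty M] {p : M → ℝ} (hp : ContMDiff (𝓡 4) 𝓘(ℝ) ∞ p) :
    hilbertEinstein g f * ∫ x, p x ∂(riemannianVolume g)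
      = ∫ x, (scalarCurvature g x * p x - 2 * g.inner x (grad g f x) (grad g p x)
          - p x * g.inner x (grad g f x) (grad g f x)) ∂(riemannianVolume g) := by
  have hfs := hf.1.1
  set u : M → ℝ := fun x => Real.exp (-1 / 2 * f x) with hu_def
  -- The direction of variation is chosen so that u v = p, which removes the exponentials from the
  -- variation formula.
  let v : M → ℝ := fun x => p x * Real.exp (1 / 2 * f x)
  have hu : ContMDiff (𝓡 4) 𝓘(ℝ) ∞ u := smooth_exp_mul hfs _
  have hv : ContMDiff (𝓡 4) 𝓘(ℝ) ∞ v := hp.mul (smooth_exp_mul hfs _)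
  have huv : ∀ x, u x * v x = p x := fun x => by
    have : Real.exp (-1 / 2 * f x) * Real.exp (1 / 2 * f x) = 1 := by
      rw [← Real.exp_add, ← Real.exp_zero]; ring_nf
    simp only [u, v]
    linear_combination p x * this
  have hu2 : ∀ x, u x ^ 2 = Real.exp (-f x) := fun x => by
    simp only [u]
    rw [← Real.exp_nat_mul]
    ring_nf
  have hint : ∀ {k : M → ℝ}, Continuous k → Integrable k (riemannianVolume g) := fun hk =>
    continuous_integrable g hk
  have huc := hu.continuous
  have hvc := hv.continuous
  set lam := hilbertEinstein g f
  have hlam : lam = energy g u := hilbertEinstein_eq_energy g hfs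
  have hnorm : ∫ x, u x ^ 2 ∂(riemannianVolume g) = 1 := by
    simp only [hu2]
    exact hf.1.2
  have hsq : ∀ t : ℝ, ∫ x, (u x + t * v x) ^ 2 ∂(riemannianVolume g)
      = 1 + 2 * t * ∫ x, p x ∂(riemannianVolume g)
        + t ^ 2 * ∫ x, v x ^ 2 ∂(riemannianVolume g) := by
    intro t
    have hpc := hp.continuous
    rw [← hnorm, ← integral_const_mul, ← integral_const_mul, ← integral_add (hint (by fun_prop))
      (hint (by fun_prop)), ← integral_add (hint (by fun_prop)) (hint (by fun_prop))]
    refine integral_congr_ae (Filter.Eventually.of_forall fun x => ?_)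
    simp only [← huv]
    ring
  have hvar : (∫ x, (scalarCurvature g x * (u x * v x)
      + 4 * g.inner x (grad g u x) (grad g v x)) ∂(riemannianVolume g))
      - lam * ∫ x, p x ∂(riemannianVolume g) = 0 := by
    -- For small t, u + t v is positive, so the quadratic inequality applies. Its constant term
    -- vanishes because u attains equality, hence the linear coefficient must vanish.
    refine eq_zero_of_eventually_quadratic_nonneg
      (b := energy g v - lam * ∫ x, v x ^ 2 ∂(riemannianVolume g)) ?_
    filter_upwards [exists_pos_perturbation huc hvc fun x => Real.exp_pos _] with t ht
    have h1 := hf.mul_integral_sq_le (w := fun x => u x + t * v x)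
      (hu.add (contMDiff_const.mul hv)) ht
    rw [hsq, energy_add_smul g hu hv, ← hlam] at h1
    linarith
  rw [← sub_eq_zero.1 hvar]
  refine integral_congr_ae (Filter.Eventually.of_forall fun x => ?_)
  have h1 : grad g u x = (-1 / 2 * Real.exp (-1 / 2 * f x)) • grad g f x := grad_exp_mul g hfs _ x
  have h2 : grad g v x = p x • ((1 / 2 * Real.exp (1 / 2 * f x)) • grad g f x)
      + Real.exp (1 / 2 * f x) • grad g p x := by
    rw [← grad_exp_mul g hfs]
    exact grad_mul g hp (smooth_exp_mul hfs _) x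
  have h3 : Real.exp (-1 / 2 * f x) * Real.exp (1 / 2 * f x) = 1 := by
    rw [← Real.exp_add, ← Real.exp_zero]; ring_nf
  simp only [huv, h1, h2, map_smul, map_add, _root_.smul_apply, smul_eq_mul]
  linear_combination (-(2 * g.inner x (grad g f x) (grad g p x))
    - p x * g.inner x (grad g f x) (grad g f x)) * h3

end Entropy

/-! ### Rescaled monopoles and the entropy formula. -/

section Monopole

variable {M : Type*} [TopologicalSpace M] [T2Space M]
    [ChartedSpace E4 M] [IsManifold (𝓡 4) ∞ M]
    {g : Metric4 M} {o : Orientation4 M}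
    {Wp Wm L : M → Type*}
    [∀ x, NormedAddCommGroup (Wp x)] [∀ x, InnerProductSpace ℂ (Wp x)]
    [TopologicalSpace (Bundle.TotalSpace C2 Wp)] [FiberBundle C2 Wp]
    [VectorBundle ℂ C2 Wp] [VectorBundle ℝ C2 Wp]
    [ContMDiffVectorBundle ∞ C2 Wp (𝓡 4)] [SmoothHermitian C2 Wp]
    [∀ x, NormedAddCommGroup (Wm x)] [∀ x, InnerProductSpace ℂ (Wm x)]
    [TopologicalSpace (Bundle.TotalSpace C2 Wm)] [FiberBundle C2 Wm]
    [VectorBundle ℂ C2 Wm] [VectorBundle ℝ C2 Wm]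
    [ContMDiffVectorBundle ∞ C2 Wm (𝓡 4)] [SmoothHermitian C2 Wm]
    [∀ x, NormedAddCommGroup (L x)] [∀ x, InnerProductSpace ℂ (L x)]
    [TopologicalSpace (Bundle.TotalSpace ℂ L)] [FiberBundle ℂ L]
    [VectorBundle ℂ ℂ L] [VectorBundle ℝ ℂ L]
    [ContMDiffVectorBundle ∞ ℂ L (𝓡 4)] [SmoothHermitian ℂ L]
    {𝔰 : SpinCStructure Wp Wm L g o} {A : SpinCConnection 𝔰}
    {φ ψ : Π x : M, Wp x} {f : M → ℝ}

theorem norm_exp_smul (hψ : ∀ x, ψ x = Real.exp (f x / 2) • φ x) (x : M) :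
    ‖ψ x‖ ^ 2 = Real.exp (f x) * ‖φ x‖ ^ 2 := by
  have : Real.exp (f x / 2) ^ 2 = Real.exp (f x) := by
    rw [← Real.exp_nat_mul]
    ring_nf
  rw [hψ, norm_smul, Real.norm_of_nonneg (Real.exp_pos _).le, mul_pow, this]

theorem SpinCConnection.IsMonopole.isWeightedMonopole (hφ : A.IsMonopole φ)
    (hf : ContMDiff (𝓡 4) 𝓘(ℝ) ∞ f) (hψ : ∀ x, ψ x = Real.exp (f x / 2) • φ x) :
    A.IsWeightedMonopole f ψ where
  smooth := by
    have h1 := smooth_exp_mul hf (1 / 2)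
    have h2 : ψ = fun x => Real.exp (1 / 2 * f x) • φ x := by
      funext x
      rw [hψ]
      ring_nf
    rw [h2]
    exact SmoothSec.smul h1 hφ.smooth
  curvature_eq x χ := by
    have h1 : Real.exp (f x / 2) * Real.exp (f x / 2) = Real.exp (f x) := by
      rw [← Real.exp_add]; ring_nf
    have h2 : Real.exp (-f x) * Real.exp (f x) = 1 := by
      rw [← Real.exp_add]; simp
    have h3 : ⟪ψ x, χ⟫_ℂ • ψ x = Real.exp (f x) • (⟪φ x, χ⟫_ℂ • φ x) := by
      rw [hψ, ← Complex.coe_smul, inner_smul_left, smul_smul, ← h1, Complex.conj_ofReal,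
        ← Complex.coe_smul, smul_smul]
      congr 1
      push_cast
      ring
    rw [hφ.curvature_eq, h3, norm_exp_smul hψ, smul_sub, smul_smul, smul_smul, h2, one_smul]
    congr 2
    linear_combination (-‖φ x‖ ^ 2 / 2) * h2
  dirac_eq x := by
    have h1 : (fun y => Real.exp (-f y / 2) • ψ y) = φ := by
      funext y
      rw [hψ, smul_smul, ← Real.exp_add]
      ring_nf
      simp
    rw [SpinCConnection.weightedDirac, h1, hφ.dirac_eq, smul_zero]

/-- ∇ψ = e^{f/2}(∇φ + ½ df ⊗ φ). The cross term in its square is df paired with Re⟨φ, ∇φ⟩ = ½ d|φ|².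
-/
theorem normSqNabla_exp_smul (hφ : SmoothSec C2 φ)
    (hf : ContMDiff (𝓡 4) 𝓘(ℝ) ∞ f) (hψ : ∀ x, ψ x = Real.exp (f x / 2) • φ x) (x : M) :
    A.normSqNabla ψ x * Real.exp (-f x) = A.normSqNabla φ x
      + 1 / 2 * g.inner x (grad g f x) (grad g (fun x => ‖φ x‖ ^ 2) x)
      + 1 / 4 * g.inner x (grad g f x) (grad g f x) * ‖φ x‖ ^ 2 := by
  have he := frame_orthonormal g x
  have hE := smooth_exp_mul hf (1 / 2)
  have hψ' : ψ = fun x => Real.exp (1 / 2 * f x) • φ x := by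
    funext x
    rw [hψ]
    ring_nf
  have h1 : ∀ v, A.nablaP ψ x v
      = Real.exp (1 / 2 * f x) • (A.nablaP φ x v + (1 / 2 * mvfderiv (𝓡 4) f x v) • φ x) := by
    intro v
    have h2 := mvfderiv_comp_hasDerivAt (((hasDerivAt_id (f x)).const_mul (1 / 2 : ℝ)).exp)
      (smooth_mdiff hf x) v
    simp only [id, mul_one] at h2
    rw [hψ', conn_smul (smooth_mdiff hE x) (hφ.diffSecAt x), h2]
    module
  have h3 : Real.exp (1 / 2 * f x) ^ 2 * Real.exp (-f x) = 1 := by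
    rw [← Real.exp_nat_mul, ← Real.exp_add, Real.exp_eq_one_iff]
    push_cast
    ring
  rw [grad_sum_sq g he, grad_sum_sq g he, SpinCConnection.normSqNabla,
    SpinCConnection.normSqNabla, Finset.mul_sum, Finset.mul_sum, Finset.sum_mul, Finset.sum_mul,
    ← Finset.sum_add_distrib, ← Finset.sum_add_distrib]
  refine Finset.sum_congr rfl fun i _ => ?_
  rw [h1, norm_smul, Real.norm_of_nonneg (Real.exp_pos _).le, mul_pow, mvfderiv_normSq A hφ]
  have h4 := norm_add_sq (𝕜 := ℂ) (A.nablaP φ x (frame g x i))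
    ((1 / 2 * mvfderiv (𝓡 4) f x (frame g x i)) • φ x)
  have h5 : RCLike.re ⟪A.nablaP φ x (frame g x i),
      (1 / 2 * mvfderiv (𝓡 4) f x (frame g x i)) • φ x⟫_ℂ
      = 1 / 2 * mvfderiv (𝓡 4) f x (frame g x i) * (⟪φ x, A.nablaP φ x (frame g x i)⟫_ℂ).re := by
    have h6 := congrArg Complex.re (inner_conj_symm (𝕜 := ℂ) (A.nablaP φ x (frame g x i)) (φ x))
    rw [Complex.conj_re] at h6
    rw [← Complex.coe_smul, inner_smul_right, h6]
    exact Complex.re_ofReal_mul _ _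
  rw [h5, norm_smul, mul_pow, Real.norm_eq_abs, sq_abs] at h4
  rw [h4]
  linear_combination (‖A.nablaP φ x (frame g x i)‖ ^ 2
    + mvfderiv (𝓡 4) f x (frame g x i) * (⟪φ x, A.nablaP φ x (frame g x i)⟫_ℂ).re
    + (1 / 2 * mvfderiv (𝓡 4) f x (frame g x i)) ^ 2 * ‖φ x‖ ^ 2) * h3

variable [CompactSpace M] [MeasurableSpace M] [BorelSpace M]

theorem SpinCConnection.IsMonopole.entropy_formula (hφ : A.IsMonopole φ) (hirr : ∃ x, φ x ≠ 0)
    (hf : IsLambdaMinimizer g f) (hψ : ∀ x, ψ x = Real.exp (f x / 2) • φ x) :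
    Integrable (fun x => (4 * A.normSqNabla ψ x + Real.exp (-f x) * ‖ψ x‖ ^ 4) * Real.exp (-f x))
      (riemannianVolume g) ∧
    0 < ∫ x, ‖ψ x‖ ^ 2 * Real.exp (-f x) ∂(riemannianVolume g) ∧
    lambdaEntropy g =
      -((∫ x, (4 * A.normSqNabla ψ x + Real.exp (-f x) * ‖ψ x‖ ^ 4) * Real.exp (-f x)
          ∂(riemannianVolume g)) /
        ∫ x, ‖ψ x‖ ^ 2 * Real.exp (-f x) ∂(riemannianVolume g)) := by
  obtain ⟨x₁, hx₁⟩ := hirr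
  have : Nonempty M := ⟨x₁⟩
  have hfs := hf.1.1
  let p : M → ℝ := fun x => ‖φ x‖ ^ 2
  have hp : ContMDiff (𝓡 4) 𝓘(ℝ) ∞ p := smooth_normSq hφ.smooth
  have hexp : ∀ x, Real.exp (-f x) * Real.exp (f x) = 1 := fun x => by
    rw [← Real.exp_add]; simp
  have hden : ∀ x, ‖ψ x‖ ^ 2 * Real.exp (-f x) = p x := fun x => by
    rw [norm_exp_smul hψ]
    linear_combination p x * hexp x
  -- The Bochner formula, doubled, eliminates 4|∇φ|² + |φ|⁴. The remainder is the Euler-Lagrange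
  -- integrand for p with opposite sign.
  have hnum : ∀ x, (4 * A.normSqNabla ψ x + Real.exp (-f x) * ‖ψ x‖ ^ 4) * Real.exp (-f x)
      = 2 * laplacian g p x - (scalarCurvature g x * p x
          - 2 * g.inner x (grad g f x) (grad g p x)
          - p x * g.inner x (grad g f x) (grad g f x)) := by
    intro x
    have h1 := normSqNabla_exp_smul (A := A) hφ.smooth hfs hψ x
    have h2 := laplacian_normSq_of_isMonopole A hφ x
    have h3 : Real.exp (-f x) * ‖ψ x‖ ^ 4 * Real.exp (-f x) = ‖φ x‖ ^ 4 := by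
      have : ‖ψ x‖ ^ 4 = (‖ψ x‖ ^ 2) ^ 2 := by ring
      rw [this, norm_exp_smul hψ]
      linear_combination (‖φ x‖ ^ 4 * (Real.exp (-f x) * Real.exp (f x) + 1)) * hexp x
    simp only [p]
    linear_combination 4 * h1 + h3 - 2 * h2
  have hΔ : Continuous (laplacian g p) := (smooth_divergence g (smooth_grad g hp)).continuous
  have hcr : Continuous fun x => scalarCurvature g x * p x
      - 2 * g.inner x (grad g f x) (grad g p x) - p x * g.inner x (grad g f x) (grad g f x) :=
    (((continuous_scalarCurvature g).mul hp.continuous).sub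
      (continuous_const.mul (smooth_gradInner g hfs hp).continuous)).sub
      (hp.continuous.mul (smooth_gradInner g hfs hfs).continuous)
  have hpos : 0 < ∫ x, p x ∂(riemannianVolume g) :=
    hp.continuous.integral_pos_of_hasCompactSupport_nonneg_nonzero
      (HasCompactSupport.of_compactSpace _) (fun x => sq_nonneg _)
      (x := x₁) (pow_ne_zero 2 (norm_ne_zero_iff.2 hx₁))
  -- Attainment makes the infimum a least element, so no separate lower bound is needed for `sInf`
  -- to have its intended value.
  have hlam : lambdaEntropy g = hilbertEinstein g f :=
    IsLeast.csInf_eq ⟨⟨f, hf.1, rfl⟩, by rintro _ ⟨h, hh, rfl⟩; exact hf.2 h hh⟩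
  simp only [hden, hnum]
  refine ⟨continuous_integrable g ((continuous_const.mul hΔ).sub hcr), hpos, ?_⟩
  have hi : Integrable (fun x => 2 * laplacian g p x) (riemannianVolume g) :=
    continuous_integrable g (continuous_const.mul hΔ)
  rw [integral_sub hi (continuous_integrable g hcr), integral_const_mul, integral_laplacian g hp, ← hf.euler_lagrange hp, hlam]
  field_simp
  ring

end Monopole

end SWEntropy

end

theorem mainTheorem2
    {M : Type*} [TopologicalSpace M] [T2Space M] [CompactSpace M]
    [ChartedSpace SWEntropy.E4 M] [IsManifold (𝓡 4) ∞ M] [MeasurableSpace M] [BorelSpace M]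
    (g : SWEntropy.Metric4 M) (o : SWEntropy.Orientation4 M)
    {Wp Wm L : M → Type*}
    [∀ x, NormedAddCommGroup (Wp x)] [∀ x, InnerProductSpace ℂ (Wp x)]
    [TopologicalSpace (Bundle.TotalSpace SWEntropy.C2 Wp)] [FiberBundle SWEntropy.C2 Wp]
    [VectorBundle ℂ SWEntropy.C2 Wp] [VectorBundle ℝ SWEntropy.C2 Wp]
    [ContMDiffVectorBundle ∞ SWEntropy.C2 Wp (𝓡 4)]
    [SWEntropy.SmoothHermitian SWEntropy.C2 Wp]
    [∀ x, NormedAddCommGroup (Wm x)] [∀ x, InnerProductSpace ℂ (Wm x)]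
    [TopologicalSpace (Bundle.TotalSpace SWEntropy.C2 Wm)] [FiberBundle SWEntropy.C2 Wm]
    [VectorBundle ℂ SWEntropy.C2 Wm] [VectorBundle ℝ SWEntropy.C2 Wm]
    [ContMDiffVectorBundle ∞ SWEntropy.C2 Wm (𝓡 4)]
    [SWEntropy.SmoothHermitian SWEntropy.C2 Wm]
    [∀ x, NormedAddCommGroup (L x)] [∀ x, InnerProductSpace ℂ (L x)]
    [TopologicalSpace (Bundle.TotalSpace ℂ L)] [FiberBundle ℂ L]
    [VectorBundle ℂ ℂ L] [VectorBundle ℝ ℂ L]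
    [ContMDiffVectorBundle ∞ ℂ L (𝓡 4)] [SWEntropy.SmoothHermitian ℂ L]
    (𝔰 : SWEntropy.SpinCStructure Wp Wm L g o) (A : SWEntropy.SpinCConnection 𝔰)
    (φ : Π x : M, Wp x) (hφ : A.IsMonopole φ) (hirr : ∃ x, φ x ≠ 0)
    (f : M → ℝ) (hf : SWEntropy.IsLambdaMinimizer g f)
    (ψ : Π x : M, Wp x) (hψ : ∀ x, ψ x = Real.exp (f x / 2) • φ x) :
    A.IsWeightedMonopole f ψ ∧
    MeasureTheory.Integrable
      (fun x => (4 * A.normSqNabla ψ x + Real.exp (-f x) * ‖ψ x‖ ^ 4) * Real.exp (-f x))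
      (SWEntropy.riemannianVolume g) ∧
    0 < ∫ x, ‖ψ x‖ ^ 2 * Real.exp (-f x) ∂(SWEntropy.riemannianVolume g) ∧
    SWEntropy.lambdaEntropy g =
      -((∫ x, (4 * A.normSqNabla ψ x + Real.exp (-f x) * ‖ψ x‖ ^ 4) * Real.exp (-f x)
          ∂(SWEntropy.riemannianVolume g)) /
        ∫ x, ‖ψ x‖ ^ 2 * Real.exp (-f x) ∂(SWEntropy.riemannianVolume g)) := by
  exact ⟨hφ.isWeightedMonopole hf.1.1 hψ, hφ.entropy_formula hirr hf hψ⟩
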